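/- Let $k$ be an algebraically closed field of arbitrary characteristic, let $b\ge 4$ be an integer, and write $\Omega(b):=\Omega^1_{\mathbb P^2}\otimes\mathcal O_{\mathbb P^2}(b)$ on the projective plane $\mathbb P^2$ over $k$. For a global section $s$ of $\Omega(b)$ let $Z(s)\subset\mathbb P^2$ denote the closed subscheme defined by $s=0$. Let $Z\subset\mathbb P^2$ be a reduced $0$-dimensional closed subscheme with ideal sheaf $\mathcal I_Z$, and suppose that $\operatorname{length}\mathcal O_Z=b^2-3b+3$. Let $|\mathcal I_Z(b-1)|$ denote the linear system of all plane curves of degree $b-1$ (effective divisors) that contain $Z$ as a subscheme. Then the following two conditions are equivalent: (i) There exists a global section $s$ of $\Omega(b)$ such that $Z=Z(s)$. (ii) There exist members $C_0,C_1$ of $|\mathcal I_Z(b-1)|$ and a $0$-dimensional closed subscheme $\Gamma\subset\mathbb P^2$ with $\operatorname{length}\mathcal O_\Gamma=b-2$ such that $\Gamma$ is contained, as a subscheme, in a line disjoint from $Z$, and such that the scheme-theoretic intersection $C_0\cap C_1$ is the union of $Z$ and $\Gamma$ (that is, the ideal sheaf of $C_0\cap C_1$ is $\mathcal I_Z\cap\mathcal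 I_\Gamma$). If these conditions are satisfied, then the global section $s$ with $Z=Z(s)$ is unique up to multiplication by a nonzero constant of $k$. -/

import Mathlib

open AlgebraicGeometry CategoryTheory HomogeneousLocalization
open scoped KaehlerDifferential

namespace PlaneForms

noncomputable section

universe u

/-- The grading of the homogeneous coordinate ring `k[X₀, X₁, X₂]` by degree. -/
abbrev grading (k : Type u) [Field k] : ℕ → Submodule k (MvPolynomial (Fin 3) k) :=
  MvPolynomial.homogeneousSubmodule (Fin 3) k

instance gradedAlgebra (k : Type u) [Field k] : GradedAlgebra (grading k) :=
  MvPolynomial.gradedAlgebra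

/-- The projective plane over `k`. -/
abbrev P2 (k : Type u) [Field k] : Scheme.{u} := Proj (grading k)

/-- The homogeneous coordinate `Xᵢ`. -/
abbrev coord (k : Type u) [Field k] (i : Fin 3) : MvPolynomial (Fin 3) k := MvPolynomial.X i

lemma coord_mem (k : Type u) [Field k] (i : Fin 3) : coord k i ∈ grading k 1 :=
  MvPolynomial.isHomogeneous_X k i

/-! ### The standard affine charts -/

/-- The degree zero part of `k[X₀, X₁, X₂][1/f]`, which is the coordinate ring of `D₊(f)`. -/
abbrev Chart (k : Type u) [Field k] (f : MvPolynomial (Fin 3) k) : Type u := Away (grading k) f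

/-- The constants in the coordinate ring of `D₊(f)`. -/
def constHom (k : Type u) [Field k] (f : MvPolynomial (Fin 3) k) : k →+* Chart k f :=
  (algebraMap (grading k 0) (Chart k f)).comp (algebraMap k (grading k 0))

instance chartAlgebra (k : Type u) [Field k] (f : MvPolynomial (Fin 3) k) :
    Algebra k (Chart k f) where
  algebraMap := constHom k f
  commutes' _ _ := mul_comm _ _
  smul_def' c x := by
    apply HomogeneousLocalization.val_injective
    rw [HomogeneousLocalization.val_smul, HomogeneousLocalization.val_mul]
    change _ = Localization.mk (algebraMap k (MvPolynomial (Fin 3) k) c) 1 * _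
    rw [Localization.mk_one_eq_algebraMap, ← Algebra.smul_def, algebraMap_smul]

/-- The coordinate ring of `D₊(XᵢXⱼ) = D₊(Xᵢ) ∩ D₊(Xⱼ)`. -/
abbrev Overlap (k : Type u) [Field k] (i j : Fin 3) : Type u := Chart k (coord k i * coord k j)

/-- Restriction of functions from `D₊(Xᵢ)` to `D₊(XᵢXⱼ)`. -/
def resLeft (k : Type u) [Field k] (i j : Fin 3) : Chart k (coord k i) →ₐ[k] Overlap k i j where
  __ := awayMap (grading k) (coord_mem k j) (f := coord k i) (x := coord k i * coord k j) rfl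
  commutes' c := awayMap_fromZeroRingHom _ _ _ (algebraMap k (grading k 0) c)

/-- Restriction of functions from `D₊(Xⱼ)` to `D₊(XᵢXⱼ)`. -/
def resRight (k : Type u) [Field k] (i j : Fin 3) : Chart k (coord k j) →ₐ[k] Overlap k i j where
  __ := awayMap (grading k) (coord_mem k i) (f := coord k j) (x := coord k i * coord k j)
    (mul_comm _ _)
  commutes' c := awayMap_fromZeroRingHom _ _ _ (algebraMap k (grading k 0) c)

/-- The function `Xᵢ / Xⱼ = Xᵢ² / (XᵢXⱼ)` on `D₊(XᵢXⱼ)`. -/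
def coordRatio (k : Type u) [Field k] (i j : Fin 3) : Overlap k i j :=
  Away.mk (grading k) (SetLike.mul_mem_graded (coord_mem k i) (coord_mem k j)) 1
    (coord k i * coord k i)
    (by simpa using SetLike.mul_mem_graded (coord_mem k i) (coord_mem k i))

/-- The function `F / Xᵢ ^ d` on `D₊(Xᵢ)`, for `F` homogeneous of degree `d`. -/
def dehomogenize (k : Type u) [Field k] {d : ℕ} (F : grading k d) (i : Fin 3) :
    Chart k (coord k i) :=
  Away.mk (grading k) (coord_mem k i) d (F : MvPolynomial (Fin 3) k) (by simp)

/-! ### Global sections of `Ω¹(b)` and their zero schemes -/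

/-- The map of Kähler differentials induced by a homomorphism of `k`-algebras. -/
def kaehlerMap {k A B : Type u} [Field k] [CommRing A] [CommRing B] [Algebra k A] [Algebra k B]
    (f : A →ₐ[k] B) : Ω[A⁄k] →ₗ[k] Ω[B⁄k] :=
  letI : Algebra A B := f.toRingHom.toAlgebra
  haveI : IsScalarTower k A B := IsScalarTower.of_algebraMap_eq' f.comp_algebraMap.symm
  (KaehlerDifferential.map k k A B).restrictScalars k

lemma kaehler_smul_comm {k A : Type u} [Field k] [CommRing A] [Algebra k A] (a : A) (c : k)
    (x : Ω[A⁄k]) : a • c • x = c • a • x := by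
  rw [← algebraMap_smul A c x, ← algebraMap_smul A c (a • x), smul_smul, smul_smul, mul_comm]

/-- The space `H⁰(ℙ², Ω¹(b))`. On `D₊(Xᵢ)` the sheaf `𝒪(b)` is free on `Xᵢ ^ b`, so that a section
of `Ω¹(b)` there is `ωᵢ ⊗ Xᵢ ^ b` with `ωᵢ` a differential form on `D₊(Xᵢ)`. A global section is a
triple of such local sections that agree on the overlaps:
`(Xᵢ / Xⱼ) ^ b • ωᵢ = ωⱼ` on `D₊(XᵢXⱼ)`. -/
def OmegaSections (k : Type u) [Field k] (b : ℕ) :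
    Submodule k (∀ i : Fin 3, Ω[Chart k (coord k i)⁄k]) where
  carrier := {ω | ∀ i j, coordRatio k i j ^ b • kaehlerMap (resLeft k i j) (ω i) =
    kaehlerMap (resRight k i j) (ω j)}
  add_mem' {ω η} hω hη i j := by
    simp only [Pi.add_apply, map_add, smul_add]
    rw [hω i j, hη i j]
  zero_mem' i j := by simp
  smul_mem' c ω hω i j := by
    simp only [Pi.smul_apply, map_smul]
    rw [kaehler_smul_comm, hω i j]

/-- The open subset `D₊(Xᵢ)` of the projective plane, as an affine open. -/
def chartOpen (k : Type u) [Field k] (i : Fin 3) : (P2 k).affineOpens :=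
  ⟨Proj.basicOpen (grading k) (coord k i),
    Proj.isAffineOpen_basicOpen (grading k) (coord k i) (coord_mem k i) one_pos⟩

/-- The ideal of a closed subscheme on `D₊(Xᵢ)`, in terms of the canonical isomorphism from
`Chart k (coord k i)` to the ring of functions on `D₊(Xᵢ)`. -/
def chartIdeal {k : Type u} [Field k] (Z : (P2 k).IdealSheafData) (i : Fin 3) :
    Ideal (Chart k (coord k i)) :=
  (Z.ideal (chartOpen k i)).comap (Proj.awayToSection (grading k) (coord k i)).hom

/-- The ideal defining the zero scheme of a section `ω` of a locally free module `M`: it is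
the image of the map from the dual of `M` to the ring given by evaluation at `ω`. -/
def zeroIdeal {A M : Type u} [CommRing A] [AddCommGroup M] [Module A M] (ω : M) : Ideal A :=
  LinearMap.range (Module.Dual.eval A M ω)

/-- `Z = Z(s)`: the closed subscheme with ideal sheaf `Z` is the subscheme of the projective plane
defined by `s = 0`. -/
def IsZeroScheme {k : Type u} [Field k] {b : ℕ} (s : OmegaSections k b)
    (Z : (P2 k).IdealSheafData) : Prop :=
  ∀ i, chartIdeal Z i = zeroIdeal (s.1 i)

/-! ### Curves and finite subschemes -/

/-- `C` is (the ideal sheaf of) the plane curve `F = 0`, for a nonzero homogeneous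
polynomial `F` of degree `d`. -/
def IsCurve {k : Type u} [Field k] (C : (P2 k).IdealSheafData) (d : ℕ) : Prop :=
  ∃ F : grading k d, F ≠ 0 ∧ ∀ i, chartIdeal C i = Ideal.span {dehomogenize k F i}

/-- The linear system `|𝓘_Z(d)|`: the plane curves of degree `d` containing `Z`. -/
def linearSystem {k : Type u} [Field k] (Z : (P2 k).IdealSheafData) (d : ℕ) :
    Set (P2 k).IdealSheafData :=
  {C | IsCurve C d ∧ C ≤ Z}

/-- The structure morphism to `Spec k` of a closed subscheme of the projective plane. -/
def structureMorphism {k : Type u} [Field k] (Z : (P2 k).IdealSheafData) :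
    Z.subscheme ⟶ Spec (CommRingCat.of k) :=
  Z.subschemeι ≫ Proj.toSpecZero (grading k) ≫
    Spec.map (CommRingCat.ofHom (algebraMap k (grading k 0)))

/-- The length of `𝒪_Z`, for a `0`-dimensional closed subscheme `Z` of the projective plane over an
algebraically closed field `k`, is the dimension over `k` of `H⁰(Z, 𝒪_Z)`. -/
def length {k : Type u} [Field k] (Z : (P2 k).IdealSheafData) : ℕ :=
  letI : Algebra k Γ(Z.subscheme, ⊤) :=
    ((Scheme.ΓSpecIso (CommRingCat.of k)).inv ≫ (structureMorphism Z).appTop).hom.toAlgebra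
  Module.finrank k Γ(Z.subscheme, ⊤)

/-- The closed subscheme is `0`-dimensional. -/
def IsZeroDimensional {k : Type u} [Field k] (Z : (P2 k).IdealSheafData) : Prop :=
  topologicalKrullDim Z.subscheme = 0

end

end PlaneForms

namespace PlaneForms

noncomputable section

universe u

open MvPolynomial

/-! ### Homogeneous polynomials as functions on the charts -/

section

/-! Put d = b - 1. By the Euler sequence a section of Ω(b) is a triple F of forms of degree d with Σ
XₙFₙ = 0 (`exists_eq_sectionOfForm`), and its zero scheme is cut out by the Fₙ
(`zeroIdeal_sectionOfForm`). The triple stands for Σ Fₙ dXₙ, so it can be rewritten in any linear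
coordinates y₀, y₁, y₂, with components G satisfying y₀G₀ + y₁G₁ + y₂G₂ = 0. If the line y₂ = 0
misses Z, the relation on this line becomes y₀G₀ + y₁G₁ = 0, so that G₀ = y₁g and G₁ = -y₀g there,
with g of degree d - 1 (`Frame.exists_comp_eq`). All three claims rest on this normal form.

From sections to curves (`exists_linked`): a line missing Z exists because k is infinite. Since y₂G₂
lies in (G₀, G₁), and (G₀, G₁, G₂) and (G₀, G₁, y₂) are comaximal on every chart, (G₀, G₁) is their
intersection there. So the curves G₀ = 0 and G₁ = 0 meet in the union of Z and the scheme g = 0 on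
the line, of length d - 1 = b - 2.

From curves to sections (`exists_section_of_linked`): Γ is the intersection of both curves with the
line, so the equations of the curves restrict to the line with a common divisor c of degree d - 1,
and the restricted pencil is c times all linear forms. A change of basis (`exists_pencil`) gives g₀
= y₁c and g₁ = -y₀c on the line, hence y₀g₀ + y₁g₁ = y₂H, and (g₀, g₁, -H) is a section. Its zero
scheme misses the line, by a local syzygy argument at a point of Γ (`mem_of_linked`). Off the line
y₂ is invertible, so H lies in (g₀, g₁) and the zero scheme is Z (`map_span_eq_of_linked`).

Uniqueness (`Frame.exists_eq_smul`): the syzygies of G on the line all lift to the plane, so the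
ideal (F) is saturated with respect to y₂ (`Frame.mem_span_of_mul_mem`). If F' has the same zero
scheme, its entries lie in (F) and, having the same degree, are constant combinations of the Fₙ. The
Euler relation for F' is then a linear syzygy of F. As g has degree at least 2, the Euler relation
is the only one up to scalars (`Frame.linear_relation`). -/

lemma aeval_mul_of_isHomogeneous {σ R A : Type*} [CommRing R] [CommRing A] [Algebra R A]
    {F : MvPolynomial σ R} {d : ℕ} (hF : F.IsHomogeneous d) (w : A) (g : σ → A) :
    aeval (fun i => w * g i) F = w ^ d * aeval g F := by
  rw [F.as_sum, map_sum, map_sum, Finset.mul_sum]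
  refine Finset.sum_congr rfl fun m hm => ?_
  rw [aeval_monomial, aeval_monomial]
  have h : m.degree = d := by
    by_contra hne
    exact (MvPolynomial.mem_support_iff.mp hm) (hF.coeff_eq_zero hne)
  have : (m.prod fun i n => (w * g i) ^ n) = w ^ d * m.prod fun i n => g i ^ n := by
    rw [← h, Finsupp.degree_apply]
    simp only [Finsupp.prod, mul_pow, Finset.prod_mul_distrib, Finset.prod_pow_eq_pow_sum]
  rw [this]
  ring

variable {k : Type u} [Field k] {f : MvPolynomial (Fin 3) k} (hf : f ∈ grading k 1)

/-- The inclusion of the coordinate ring of `D₊(f)` in the localization away from `f`. -/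
def valHom (f : MvPolynomial (Fin 3) k) : Chart k f →ₐ[k] Localization.Away f where
  __ := algebraMap (Chart k f) (Localization.Away f)
  commutes' c := by
    change Localization.mk (algebraMap k (MvPolynomial (Fin 3) k) c) 1 = _
    rw [Localization.mk_one_eq_algebraMap]
    rfl

lemma valHom_apply (x : Chart k f) : valHom f x = x.val := rfl

/-- The map sending a homogeneous polynomial `F` of degree `d` to the function `F / f ^ d` on
`D₊(f)`, where `f` is a linear form. -/
def toChart : MvPolynomial (Fin 3) k →ₐ[k] Chart k f :=
  aeval fun n => Away.mk (grading k) hf 1 (X n) (by simpa using coord_mem k n)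

/-- `toChart` is dehomogenization, an algebra map defined on all polynomials that sends `f` to 1; it
divides by `f ^ d` only on forms of degree `d`. -/
lemma val_toChart {F : MvPolynomial (Fin 3) k} {d : ℕ} (hF : F ∈ grading k d) :
    (toChart hf F).val = IsLocalization.Away.invSelf f ^ d * algebraMap _ _ F := by
  rw [← valHom_apply, toChart, comp_aeval_apply]
  have h : algebraMap _ (Localization.Away f) F =
      aeval (fun n => algebraMap _ (Localization.Away f) (X n : MvPolynomial (Fin 3) k)) F := by
    conv_lhs => rw [← aeval_X_left_apply F (R := k)]
    exact (aeval_algebraMap_apply _ _ _).symm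
  rw [h, ← aeval_mul_of_isHomogeneous ((mem_homogeneousSubmodule _ _).mp hF)]
  congr 2
  ext n
  simp only [valHom_apply, Away.val_mk, Localization.mk_eq_mk',
    IsLocalization.Away.invSelf]
  rw [← IsLocalization.mk'_one (M := Submonoid.powers f) (Localization.Away f) (X n : MvPolynomial (Fin 3) k),
    ← IsLocalization.mk'_mul]
  simp

lemma toChart_of_mem {F : MvPolynomial (Fin 3) k} {d : ℕ} (hF : F ∈ grading k d) :
    toChart hf F = Away.mk (grading k) hf d F (by simpa using hF) := by
  apply HomogeneousLocalization.val_injective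
  rw [val_toChart hf hF, Away.val_mk, Localization.mk_eq_mk', IsLocalization.Away.invSelf,
    ← IsLocalization.mk'_one (M := Submonoid.powers f) (Localization.Away f) F, ← IsLocalization.mk'_pow,
    ← IsLocalization.mk'_mul]
  simp

lemma toChart_self : toChart hf f = 1 := by
  apply HomogeneousLocalization.val_injective
  rw [val_toChart hf hf, HomogeneousLocalization.val_one, pow_one, mul_comm]
  exact IsLocalization.Away.mul_invSelf f

lemma exists_toChart_eq (a : Chart k f) : ∃ d, ∃ F ∈ grading k d, toChart hf F = a := by
  obtain ⟨n, F, hF, rfl⟩ := Away.mk_surjective (grading k) hf a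
  have hF' : F ∈ grading k n := by simpa using hF
  exact ⟨n, F, hF', toChart_of_mem hf hF'⟩

lemma toChart_eq_iff {F G : MvPolynomial (Fin 3) k} {d e : ℕ} (hF : F ∈ grading k d)
    (hG : G ∈ grading k e) :
    toChart hf F = toChart hf G ↔ ∃ n, f ^ n * (f ^ e * F) = f ^ n * (f ^ d * G) := by
  rw [toChart_of_mem hf hF, toChart_of_mem hf hG,
    ← (HomogeneousLocalization.val_injective _).eq_iff, Away.val_mk, Away.val_mk,
    Localization.mk_eq_mk_iff, Localization.r_iff_exists]
  constructor
  · rintro ⟨⟨_, n, rfl⟩, h⟩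
    exact ⟨n, h⟩
  · rintro ⟨n, h⟩
    exact ⟨⟨_, n, rfl⟩, h⟩

lemma toChart_pow_mul (n : ℕ) (F : MvPolynomial (Fin 3) k) :
    toChart hf (f ^ n * F) = toChart hf F := by
  rw [map_mul, map_pow, toChart_self, one_pow, one_mul]

lemma exists_of_mem_map_toChart {J : Ideal (MvPolynomial (Fin 3) k)}
    (hJ : J.IsHomogeneous (grading k)) {a : Chart k f} (ha : a ∈ J.map (toChart hf)) :
    ∃ d, ∃ E ∈ grading k d, E ∈ J ∧ toChart hf E = a := by
  have hadd : ∀ a b : Chart k f, (∃ d, ∃ E ∈ grading k d, E ∈ J ∧ toChart hf E = a) →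
      (∃ d, ∃ E ∈ grading k d, E ∈ J ∧ toChart hf E = b) →
      ∃ d, ∃ E ∈ grading k d, E ∈ J ∧ toChart hf E = a + b := by
    rintro _ _ ⟨d, E, hE, hEJ, rfl⟩ ⟨d', E', hE', hEJ', rfl⟩
    -- Powers of `f` bring both representatives to the same degree without changing their images.
    refine ⟨d + d', f ^ d' * E + f ^ d * E', ?_, J.add_mem (J.mul_mem_left _ hEJ)
      (J.mul_mem_left _ hEJ'), by simp [toChart_self]⟩
    refine Submodule.add_mem _ ?_ ?_
    · have := SetLike.mul_mem_graded (SetLike.pow_mem_graded d' hf) hE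
      simpa [add_comm] using this
    · have := SetLike.mul_mem_graded (SetLike.pow_mem_graded d hf) hE'
      simpa [add_comm] using this
  rw [Ideal.map] at ha
  induction ha using Submodule.span_induction with
  | mem x hx =>
    obtain ⟨G, hG, rfl⟩ := hx
    have hc : ∀ s : Finset ℕ, ∃ d, ∃ E ∈ grading k d, E ∈ J ∧
        toChart hf E = ∑ i ∈ s, toChart hf (homogeneousComponent i G) := by
      intro s
      induction s using Finset.cons_induction with
      | empty => exact ⟨0, 0, zero_mem _, J.zero_mem, by simp⟩
      | cons i s hi ih =>
        rw [Finset.sum_cons]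
        exact hadd _ _ ⟨i, _, homogeneousComponent_mem _ _,
          homogeneousComponent_mem_of_mem hJ hG i, rfl⟩ ih
    have := hc (Finset.range (G.totalDegree + 1))
    rwa [← map_sum, sum_homogeneousComponent] at this
  | zero => exact ⟨0, 0, zero_mem _, J.zero_mem, by simp⟩
  | add x y _ _ hx hy => exact hadd _ _ hx hy
  | smul a x _ hx =>
    obtain ⟨d, E, hE, hEJ, rfl⟩ := hx
    obtain ⟨e, B, hB, rfl⟩ := exists_toChart_eq hf a
    exact ⟨e + d, B * E, SetLike.mul_mem_graded hB hE, J.mul_mem_left _ hEJ, by simp⟩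

/-- The basic dictionary: the ideal on the chart sees `J` up to saturation by `f`. -/
lemma toChart_mem_map_iff {J : Ideal (MvPolynomial (Fin 3) k)}
    (hJ : J.IsHomogeneous (grading k)) {F : MvPolynomial (Fin 3) k} {d : ℕ}
    (hF : F ∈ grading k d) :
    toChart hf F ∈ J.map (toChart hf) ↔ ∃ n, f ^ n * F ∈ J := by
  constructor
  · intro h
    obtain ⟨e, E, hE, hEJ, h⟩ := exists_of_mem_map_toChart hf hJ h
    obtain ⟨n, h⟩ := (toChart_eq_iff hf hE hF).mp h
    refine ⟨n + e, ?_⟩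
    rw [pow_add, mul_assoc, ← h]
    exact J.mul_mem_left _ (J.mul_mem_left _ hEJ)
  · rintro ⟨n, h⟩
    rw [← toChart_pow_mul hf n F]
    exact Ideal.mem_map_of_mem _ h

lemma map_toChart_eq_top_iff {J : Ideal (MvPolynomial (Fin 3) k)}
    (hJ : J.IsHomogeneous (grading k)) :
    J.map (toChart hf) = ⊤ ↔ ∃ n, f ^ n ∈ J := by
  rw [Ideal.eq_top_iff_one, ← map_one (toChart hf),
    toChart_mem_map_iff hf hJ (SetLike.one_mem_graded _)]
  simp

/-- Evaluation of the functions on `D₊(f)` along a homomorphism taking the value `1` at `f`. -/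
def evalChart {B : Type*} [CommRing B] [Algebra k B] (θ : MvPolynomial (Fin 3) k →ₐ[k] B)
    (hθ : θ f = 1) : Chart k f →ₐ[k] B where
  __ := (Localization.awayLift θ.toRingHom f (by simp [hθ])).comp
    (algebraMap (Chart k f) (Localization.Away f))
  commutes' c := by
    have h : (algebraMap (Chart k f) (Localization.Away f)) (algebraMap k (Chart k f) c) =
        algebraMap _ _ (C c : MvPolynomial (Fin 3) k) := (valHom f).commutes c
    change Localization.awayLift θ.toRingHom f (by simp [hθ]) (algebraMap _ _ (algebraMap k (Chart k f) c)) = _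
    rw [h]
    exact (IsLocalization.Away.lift_eq _ _ _).trans (θ.commutes c)

@[simp]
lemma evalChart_toChart {B : Type*} [CommRing B] [Algebra k B]
    (θ : MvPolynomial (Fin 3) k →ₐ[k] B) (hθ : θ f = 1) (F : MvPolynomial (Fin 3) k) :
    evalChart θ hθ (toChart hf F) = θ F := by
  have : (evalChart θ hθ).comp (toChart hf) = θ := by
    ext n
    change Localization.awayLift θ.toRingHom f (by simp [hθ]) (toChart hf (X n)).val = _
    rw [val_toChart hf (coord_mem k n), pow_one, map_mul]
    have h1 : Localization.awayLift θ.toRingHom f (by simp [hθ])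
        (algebraMap _ (Localization.Away f) f) = 1 :=
      (IsLocalization.Away.lift_eq _ _ _).trans hθ
    have h2 : Localization.awayLift θ.toRingHom f (by simp [hθ])
        (IsLocalization.Away.invSelf (S := Localization.Away f) f) = 1 := by
      have h := congrArg (Localization.awayLift θ.toRingHom f (by simp [hθ]))
        (IsLocalization.Away.mul_invSelf (S := Localization.Away f) f)
      rwa [map_mul, map_one, h1, one_mul] at h
    rw [h2, one_mul]
    exact IsLocalization.Away.lift_eq _ _ _
  exact DFunLike.congr_fun this F

end

/-! ### Frames of linear forms -/

section

/-- A system of linear coordinates on the projective plane: the rows of `M` are the coefficients of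
three linear forms, and `N` is the inverse matrix. -/
structure Frame (k : Type u) [Field k] where
  M : Matrix (Fin 3) (Fin 3) k
  N : Matrix (Fin 3) (Fin 3) k
  mul_eq_one : M * N = 1

/-- The linear form with the given coefficients. -/
def linForm {k : Type u} [Field k] (a : Fin 3 → k) : MvPolynomial (Fin 3) k := ∑ n, C (a n) * X n

lemma linForm_mem {k : Type u} [Field k] (a : Fin 3 → k) : linForm a ∈ grading k 1 :=
  Submodule.sum_mem _ fun _ _ => isHomogeneous_C_mul_X _ _

lemma exists_eq_linForm {k : Type u} [Field k] {f : MvPolynomial (Fin 3) k}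
    (hf : f ∈ grading k 1) : ∃ a, f = linForm a := by
  rw [grading, homogeneousSubmodule_one_eq_span_X, Submodule.mem_span_range_iff_exists_fun] at hf
  obtain ⟨a, rfl⟩ := hf
  exact ⟨a, by simp [linForm, MvPolynomial.smul_eq_C_mul]⟩

lemma linForm_injective {k : Type u} [Field k] : Function.Injective (linForm (k := k)) := by
  intro a b h
  ext n
  have := congrArg (MvPolynomial.coeff (Finsupp.single n 1)) h
  simpa [linForm, coeff_sum, coeff_C_mul, coeff_X, Finsupp.single_left_inj] using this

/-- The hypothesis puts the coordinates in the radical of `J`, hence also their linear combinations.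
It is the algebraic form of "`J` has no zeros in the plane". -/
lemma linForm_pow_mem {k : Type u} [Field k] {J : Ideal (MvPolynomial (Fin 3) k)}
    (h : ∀ i, ∃ n, coord k i ^ n ∈ J) (a : Fin 3 → k) : ∃ n, linForm a ^ n ∈ J := by
  have : linForm a ∈ J.radical := by
    refine Ideal.sum_mem _ fun i _ => Ideal.mul_mem_left _ _ ?_
    obtain ⟨n, hn⟩ := h i
    exact ⟨n, hn⟩
  exact this

namespace Frame

variable {k : Type u} [Field k] (E : Frame k)

lemma mul_eq_one' : E.N * E.M = 1 := mul_eq_one_comm.mp E.mul_eq_one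

lemma sum_M_mul_N (a b : Fin 3) : ∑ n, E.M a n * E.N n b = if a = b then 1 else 0 := by
  have := congrFun (congrFun E.mul_eq_one a) b
  rwa [Matrix.mul_apply, Matrix.one_apply] at this

lemma sum_N_mul_M (a b : Fin 3) : ∑ n, E.N a n * E.M n b = if a = b then 1 else 0 := by
  have := congrFun (congrFun E.mul_eq_one' a) b
  rwa [Matrix.mul_apply, Matrix.one_apply] at this

/-- The coordinates of the frame. -/
def form (a : Fin 3) : MvPolynomial (Fin 3) k := linForm (E.M a)

lemma form_mem (a : Fin 3) : E.form a ∈ grading k 1 := linForm_mem _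

lemma coord_eq (n : Fin 3) : coord k n = ∑ a, C (E.N n a) * E.form a := by
  simp only [form, linForm, Finset.mul_sum, ← mul_assoc, ← C_mul]
  rw [Finset.sum_comm]
  simp only [← Finset.sum_mul, ← map_sum, E.sum_N_mul_M]
  simp

/-- Restriction of polynomials to the line given by the last coordinate of the frame. -/
def restrict : MvPolynomial (Fin 3) k →ₐ[k] MvPolynomial (Fin 2) k :=
  aeval fun n => C (E.N n 0) * X 0 + C (E.N n 1) * X 1

/-- Substitution of the first two coordinates of the frame. -/
def lift : MvPolynomial (Fin 2) k →ₐ[k] MvPolynomial (Fin 3) k :=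
  aeval ![E.form 0, E.form 1]

lemma restrict_form (a : Fin 3) : E.restrict (E.form a) = ![X 0, X 1, 0] a := by
  have : E.restrict (E.form a) = C (∑ n, E.M a n * E.N n 0) * X 0 +
      C (∑ n, E.M a n * E.N n 1) * X 1 := by
    simp only [form, linForm, restrict, map_sum, map_mul, algHom_C, aeval_X, Finset.sum_mul,
      ← Finset.sum_add_distrib]
    refine Finset.sum_congr rfl fun n _ => ?_
    simp only [MvPolynomial.algebraMap_eq]
    ring
  rw [this, E.sum_M_mul_N, E.sum_M_mul_N]
  fin_cases a <;> simp

@[simp] lemma restrict_form_zero : E.restrict (E.form 0) = X 0 := E.restrict_form 0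
@[simp] lemma restrict_form_one : E.restrict (E.form 1) = X 1 := E.restrict_form 1
@[simp] lemma restrict_form_two : E.restrict (E.form 2) = 0 := E.restrict_form 2

@[simp]
lemma restrict_lift (p : MvPolynomial (Fin 2) k) : E.restrict (E.lift p) = p := by
  have : E.restrict.comp E.lift = AlgHom.id k _ := by
    ext n
    fin_cases n <;> simp [lift]
  exact DFunLike.congr_fun this p

lemma sub_lift_restrict_mem (F : MvPolynomial (Fin 3) k) :
    F - E.lift (E.restrict F) ∈ Ideal.span {E.form 2} := by
  rw [← Ideal.Quotient.mk_eq_mk_iff_sub_mem]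
  have : (Ideal.Quotient.mkₐ k (Ideal.span {E.form 2})) =
      ((Ideal.Quotient.mkₐ k (Ideal.span {E.form 2})).comp E.lift).comp E.restrict := by
    ext n
    simp only [AlgHom.comp_apply, restrict, aeval_X, map_add, map_mul, lift, Matrix.cons_val_zero,
      Matrix.cons_val_one]
    have h := E.coord_eq n
    rw [coord] at h
    rw [h, Fin.sum_univ_three, map_add, map_add]
    have h2 : Ideal.Quotient.mkₐ k (Ideal.span {E.form 2}) (C (E.N n 2) * E.form 2) = 0 :=
      Ideal.Quotient.eq_zero_iff_mem.mpr
        (Ideal.mul_mem_left _ _ (Ideal.mem_span_singleton_self _))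
    rw [h2, add_zero, map_mul, map_mul]
    simp [MvPolynomial.algHom_C]
  exact DFunLike.congr_fun this F

lemma restrict_eq_zero_iff {F : MvPolynomial (Fin 3) k} : E.restrict F = 0 ↔ E.form 2 ∣ F := by
  constructor
  · intro h
    have := E.sub_lift_restrict_mem F
    rwa [h, map_zero, sub_zero, Ideal.mem_span_singleton] at this
  · rintro ⟨G, rfl⟩
    simp

lemma restrict_mem {F : MvPolynomial (Fin 3) k} {d : ℕ} (hF : F ∈ grading k d) :
    (E.restrict F).IsHomogeneous d := by
  have := ((mem_homogeneousSubmodule _ _).mp hF).aeval (n := 1)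
    (fun n => C (E.N n 0) * X 0 + C (E.N n 1) * X 1 : Fin 3 → MvPolynomial (Fin 2) k)
    fun n => (isHomogeneous_C_mul_X _ _).add (isHomogeneous_C_mul_X _ _)
  rwa [one_mul] at this

lemma form_two_ne_zero : E.form 2 ≠ 0 := by
  intro h
  have h0 : E.M 2 = 0 := linForm_injective (h.trans (by simp [linForm]))
  have := E.sum_M_mul_N 2 2
  simp [h0] at this

/-- Restriction of polynomials to the affine part of the line given by the last coordinate of the
frame, with affine coordinate the quotient of the first two coordinates. -/
def restrictAffine : MvPolynomial (Fin 3) k →ₐ[k] Polynomial k :=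
  (aeval ![Polynomial.X, 1]).comp E.restrict

lemma restrictAffine_apply (F : MvPolynomial (Fin 3) k) :
    E.restrictAffine F = aeval ![Polynomial.X, 1] (E.restrict F) := rfl

@[simp] lemma restrictAffine_form_zero : E.restrictAffine (E.form 0) = Polynomial.X := by
  simp [restrictAffine]
@[simp] lemma restrictAffine_form_one : E.restrictAffine (E.form 1) = 1 := by
  simp [restrictAffine]
@[simp] lemma restrictAffine_form_two : E.restrictAffine (E.form 2) = 0 := by
  simp [restrictAffine]

/-- A binary form is recovered from its dehomogenization. Homogeneity is essential: `E.form 1 - 1`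
also restricts to 0. -/
lemma dvd_of_restrictAffine_eq_zero {F : MvPolynomial (Fin 3) k} {d : ℕ} (hF : F ∈ grading k d)
    (h : E.restrictAffine F = 0) : E.form 2 ∣ F := by
  rw [← E.restrict_eq_zero_iff,
    ← Polynomial.homogenize_eq_of_isHomogeneous (E.restrict_mem hF) h]
  simp

lemma natDegree_restrictAffine_le {F : MvPolynomial (Fin 3) k} {d : ℕ} (hF : F ∈ grading k d) :
    (E.restrictAffine F).natDegree ≤ d := by
  rw [restrictAffine_apply, (E.restrict F).as_sum, map_sum]
  refine Polynomial.natDegree_sum_le_of_forall_le _ _ fun m hm => ?_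
  rw [aeval_monomial]
  have hd : m.degree = d := by
    by_contra hne
    exact (MvPolynomial.mem_support_iff.mp hm) ((E.restrict_mem hF).coeff_eq_zero hne)
  have : (m.prod fun i e => (![Polynomial.X, 1] : Fin 2 → Polynomial k) i ^ e) =
      Polynomial.X ^ (m 0) := by
    rw [Finsupp.prod_fintype _ _ (by simp)]
    simp
  rw [this]
  refine (Polynomial.natDegree_C_mul_X_pow_le _ _).trans ?_
  rw [← hd]
  exact Finsupp.le_degree 0 m

/-- The top coefficient is the value at the point (1 : 0), which is at infinity for the affine
coordinate; when it is nonzero, no zero of `F` on the line is lost. -/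
lemma coeff_restrictAffine {F : MvPolynomial (Fin 3) k} {d : ℕ} (hF : F ∈ grading k d) :
    (E.restrictAffine F).coeff d = MvPolynomial.eval ![1, 0] (E.restrict F) := by
  have h := Polynomial.homogenize_eq_of_isHomogeneous (E.restrict_mem hF) rfl
  rw [← h, Polynomial.homogenize, map_sum, Finset.sum_eq_single (d, 0)]
  · simp [restrictAffine_apply, MvPolynomial.eval_monomial, Finsupp.prod_fintype]
  · rintro ⟨a, b⟩ hab hne
    have hb : b ≠ 0 := by
      rintro rfl
      simp at hab
      exact hne (by simp [hab])
    simp [MvPolynomial.eval_monomial, Finsupp.prod_fintype, hb]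
  · simp

lemma exists_row_eq {a : Fin 3 → k} (ha : a ≠ 0) : ∃ E : Frame k, E.M 2 = a := by
  have key : ∀ M : Matrix (Fin 3) (Fin 3) k, M.det ≠ 0 → M 2 = a → ∃ E : Frame k, E.M 2 = a :=
    fun M hM h => ⟨⟨M, M⁻¹, M.mul_nonsing_inv (isUnit_iff_ne_zero.mpr hM)⟩, h⟩
  obtain ⟨i, hi⟩ := Function.ne_iff.mp ha
  have hr : ![a 0, a 1, a 2] = a := by ext j; fin_cases j <;> rfl
  -- The row is completed by two standard basis vectors; the determinant is `a i` up to sign.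
  fin_cases i
  · exact key !![0, 1, 0; 0, 0, 1; a 0, a 1, a 2] (by simpa [Matrix.det_fin_three] using hi) hr
  · exact key !![1, 0, 0; 0, 0, 1; a 0, a 1, a 2] (by simpa [Matrix.det_fin_three] using hi) hr
  · exact key !![1, 0, 0; 0, 1, 0; a 0, a 1, a 2] (by simpa [Matrix.det_fin_three] using hi) hr

/-- A change of coordinates on the line given by the last coordinate of the frame, taking
`(1 : 0)` to a given point. -/
lemma exists_change {p : Fin 2 → k} (hp : p ≠ 0) : ∃ (E' : Frame k) (r s : k),
    E'.M 2 = E.M 2 ∧ r * p 1 - s * p 0 = 1 ∧ (∀ n, E'.N n 0 = p 0 * E.N n 0 + p 1 * E.N n 1) ∧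
    ∀ n, E'.N n 1 = r * E.N n 0 + s * E.N n 1 := by
  obtain ⟨r, s, h⟩ : ∃ r s : k, r * p 1 - s * p 0 = 1 := by
    by_cases h1 : p 1 = 0
    · have h0 : p 0 ≠ 0 := fun h0 => hp (by ext j; fin_cases j <;> simp [h0, h1])
      exact ⟨0, -(p 0)⁻¹, by simp [h1, h0]⟩
    · exact ⟨(p 1)⁻¹, 0, by simp [h1]⟩
  -- `P` has the points `p` and `(r, s)` as its first columns and determinant -1, and `Q` is its
  -- inverse.
  let P : Matrix (Fin 3) (Fin 3) k := !![p 0, r, 0; p 1, s, 0; 0, 0, 1]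
  let Q : Matrix (Fin 3) (Fin 3) k := !![-s, r, 0; p 1, -p 0, 0; 0, 0, 1]
  have hQP : Q * P = 1 := by
    ext i j
    fin_cases i <;> fin_cases j <;> simp [Q, P, Matrix.mul_apply, Fin.sum_univ_three] <;>
      first | linear_combination h | ring
  refine ⟨⟨Q * E.M, E.N * P, ?_⟩, r, s, ?_, h, fun n => ?_, fun n => ?_⟩
  · rw [Matrix.mul_assoc, ← Matrix.mul_assoc E.M, E.mul_eq_one, Matrix.one_mul, hQP]
  · ext j
    simp [Q, Matrix.mul_apply, Fin.sum_univ_three]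
  · simp [P, Matrix.mul_apply, Fin.sum_univ_three, mul_comm]
  · simp [P, Matrix.mul_apply, Fin.sum_univ_three, mul_comm]

lemma eval_restrict (F : MvPolynomial (Fin 3) k) (p : Fin 2 → k) :
    MvPolynomial.eval p (E.restrict F) =
      MvPolynomial.eval (fun n => p 0 * E.N n 0 + p 1 * E.N n 1) F := by
  rw [restrict, ← MvPolynomial.coe_aeval_eq_eval, ← MvPolynomial.coe_aeval_eq_eval]
  simp only [RingHom.coe_coe]
  rw [comp_aeval_apply]
  congr 2
  ext n
  simp [mul_comm]

/-- A frame with given last coordinate in which a form that is not divisible by that coordinate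
does not vanish at the point `(1 : 0)` of the line. -/
lemma exists_coeff_ne_zero [Infinite k] {F : MvPolynomial (Fin 3) k} {d : ℕ} (hd : d ≠ 0)
    (hF : F ∈ grading k d) (h : ¬ E.form 2 ∣ F) :
    ∃ E' : Frame k, E'.M 2 = E.M 2 ∧ (E'.restrictAffine F).coeff d ≠ 0 := by
  have h0 : E.restrict F ≠ 0 := fun h0 => h (E.restrict_eq_zero_iff.mp h0)
  obtain ⟨p, hp⟩ : ∃ p, MvPolynomial.eval p (E.restrict F) ≠ 0 := by
    by_contra! hp
    exact h0 ((E.restrict_mem hF).eq_zero_of_forall_eval_eq_zero hp)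
  have hp0 : p ≠ 0 := by
    rintro rfl
    have : MvPolynomial.eval 0 (E.restrict F) = 0 := by
      rw [MvPolynomial.eval_zero, MvPolynomial.constantCoeff_eq]
      exact (E.restrict_mem hF).coeff_eq_zero (by simpa using hd.symm)
    exact hp this
  obtain ⟨E', r, s, hM, -, hN, -⟩ := E.exists_change hp0
  refine ⟨E', hM, ?_⟩
  rw [E'.coeff_restrictAffine hF, eval_restrict]
  rw [eval_restrict] at hp
  convert! hp using 3
  ext n
  simp [hN]

end Frame

end

/-! ### Forms in a frame -/

section

/-! ### Syzygies of binary forms -/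

section Binary

variable {k : Type u} [Field k]

lemma isRelPrime_X_zero_X_one : IsRelPrime (X 0 : MvPolynomial (Fin 2) k) (X 1) := by
  rw [(X_prime (i := (0 : Fin 2)) (R := k)).irreducible.isRelPrime_iff_not_dvd, X_dvd_X]
  simp

/-- Relations between the components of a form restricted to a line. -/
lemma exists_of_binary_relation {g m₀ m₁ a₀ a₁ a₂ : MvPolynomial (Fin 2) k} (hg : g ≠ 0)
    (hrel : IsRelPrime g (-X 0 * m₀ - X 1 * m₁))
    (h : a₀ * (X 1 * g) + a₁ * (-X 0 * g) + a₂ * (-X 0 * m₀ - X 1 * m₁) = 0) :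
    ∃ e t, a₀ = X 0 * t + e * m₁ ∧ a₁ = X 1 * t - e * m₀ ∧ a₂ = g * e := by
  -- Modulo `g` only the third term survives, and its factor is prime to `g`. What is left is a
  -- relation between X₁ and -X₀, whose syzygies are the multiples of (X₀, X₁).
  obtain ⟨e, rfl⟩ : g ∣ a₂ := by
    refine hrel.dvd_of_dvd_mul_right ⟨-(a₀ * X 1) + a₁ * X 0, ?_⟩
    linear_combination h
  have h1 : X 1 * (a₀ - e * m₁) = X 0 * (a₁ + e * m₀) := by
    apply mul_left_cancel₀ hg
    linear_combination h
  obtain ⟨t, ht⟩ : (X 0 : MvPolynomial (Fin 2) k) ∣ a₀ - e * m₁ :=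
    isRelPrime_X_zero_X_one.dvd_of_dvd_mul_left ⟨_, h1⟩
  refine ⟨e, t, by linear_combination ht, ?_, rfl⟩
  rw [ht] at h1
  have : X 0 * (X 1 * t) = X 0 * (a₁ + e * m₀) := by rw [← h1]; ring
  linear_combination -(mul_left_cancel₀ (X_ne_zero (0 : Fin 2)) this)

end Binary

namespace Frame

variable {k : Type u} [Field k] (E : Frame k)

/-- The components of a form with respect to a frame. -/
def comp (F : Fin 3 → MvPolynomial (Fin 3) k) (a : Fin 3) : MvPolynomial (Fin 3) k :=
  ∑ n, C (E.N n a) * F n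

/-- The form with given components with respect to a frame. -/
def ofComp (G : Fin 3 → MvPolynomial (Fin 3) k) (n : Fin 3) : MvPolynomial (Fin 3) k :=
  ∑ a, C (E.M a n) * G a

lemma comp_ofComp (G : Fin 3 → MvPolynomial (Fin 3) k) : E.comp (E.ofComp G) = G := by
  ext1 a
  simp only [comp, ofComp, Finset.mul_sum, ← mul_assoc, ← C_mul]
  rw [Finset.sum_comm]
  simp only [← Finset.sum_mul, ← map_sum]
  have : ∀ c, ∑ n, E.N n a * E.M c n = if c = a then 1 else 0 := fun c => by
    rw [← E.sum_M_mul_N]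
    exact Finset.sum_congr rfl fun _ _ => mul_comm _ _
  simp [this]

lemma ofComp_comp (F : Fin 3 → MvPolynomial (Fin 3) k) : E.ofComp (E.comp F) = F := by
  ext1 n
  simp only [comp, ofComp, Finset.mul_sum, ← mul_assoc, ← C_mul]
  rw [Finset.sum_comm]
  simp only [← Finset.sum_mul, ← map_sum]
  have : ∀ c, ∑ a, E.M a n * E.N c a = if c = n then 1 else 0 := fun c => by
    rw [← E.sum_N_mul_M]
    exact Finset.sum_congr rfl fun _ _ => mul_comm _ _
  simp [this]

/-- `E.comp F` lists the coefficients of Σ Fₙ dXₙ with respect to the differentials of the frame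
coordinates, so contraction with the Euler field gives the same polynomial. -/
lemma sum_form_mul_comp (F : Fin 3 → MvPolynomial (Fin 3) k) :
    ∑ a, E.form a * E.comp F a = ∑ n, X n * F n := by
  have : ∀ n, (X n : MvPolynomial (Fin 3) k) * F n =
      ∑ a, E.form a * (C (E.N n a) * F n) := fun n => by
    have := E.coord_eq n
    rw [coord] at this
    rw [this, Finset.sum_mul]
    exact Finset.sum_congr rfl fun _ _ => by ring
  simp only [this, comp, Finset.mul_sum]
  exact Finset.sum_comm

lemma sum_X_mul_ofComp (G : Fin 3 → MvPolynomial (Fin 3) k) :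
    ∑ n, X n * E.ofComp G n = ∑ a, E.form a * G a := by
  rw [← E.sum_form_mul_comp, comp_ofComp]

lemma comp_mem {F : Fin 3 → MvPolynomial (Fin 3) k} {d : ℕ} (hF : ∀ n, F n ∈ grading k d)
    (a : Fin 3) : E.comp F a ∈ grading k d :=
  Submodule.sum_mem _ fun n _ => by
    rw [C_mul']
    exact Submodule.smul_mem _ _ (hF n)

lemma ofComp_mem {F : Fin 3 → MvPolynomial (Fin 3) k} {d : ℕ} (hF : ∀ n, F n ∈ grading k d)
    (a : Fin 3) : E.ofComp F a ∈ grading k d :=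
  Submodule.sum_mem _ fun n _ => by
    rw [C_mul']
    exact Submodule.smul_mem _ _ (hF n)

lemma span_range_comp (F : Fin 3 → MvPolynomial (Fin 3) k) :
    Ideal.span (Set.range (E.comp F)) = Ideal.span (Set.range F) := by
  apply le_antisymm
  · rw [Ideal.span_le]
    rintro _ ⟨a, rfl⟩
    exact Ideal.sum_mem _ fun n _ => Ideal.mul_mem_left _ _ (Ideal.subset_span ⟨n, rfl⟩)
  · rw [Ideal.span_le]
    rintro _ ⟨n, rfl⟩
    rw [← E.ofComp_comp F]
    refine Ideal.sum_mem _ fun a _ => Ideal.mul_mem_left _ _ (Ideal.subset_span ⟨a, ?_⟩)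
    rw [ofComp_comp]

lemma X_dvd_lift (F : MvPolynomial (Fin 3) k) :
    ∃ m, F = E.lift (E.restrict F) + E.form 2 * m := by
  obtain ⟨m, hm⟩ := Ideal.mem_span_singleton.mp (E.sub_lift_restrict_mem F)
  exact ⟨m, by rw [← hm]; ring⟩

@[simp] lemma lift_X_zero : E.lift (X 0) = E.form 0 := by simp [lift]
@[simp] lemma lift_X_one : E.lift (X 1) = E.form 1 := by simp [lift]

/-- The shape of the components of a form that does not vanish on the line given by the last
coordinate of the frame. -/
lemma exists_comp_eq {F : Fin 3 → MvPolynomial (Fin 3) k}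
    (hF : ∑ n, X n * F n = 0)
    (hdisj : ∀ i, ∃ n, coord k i ^ n ∈ Ideal.span (insert (E.form 2) (Set.range F))) :
    ∃ (g : MvPolynomial (Fin 2) k) (m₀ m₁ : MvPolynomial (Fin 3) k), g ≠ 0 ∧
      IsRelPrime g (-X 0 * E.restrict m₀ - X 1 * E.restrict m₁) ∧
      E.comp F 0 = E.form 1 * E.lift g + E.form 2 * m₀ ∧
      E.comp F 1 = -E.form 0 * E.lift g + E.form 2 * m₁ ∧
      E.comp F 2 = -E.form 0 * m₀ - E.form 1 * m₁ := by
  have hrel := (E.sum_form_mul_comp F).trans hF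
  rw [Fin.sum_univ_three] at hrel
  have h1 := congrArg E.restrict hrel
  simp only [map_add, map_mul, restrict_form_zero, restrict_form_one, restrict_form_two,
    zero_mul, add_zero, map_zero] at h1
  -- On the line the Euler relation reads X₀a₀ + X₁a₁ = 0.
  obtain ⟨g, hg⟩ : (X 1 : MvPolynomial (Fin 2) k) ∣ E.restrict (E.comp F 0) :=
    isRelPrime_X_zero_X_one.symm.dvd_of_dvd_mul_left
      ⟨-E.restrict (E.comp F 1), by linear_combination h1⟩
  have hg' : E.restrict (E.comp F 1) = -X 0 * g := by
    apply mul_left_cancel₀ (X_ne_zero (R := k) (1 : Fin 2))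
    rw [hg] at h1
    linear_combination h1
  obtain ⟨m₀, h₀⟩ := E.X_dvd_lift (E.comp F 0)
  obtain ⟨m₁, h₁⟩ := E.X_dvd_lift (E.comp F 1)
  rw [hg, map_mul, lift_X_one] at h₀
  rw [hg', map_mul, map_neg, lift_X_zero] at h₁
  have h₂ : E.comp F 2 = -E.form 0 * m₀ - E.form 1 * m₁ := by
    apply mul_left_cancel₀ E.form_two_ne_zero
    rw [h₀, h₁] at hrel
    linear_combination hrel
  have h₂' := congrArg E.restrict h₂
  simp only [map_sub, map_mul, map_neg, restrict_form_zero, restrict_form_one] at h₂'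
  -- All components restrict into the ideal of `g` and the restricted third component. Since powers
  -- of all linear forms lie in the ideal upstairs, a common divisor of these two divides a power of
  -- X₀ and a power of X₁.
  have hle : ∀ p ∈ Ideal.span (insert (E.form 2) (Set.range F)),
      E.restrict p ∈ Ideal.span {g, -X 0 * E.restrict m₀ - X 1 * E.restrict m₁} := by
    rw [Ideal.span_insert, ← E.span_range_comp F, ← Ideal.span_insert]
    intro p hp
    rw [← Ideal.mem_comap]
    refine (Ideal.span_le (I := Ideal.comap E.restrict _)).mpr ?_ hp
    rintro _ (rfl | ⟨a, rfl⟩)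
    · simp
    · rw [SetLike.mem_coe, Ideal.mem_comap]
      fin_cases a
      · simp only [Fin.zero_eta, hg]
        exact Ideal.mul_mem_left _ _ (Ideal.subset_span (by simp))
      · simp only [Fin.mk_one, hg']
        exact Ideal.mul_mem_left _ _ (Ideal.subset_span (by simp))
      · simp only [Fin.reduceFinMk, h₂']
        exact Ideal.subset_span (by simp)
  have hprime : IsRelPrime g (-X 0 * E.restrict m₀ - X 1 * E.restrict m₁) := by
    intro c hc hc'
    obtain ⟨n₀, hn₀⟩ := linForm_pow_mem hdisj (E.M 0)
    obtain ⟨n₁, hn₁⟩ := linForm_pow_mem hdisj (E.M 1)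
    have hc2 : ∀ p ∈ Ideal.span {g, -X 0 * E.restrict m₀ - X 1 * E.restrict m₁}, c ∣ p := by
      intro p hp
      rw [← Ideal.mem_span_singleton]
      refine Ideal.span_le.mpr ?_ hp
      rintro _ (rfl | rfl)
      · exact Ideal.mem_span_singleton.mpr hc
      · exact Ideal.mem_span_singleton.mpr hc'
    have e₀ := hc2 _ (hle _ hn₀)
    have e₁ := hc2 _ (hle _ hn₁)
    rw [map_pow] at e₀ e₁
    change c ∣ E.restrict (E.form 0) ^ _ at e₀
    change c ∣ E.restrict (E.form 1) ^ _ at e₁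
    rw [restrict_form_zero] at e₀
    rw [restrict_form_one] at e₁
    exact (isRelPrime_X_zero_X_one.pow) e₀ e₁
  refine ⟨g, m₀, m₁, ?_, hprime, h₀, h₁, h₂⟩
  -- If `g` were 0, coprimality would make the other polynomial a unit, but its constant term is 0.
  rintro rfl
  rw [isRelPrime_zero_left] at hprime
  have := hprime.map (MvPolynomial.constantCoeff (R := k))
  simp at this

/-- A polynomial whose product with a line disjoint from the zero scheme of a form lies in the
ideal of the form lies itself in this ideal. -/
lemma mem_span_of_mul_mem {F : Fin 3 → MvPolynomial (Fin 3) k}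
    (hF : ∑ n, X n * F n = 0)
    (hdisj : ∀ i, ∃ n, coord k i ^ n ∈ Ideal.span (insert (E.form 2) (Set.range F)))
    {h : MvPolynomial (Fin 3) k} (hh : E.form 2 * h ∈ Ideal.span (Set.range F)) :
    h ∈ Ideal.span (Set.range F) := by
  obtain ⟨g, m₀, m₁, hg, hrel, h₀, h₁, h₂⟩ := E.exists_comp_eq hF hdisj
  rw [← E.span_range_comp] at hh ⊢
  obtain ⟨A, hA⟩ := (Ideal.mem_span_range_iff_exists_fun).mp hh
  rw [Fin.sum_univ_three, h₀, h₁, h₂] at hA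
  have hA' := congrArg E.restrict hA
  simp only [map_add, map_mul, map_sub, map_neg, restrict_form_zero, restrict_form_one,
    restrict_form_two, zero_mul, add_zero, restrict_lift] at hA'
  -- Restricted to the line, the coefficients `A` form a syzygy, a combination of (X₀, X₁, 0) and
  -- (m₁, -m₀, g); subtracting a lift of it leaves multiples of `E.form 2`.
  obtain ⟨e, t, e₀, e₁, e₂⟩ := exists_of_binary_relation hg hrel hA'
  obtain ⟨n₀, hn₀⟩ := E.X_dvd_lift (A 0 - (E.form 0 * E.lift t + E.lift e * m₁))
  obtain ⟨n₁, hn₁⟩ := E.X_dvd_lift (A 1 - (E.form 1 * E.lift t - E.lift e * m₀))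
  obtain ⟨n₂, hn₂⟩ := E.X_dvd_lift (A 2 - E.lift g * E.lift e)
  have z₀ : E.restrict (A 0 - (E.form 0 * E.lift t + E.lift e * m₁)) = 0 := by simp [e₀]
  have z₁ : E.restrict (A 1 - (E.form 1 * E.lift t - E.lift e * m₀)) = 0 := by simp [e₁]
  have z₂ : E.restrict (A 2 - E.lift g * E.lift e) = 0 := by simp [e₂]
  rw [z₀, map_zero, zero_add] at hn₀
  rw [z₁, map_zero, zero_add] at hn₁
  rw [z₂, map_zero, zero_add] at hn₂
  rw [Ideal.mem_span_range_iff_exists_fun]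
  -- The lift of (m₁, -m₀, g) is an exact syzygy upstairs. The lift of (X₀, X₁, 0) is the Euler
  -- relation without its last term, which accounts for the correction by `E.lift t`.
  refine ⟨![n₀, n₁, n₂ - E.lift t], ?_⟩
  rw [Fin.sum_univ_three, h₀, h₁, h₂]
  simp only [Matrix.cons_val_zero, Matrix.cons_val_one, Matrix.cons_val]
  apply mul_left_cancel₀ E.form_two_ne_zero
  rw [← hA]
  rw [sub_eq_iff_eq_add] at hn₀ hn₁ hn₂
  rw [hn₀, hn₁, hn₂]
  ring

end Frame

end

/-! ### Uniqueness of forms -/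

section

/-- This is `linForm_pow_mem` for the colon ideal (J : p). -/
lemma linForm_pow_mul_mem {k : Type u} [Field k] {J : Ideal (MvPolynomial (Fin 3) k)}
    {p : MvPolynomial (Fin 3) k} (h : ∀ i, ∃ n, coord k i ^ n * p ∈ J) (a : Fin 3 → k) :
    ∃ n, linForm a ^ n * p ∈ J :=
  linForm_pow_mem (J := Submodule.comap (LinearMap.toSpanSingleton _ _ p) J) h a

/-- In degree `d` only the constant terms of the coefficients contribute. -/
lemma exists_const_of_mem_span {k : Type u} [Field k] {d : ℕ}
    {F : Fin 3 → MvPolynomial (Fin 3) k} (hF : ∀ n, F n ∈ grading k d)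
    {p : MvPolynomial (Fin 3) k} (hp : p ∈ grading k d) (h : p ∈ Ideal.span (Set.range F)) :
    ∃ c : Fin 3 → k, ∑ n, C (c n) * F n = p := by
  obtain ⟨A, hA⟩ := (Ideal.mem_span_range_iff_exists_fun).mp h
  refine ⟨fun n => (A n).coeff 0, ?_⟩
  have h1 := congrArg (fun q => (DirectSum.decompose (grading k) q d : MvPolynomial (Fin 3) k)) hA
  simp only [DirectSum.decompose_sum, DirectSum.decompose_of_mem_same _ hp] at h1
  rw [← h1, DirectSum.sum_apply, AddSubmonoidClass.coe_finsetSum]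
  refine Finset.sum_congr rfl fun n _ => ?_
  rw [DirectSum.coe_decompose_mul_of_right_mem_of_le _ (hF n) le_rfl, Nat.sub_self]
  congr 1
  rw [← homogeneousComponent_zero]
  exact (decomposition.decompose'_apply (A n) 0).symm

namespace Frame

variable {k : Type u} [Field k] (E : Frame k)

/-- The third coefficient is a multiple of `g` of smaller degree, so it is 0 and only the syzygy
(X₀, X₁, 0) remains. -/
lemma eq_zero_of_binary_relation {g m₀ m₁ a₀ a₁ a₂ : MvPolynomial (Fin 2) k} (hg : g ≠ 0)
    (hrel : IsRelPrime g (-X 0 * m₀ - X 1 * m₁))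
    (h : a₀ * (X 1 * g) + a₁ * (-X 0 * g) + a₂ * (-X 0 * m₀ - X 1 * m₁) = 0)
    (hdeg : a₂.totalDegree < g.totalDegree) :
    a₂ = 0 ∧ ∃ t, a₀ = X 0 * t ∧ a₁ = X 1 * t := by
  obtain ⟨e, t, e₀, e₁, e₂⟩ := exists_of_binary_relation hg hrel h
  have he : e = 0 := by
    by_contra he
    rw [e₂, totalDegree_mul_of_isDomain hg he] at hdeg
    omega
  subst he
  exact ⟨by simpa using e₂, t, by simpa using e₀, by simpa using e₁⟩

/-- The Euler relation is the only linear syzygy up to scalars. The bound `3 ≤ d` makes the degree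
of `g`, which is `d - 1`, exceed that of a linear form on the line. -/
lemma linear_relation {F : Fin 3 → MvPolynomial (Fin 3) k} {d : ℕ} (hd : 3 ≤ d)
    (hFd : ∀ n, F n ∈ grading k d) (hF : ∑ n, X n * F n = 0)
    (hdisj : ∀ i, ∃ n, coord k i ^ n ∈ Ideal.span (insert (E.form 2) (Set.range F)))
    {c : Fin 3 → Fin 3 → k}
    (h : ∑ a, E.form a * ∑ n, C (c a n) * E.comp F n = 0) :
    ∀ a n, c a n = if a = n then c 0 0 else 0 := by
  obtain ⟨g, m₀, m₁, hg, hrel, h₀, h₁, h₂⟩ := E.exists_comp_eq hF hdisj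
  have hsum := (E.sum_form_mul_comp F).trans hF
  have r₀ : E.restrict (E.comp F 0) = X 1 * g := by simp [h₀]
  have r₁ : E.restrict (E.comp F 1) = -X 0 * g := by simp [h₁]
  have r₂ : E.restrict (E.comp F 2) = -X 0 * E.restrict m₀ - X 1 * E.restrict m₁ := by simp [h₂]
  have hdeg : 2 ≤ g.totalDegree := by
    have h1 := (E.restrict_mem (E.comp_mem hFd 0)).totalDegree
      (by rw [r₀]; exact mul_ne_zero (X_ne_zero _) hg)
    rw [r₀, totalDegree_mul_of_isDomain (X_ne_zero _) hg, totalDegree_X] at h1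
    omega
  simp only [Fin.sum_univ_three] at h hsum
  have h' := congrArg E.restrict h
  simp only [map_add, map_mul, restrict_form_zero, restrict_form_one, restrict_form_two, zero_mul,
    add_zero, map_zero, algHom_C, MvPolynomial.algebraMap_eq, r₀, r₁, r₂] at h'
  obtain ⟨e₂, t, e₀, e₁⟩ := eq_zero_of_binary_relation (a₀ := C (c 0 0) * X 0 + C (c 1 0) * X 1)
    (a₁ := C (c 0 1) * X 0 + C (c 1 1) * X 1) (a₂ := C (c 0 2) * X 0 + C (c 1 2) * X 1) hg hrel
    (by linear_combination h') (by
      refine lt_of_le_of_lt (IsHomogeneous.totalDegree_le (n := 1) ?_) hdeg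
      exact (isHomogeneous_C_mul_X _ _).add (isHomogeneous_C_mul_X _ _))
  have e₃ : (X 1 : MvPolynomial (Fin 2) k) * (C (c 0 0) * X 0 + C (c 1 0) * X 1) =
      X 0 * (C (c 0 1) * X 0 + C (c 1 1) * X 1) := by
    rw [e₀, e₁]; ring
  have c10 : c 1 0 = 0 := by simpa using congrArg (MvPolynomial.eval ![0, 1]) e₃
  have c01 : c 0 1 = 0 := by simpa using (congrArg (MvPolynomial.eval ![1, 0]) e₃).symm
  have c11 : c 1 1 = c 0 0 := by
    simpa [c10, c01] using (congrArg (MvPolynomial.eval ![1, 1]) e₃).symm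
  have c02 : c 0 2 = 0 := by simpa using congrArg (MvPolynomial.eval ![1, 0]) e₂
  have c12 : c 1 2 = 0 := by simpa using congrArg (MvPolynomial.eval ![0, 1]) e₂
  rw [c10, c01, c11, c02, c12] at h
  -- Once `c 0 0` times the Euler relation is subtracted, only terms divisible by `E.form 2` are
  -- left; cancelling it gives a relation with constant coefficients, treated on the line in the
  -- same way.
  have h3 : C (c 2 0) * E.comp F 0 + C (c 2 1) * E.comp F 1 +
      C (c 2 2 - c 0 0) * E.comp F 2 = 0 := by
    apply mul_left_cancel₀ E.form_two_ne_zero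
    simp only [C_sub, C_0] at h ⊢
    linear_combination h - C (c 0 0) * hsum
  have h3' := congrArg E.restrict h3
  simp only [map_add, map_mul, map_zero, algHom_C, MvPolynomial.algebraMap_eq, r₀, r₁, r₂] at h3'
  obtain ⟨f₂, s, f₀, f₁⟩ := eq_zero_of_binary_relation hg hrel h3' (by
    rw [totalDegree_C]; omega)
  have c20 : c 2 0 = 0 := by simpa using congrArg (MvPolynomial.eval ![0, 0]) f₀
  have c21 : c 2 1 = 0 := by simpa using congrArg (MvPolynomial.eval ![0, 0]) f₁
  have c22 : c 2 2 = c 0 0 := by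
    simpa [sub_eq_zero] using congrArg (MvPolynomial.eval ![0, 0]) f₂
  intro a n
  fin_cases a <;> fin_cases n <;> simp [c10, c01, c11, c02, c12, c20, c21, c22]

/-- A form of degree at least three is determined by its zero scheme up to a scalar, provided that
this zero scheme is disjoint from a line. -/
lemma exists_eq_smul {F F' : Fin 3 → MvPolynomial (Fin 3) k} {d : ℕ} (hd : 3 ≤ d)
    (hFd : ∀ n, F n ∈ grading k d) (hF : ∑ n, X n * F n = 0)
    (hFd' : ∀ n, F' n ∈ grading k d) (hF' : ∑ n, X n * F' n = 0)
    (hdisj : ∀ i, ∃ n, coord k i ^ n ∈ Ideal.span (insert (E.form 2) (Set.range F)))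
    (hmem : ∀ n i, ∃ m, coord k i ^ m * F' n ∈ Ideal.span (Set.range F)) :
    ∃ c : k, F' = c • F := by
  -- The entries of `F'` lie in (F) up to a power of `E.form 2`, which is removed one factor at a
  -- time.
  have hspan : ∀ n, F' n ∈ Ideal.span (Set.range F) := by
    intro n
    obtain ⟨m, hm⟩ := linForm_pow_mul_mem (hmem n) (E.M 2)
    change E.form 2 ^ m * _ ∈ _ at hm
    induction m with
    | zero => simpa using hm
    | succ m ih =>
      rw [pow_succ', mul_assoc] at hm
      exact ih (E.mem_span_of_mul_mem hF hdisj hm)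
  have hcomp : ∀ a, ∃ c : Fin 3 → k, ∑ n, C (c n) * E.comp F n = E.comp F' a := by
    intro a
    refine exists_const_of_mem_span (E.comp_mem hFd) (E.comp_mem hFd' a) ?_
    rw [E.span_range_comp]
    exact Ideal.sum_mem _ fun n _ => Ideal.mul_mem_left _ _ (hspan n)
  choose c hc using hcomp
  -- The Euler relation for `F'` forces the constant matrix `c` to be scalar.
  obtain ⟨t, ht⟩ : ∃ t : k, ∀ a n, c a n = if a = n then t else 0 :=
    ⟨c 0 0, E.linear_relation hd hFd hF hdisj (c := c) (by
    simp only [hc]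
    exact (E.sum_form_mul_comp F').trans hF')⟩
  refine ⟨t, ?_⟩
  rw [← E.ofComp_comp F', ← E.ofComp_comp F]
  have : E.comp F' = fun a => C t * E.comp F a := by
    ext1 a
    rw [← hc]
    rw [Finset.sum_eq_single a (fun n _ hn => by simp [ht, hn.symm]) (by simp), ht, if_pos rfl]
  ext1 n
  rw [this, Pi.smul_apply, ofComp, ofComp, Finset.smul_sum]
  refine Finset.sum_congr rfl fun a _ => ?_
  rw [MvPolynomial.smul_eq_C_mul]
  ring

end Frame

end

/-! ### Differential forms on the charts -/

section

section KaehlerMap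

variable {k A B : Type u} [Field k] [CommRing A] [CommRing B] [Algebra k A] [Algebra k B]

lemma kaehlerMap_D (f : A →ₐ[k] B) (a : A) :
    kaehlerMap f (KaehlerDifferential.D k A a) = KaehlerDifferential.D k B (f a) := by
  let : Algebra A B := f.toRingHom.toAlgebra
  have : IsScalarTower k A B := IsScalarTower.of_algebraMap_eq' f.comp_algebraMap.symm
  exact KaehlerDifferential.map_D k k A B a

lemma kaehlerMap_smul (f : A →ₐ[k] B) (a : A) (x : Ω[A⁄k]) :
    kaehlerMap f (a • x) = f a • kaehlerMap f x := by
  let : Algebra A B := f.toRingHom.toAlgebra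
  have : IsScalarTower k A B := IsScalarTower.of_algebraMap_eq' f.comp_algebraMap.symm
  exact (map_smul (KaehlerDifferential.map k k A B) a x).trans (algebraMap_smul B a _).symm

lemma kaehlerMap_surjective {f : A →ₐ[k] B} (hf : Function.Surjective f) :
    Function.Surjective (kaehlerMap f) := by
  intro x
  have hx : x ∈ Submodule.span B (Set.range (KaehlerDifferential.D k B)) := by
    rw [KaehlerDifferential.span_range_derivation]; trivial
  induction hx using Submodule.span_induction with
  | mem x hx =>
    obtain ⟨b, rfl⟩ := hx
    obtain ⟨a, rfl⟩ := hf b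
    exact ⟨_, kaehlerMap_D f a⟩
  | zero => exact ⟨0, map_zero _⟩
  | add x y _ _ hx hy =>
    obtain ⟨x, rfl⟩ := hx
    obtain ⟨y, rfl⟩ := hy
    exact ⟨x + y, map_add _ _ _⟩
  | smul b x _ hx =>
    obtain ⟨x, rfl⟩ := hx
    obtain ⟨a, rfl⟩ := hf b
    exact ⟨a • x, kaehlerMap_smul f a x⟩

end KaehlerMap

variable {k : Type u} [Field k]

/-- The coordinate function `Xⱼ / Xᵢ` on `D₊(Xᵢ)`. -/
def affineCoord (i j : Fin 3) : Chart k (coord k i) := toChart (coord_mem k i) (X j)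

@[simp]
lemma affineCoord_self (i : Fin 3) : affineCoord (k := k) i i = 1 := toChart_self (coord_mem k i)

/-- The affine coordinates identify `D₊(Xᵢ)` with an affine space. -/
def polyToChart (i : Fin 3) : MvPolynomial {m : Fin 3 // m ≠ i} k →ₐ[k] Chart k (coord k i) :=
  aeval fun m => affineCoord i m

/-- The inverse of `polyToChart`. -/
def chartToPoly (i : Fin 3) : Chart k (coord k i) →ₐ[k] MvPolynomial {m : Fin 3 // m ≠ i} k :=
  evalChart (aeval fun n => if h : n = i then 1 else X ⟨n, h⟩) (by simp)

lemma chartToPoly_polyToChart (i : Fin 3) (p) : chartToPoly (k := k) i (polyToChart i p) = p := by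
  have : (chartToPoly (k := k) i).comp (polyToChart i) = AlgHom.id k _ := by
    ext m
    simp [polyToChart, chartToPoly, affineCoord, m.2]
  exact DFunLike.congr_fun this p

lemma polyToChart_surjective (i : Fin 3) : Function.Surjective (polyToChart (k := k) i) := by
  intro a
  obtain ⟨d, F, -, rfl⟩ := exists_toChart_eq (coord_mem k i) a
  refine ⟨aeval (fun n => if h : n = i then 1 else X ⟨n, h⟩) F, ?_⟩
  rw [comp_aeval_apply, toChart]
  congr 2
  ext1 n
  by_cases h : n = i
  · subst h
    simp only [dite_true, map_one]
    exact (affineCoord_self n).symm.trans (aeval_X _ _)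
  · simp only [h, dite_false, polyToChart, aeval_X]
    exact (aeval_X _ _)

lemma linearIndependent_D_affineCoord (i : Fin 3) :
    LinearIndependent (Chart k (coord k i)) fun m : {m : Fin 3 // m ≠ i} =>
      KaehlerDifferential.D k (Chart k (coord k i)) (affineCoord i m) := by
  rw [Fintype.linearIndependent_iff]
  intro g hg m
  have h := congrArg (kaehlerMap (chartToPoly i)) hg
  simp only [map_sum, kaehlerMap_smul, kaehlerMap_D, map_zero] at h
  have hX : ∀ m : {m : Fin 3 // m ≠ i}, chartToPoly (k := k) i (affineCoord i m) = X m := fun m => by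
    simp [chartToPoly, affineCoord, m.2]
  simp only [hX, ← KaehlerDifferential.mvPolynomialBasis_apply] at h
  have h2 := (Fintype.linearIndependent_iff.mp
    (KaehlerDifferential.mvPolynomialBasis k {m : Fin 3 // m ≠ i}).linearIndependent) _ h m
  obtain ⟨p, hp⟩ := polyToChart_surjective i (g m)
  rw [← hp, chartToPoly_polyToChart] at h2
  rw [← hp, h2, map_zero]

lemma span_D_affineCoord (i : Fin 3) :
    ⊤ ≤ Submodule.span (Chart k (coord k i)) (Set.range fun m : {m : Fin 3 // m ≠ i} =>
      KaehlerDifferential.D k (Chart k (coord k i)) (affineCoord i m)) := by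
  rintro x -
  obtain ⟨y, rfl⟩ := kaehlerMap_surjective (polyToChart_surjective i) x
  rw [← (KaehlerDifferential.mvPolynomialBasis k {m : Fin 3 // m ≠ i}).sum_repr y, map_sum]
  refine Submodule.sum_mem _ fun m _ => ?_
  rw [kaehlerMap_smul, KaehlerDifferential.mvPolynomialBasis_apply, kaehlerMap_D]
  refine Submodule.smul_mem _ _ (Submodule.subset_span ⟨m, ?_⟩)
  simp [polyToChart]

/-- The differentials of the affine coordinates form a basis. -/
def chartBasis (i : Fin 3) : Module.Basis {m : Fin 3 // m ≠ i} (Chart k (coord k i))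
    Ω[Chart k (coord k i)⁄k] :=
  .mk (linearIndependent_D_affineCoord i) (span_D_affineCoord i)

lemma chartBasis_apply (i : Fin 3) (m : {m : Fin 3 // m ≠ i}) :
    chartBasis (k := k) i m = KaehlerDifferential.D k _ (affineCoord i m) := by
  simp [chartBasis]

/-- The differential form with given components. -/
def chartForm (i : Fin 3) (a : Fin 3 → Chart k (coord k i)) : Ω[Chart k (coord k i)⁄k] :=
  ∑ m, a m • KaehlerDifferential.D k (Chart k (coord k i)) (affineCoord i m)

lemma chartForm_eq (i : Fin 3) (a : Fin 3 → Chart k (coord k i)) :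
    chartForm i a = ∑ m : {m : Fin 3 // m ≠ i}, a m • chartBasis i m := by
  simp only [chartBasis_apply]
  rw [chartForm, ← Fintype.sum_subtype_add_sum_subtype (fun m => m ≠ i), add_eq_left]
  refine Finset.sum_eq_zero fun m _ => ?_
  rw [not_ne_iff.mp m.2, affineCoord_self]
  simp

/-- The component with index `i` multiplies d1 = 0, so it is free; it is chosen to make the Euler
relation hold. -/
lemma exists_chartForm_eq (i : Fin 3) (ω : Ω[Chart k (coord k i)⁄k]) :
    ∃ a, ∑ m, a m * affineCoord i m = 0 ∧ chartForm i a = ω := by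
  have h := (chartBasis i).sum_repr ω
  let c : Fin 3 → Chart k (coord k i) := fun m =>
    if h : m = i then 0 else (chartBasis i).repr ω ⟨m, h⟩
  let a : Fin 3 → Chart k (coord k i) := fun m =>
    if m = i then - ∑ n, c n * affineCoord i n else c m
  refine ⟨a, ?_, ?_⟩
  · have : ∀ m, a m = c m - if m = i then ∑ n, c n * affineCoord i n else 0 := fun m => by
      by_cases hm : m = i <;> simp [a, c, hm]
    simp [this, sub_mul]
  · rw [chartForm_eq]
    conv_rhs => rw [← h]
    refine Finset.sum_congr rfl fun m _ => ?_
    simp [a, c, m.2]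

/-- The components other than the `i`-th are coordinates in a basis, and the Euler relation puts the
`i`-th one in the ideal they generate. -/
lemma zeroIdeal_chartForm (i : Fin 3) {a : Fin 3 → Chart k (coord k i)}
    (ha : ∑ m, a m * affineCoord i m = 0) :
    zeroIdeal (chartForm i a) = Ideal.span (Set.range a) := by
  have hne : ∀ m ≠ i, a m ∈ zeroIdeal (chartForm i a) := by
    intro m hm
    refine ⟨(chartBasis i).coord ⟨m, hm⟩, ?_⟩
    rw [Module.Dual.eval_apply, chartForm_eq, map_sum, Finset.sum_eq_single ⟨m, hm⟩]
    · simp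
    · intro n _ hn
      simp [hn]
    · simp
  apply le_antisymm
  · rintro _ ⟨φ, rfl⟩
    rw [Module.Dual.eval_apply, chartForm, map_sum]
    refine Ideal.sum_mem _ fun m _ => ?_
    rw [map_smul, smul_eq_mul]
    exact Ideal.mul_mem_right _ _ (Ideal.subset_span ⟨m, rfl⟩)
  · rw [Ideal.span_le]
    rintro _ ⟨m, rfl⟩
    by_cases hm : m = i
    · subst hm
      have : a m = - ∑ n ∈ Finset.univ.erase m, a n * affineCoord m n := by
        rw [← Finset.add_sum_erase _ _ (Finset.mem_univ m), affineCoord_self, mul_one] at ha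
        exact eq_neg_of_add_eq_zero_left ha
      rw [SetLike.mem_coe, this]
      exact neg_mem (Ideal.sum_mem _ fun n hn =>
        Ideal.mul_mem_right _ _ (hne n (Finset.ne_of_mem_erase hn)))
    · exact hne m hm

end

/-! ### Global sections and forms -/

section

variable {k : Type u} [Field k]

lemma resRight_toChart (i j : Fin 3) {F : MvPolynomial (Fin 3) k} {d : ℕ} (hF : F ∈ grading k d) :
    resRight k i j (toChart (coord_mem k j) F) =
      coordRatio k i j ^ d * resLeft k i j (toChart (coord_mem k i) F) := by
  rw [toChart_of_mem _ hF, toChart_of_mem _ hF]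
  change awayMap (grading k) (coord_mem k i) (mul_comm _ _) _ =
    _ * awayMap (grading k) (coord_mem k j) rfl _
  rw [awayMap_mk, awayMap_mk]
  apply HomogeneousLocalization.val_injective
  rw [HomogeneousLocalization.val_mul, HomogeneousLocalization.val_pow, coordRatio, Away.val_mk,
    Away.val_mk, Away.val_mk, Localization.mk_pow, Localization.mk_mul, Localization.mk_eq_mk_iff,
    Localization.r_iff_exists]
  refine ⟨1, ?_⟩
  simp only [OneMemClass.coe_one, SubmonoidClass.coe_pow, Submonoid.coe_mul]
  ring

lemma resRight_affineCoord (i j m : Fin 3) :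
    resRight k i j (affineCoord j m) = coordRatio k i j * resLeft k i j (affineCoord i m) := by
  rw [affineCoord, resRight_toChart i j (coord_mem k m), pow_one]
  rfl

lemma coordRatio_mul_resLeft (i j : Fin 3) :
    coordRatio k i j * resLeft k i j (affineCoord i j) = 1 := by
  rw [← resRight_affineCoord, affineCoord_self, map_one]

lemma coordRatio_eq (i j : Fin 3) : coordRatio k i j = resRight k i j (affineCoord j i) := by
  rw [resRight_affineCoord, affineCoord_self, map_one, mul_one]

lemma isUnit_coordRatio (i j : Fin 3) : IsUnit (coordRatio k i j) :=
  .of_mul_eq_one _ (coordRatio_mul_resLeft i j)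

lemma toChart_coord_injective (i : Fin 3) {F : MvPolynomial (Fin 3) k} {d : ℕ}
    (hF : F ∈ grading k d) (h : toChart (coord_mem k i) F = 0) : F = 0 := by
  rw [← map_zero (toChart (coord_mem k i)),
    toChart_eq_iff (coord_mem k i) hF (zero_mem (grading k 0))] at h
  obtain ⟨n, h⟩ := h
  simpa [X_ne_zero] using h

lemma resRight_injective (i j : Fin 3) : Function.Injective (resRight k i j) := by
  rw [injective_iff_map_eq_zero]
  intro a ha
  obtain ⟨d, F, hF, rfl⟩ := exists_toChart_eq (coord_mem k j) a
  rw [toChart_of_mem _ hF] at ha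
  change awayMap (grading k) (coord_mem k i) (mul_comm _ _) _ = _ at ha
  rw [awayMap_mk, ← (HomogeneousLocalization.val_injective _).eq_iff, Away.val_mk,
    HomogeneousLocalization.val_zero, Localization.mk_eq_mk', IsLocalization.mk'_eq_zero_iff] at ha
  obtain ⟨⟨_, n, rfl⟩, h⟩ := ha
  have : F = 0 := by simpa [X_ne_zero] using h
  rw [this, map_zero]

/-! ### Algebra of the change of chart -/

section Generic

variable {A : Type u} [CommRing A] [Algebra k A] {M : Type*} [AddCommGroup M] [Module A M]

/-- By the Leibniz rule the terms in dr add up to (Σ cₘtₘ) dr = 0. So a change of chart costs the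
differentials one factor `r`; this is why forms of degree `d` give sections of Ω(d + 1). -/
lemma sum_smul_D_mul {c t : Fin 3 → A} (r : A) (h : ∑ m, c m * t m = 0) :
    ∑ m, c m • KaehlerDifferential.D k A (r * t m) =
      r • ∑ m, c m • KaehlerDifferential.D k A (t m) := by
  simp only [Derivation.leibniz, smul_add, Finset.sum_add_distrib, Finset.smul_sum]
  rw [add_eq_left.mpr]
  · exact Finset.sum_congr rfl fun m _ => smul_comm _ _ _
  · simp only [smul_smul, ← Finset.sum_smul, h, zero_smul]

lemma pow_succ_smul_sum (r : A) (d : ℕ) (f : Fin 3 → A) (x : Fin 3 → M) :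
    r ^ (d + 1) • ∑ m, f m • x m = r • ∑ m, (r ^ d * f m) • x m := by
  simp only [Finset.smul_sum, smul_smul]
  exact Finset.sum_congr rfl fun m _ => by ring_nf

lemma sum_sub_smul_eq_zero {r : A} (hr : IsUnit r) (d : ℕ) {p q : Fin 3 → A} {x : Fin 3 → M}
    (h : r ^ (d + 1) • ∑ m, p m • x m = r • ∑ m, q m • x m) :
    ∑ m, (r ^ d * p m - q m) • x m = 0 := by
  rw [pow_succ_smul_sum] at h
  simp only [sub_smul, Finset.sum_sub_distrib]
  exact sub_eq_zero.mpr (hr.smul_left_cancel.mp h)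

lemma sum_mul_eq_zero_of_isUnit {r : A} (hr : IsUnit r) {q t : Fin 3 → A}
    (h : ∑ m, q m * (r * t m) = 0) : ∑ m, q m * t m = 0 := by
  refine (hr.mul_right_eq_zero).mp ?_
  rw [← h, Finset.mul_sum]
  exact Finset.sum_congr rfl fun m _ => by ring

lemma sum_sub_mul_eq_zero (r : A) (d : ℕ) {p q t : Fin 3 → A} (hp : ∑ m, p m * t m = 0)
    (hq : ∑ m, q m * t m = 0) : ∑ m, (r ^ d * p m - q m) * t m = 0 := by
  simp only [sub_mul, Finset.sum_sub_distrib, hq, mul_assoc, ← Finset.mul_sum, hp]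
  simp

end Generic

lemma sum_resLeft_mul {i j : Fin 3} {a : Fin 3 → Chart k (coord k i)}
    (ha : ∑ m, a m * affineCoord i m = 0) :
    ∑ m, resLeft k i j (a m) * resLeft k i j (affineCoord i m) = 0 := by
  simpa only [map_sum, map_mul, map_zero] using congrArg (resLeft k i j) ha

lemma sum_resRight_mul {i j : Fin 3} {a : Fin 3 → Chart k (coord k j)}
    (ha : ∑ m, a m * affineCoord j m = 0) :
    ∑ m, resRight k i j (a m) * resLeft k i j (affineCoord i m) = 0 := by
  apply sum_mul_eq_zero_of_isUnit (isUnit_coordRatio (k := k) i j)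
  simpa only [map_sum, map_mul, map_zero, resRight_affineCoord] using congrArg (resRight k i j) ha

/-- Restriction of differential forms to `D₊(XᵢXⱼ)`. -/
lemma kaehlerMap_resLeft_chartForm (i j : Fin 3) (a : Fin 3 → Chart k (coord k i)) :
    kaehlerMap (resLeft k i j) (chartForm i a) = ∑ m, resLeft k i j (a m) •
      KaehlerDifferential.D k (Overlap k i j) (resLeft k i j (affineCoord i m)) := by
  simp only [chartForm, map_sum, kaehlerMap_smul, kaehlerMap_D]

lemma kaehlerMap_resRight_chartForm (i j : Fin 3) {a : Fin 3 → Chart k (coord k j)}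
    (ha : ∑ m, a m * affineCoord j m = 0) :
    kaehlerMap (resRight k i j) (chartForm j a) = coordRatio k i j • ∑ m, resRight k i j (a m) •
      KaehlerDifferential.D k (Overlap k i j) (resLeft k i j (affineCoord i m)) := by
  simp only [chartForm, map_sum, kaehlerMap_smul, kaehlerMap_D, resRight_affineCoord]
  exact sum_smul_D_mul _ (sum_resRight_mul ha)

/-- The overlap is a localization of the chart, and differentials localize. -/
lemma linearIndependent_D_resLeft (i j : Fin 3) :
    LinearIndependent (Overlap k i j) fun m : {m : Fin 3 // m ≠ i} =>
      KaehlerDifferential.D k (Overlap k i j) (resLeft k i j (affineCoord i m)) := by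
  let : Algebra (Chart k (coord k i)) (Overlap k i j) := (resLeft k i j).toRingHom.toAlgebra
  have : IsScalarTower k (Chart k (coord k i)) (Overlap k i j) :=
    IsScalarTower.of_algebraMap_eq' (resLeft k i j).comp_algebraMap.symm
  have : IsLocalization.Away (Away.isLocalizationElem (coord_mem k i) (coord_mem k j))
      (Overlap k i j) :=
    Away.isLocalization_mul (coord_mem k i) (coord_mem k j) rfl one_ne_zero
  have h := (linearIndependent_D_affineCoord (k := k) i).of_isLocalizedModule (Overlap k i j)
    (Submonoid.powers (Away.isLocalizationElem (coord_mem k i) (coord_mem k j)))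
    (KaehlerDifferential.map k k (Chart k (coord k i)) (Overlap k i j))
  convert! h using 2 with m
  exact (KaehlerDifferential.map_D k k _ _ _).symm

/-- Components normalized by the Euler relation are unique, also on overlaps; this lets them be
glued one by one. -/
lemma eq_zero_of_sum_smul_D_eq_zero (i j : Fin 3) {c : Fin 3 → Overlap k i j}
    (hc : ∑ m, c m * resLeft k i j (affineCoord i m) = 0)
    (h : ∑ m, c m • KaehlerDifferential.D k (Overlap k i j) (resLeft k i j (affineCoord i m)) = 0) :
    c = 0 := by
  have hne : ∀ m ≠ i, c m = 0 := by
    rw [← Fintype.sum_subtype_add_sum_subtype (fun m => m ≠ i),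
      Finset.sum_eq_zero (s := (Finset.univ : Finset {m // ¬ m ≠ i})), add_zero] at h
    · intro m hm
      exact Fintype.linearIndependent_iff.mp (linearIndependent_D_resLeft i j) (fun m => c m) h
        ⟨m, hm⟩
    · intro m _
      rw [not_ne_iff.mp m.2, affineCoord_self, map_one]
      simp
  ext1 m
  by_cases hm : m = i
  · subst hm
    rw [← Finset.add_sum_erase _ _ (Finset.mem_univ m), affineCoord_self, map_one, mul_one,
      Finset.sum_eq_zero (fun n hn => by rw [hne n (Finset.ne_of_mem_erase hn), zero_mul]),
      add_zero] at hc
    exact hc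
  · exact hne m hm

/-- The global section of `Ω¹(d + 1)` given by forms of degree `d`. -/
def sectionOfForm {d : ℕ} {F : Fin 3 → MvPolynomial (Fin 3) k} (hFd : ∀ n, F n ∈ grading k d)
    (hF : ∑ n, X n * F n = 0) : OmegaSections k (d + 1) where
  val i := chartForm i fun n => toChart (coord_mem k i) (F n)
  property i j := by
    have hj : ∑ n, toChart (coord_mem k j) (F n) * affineCoord j n = 0 := by
      have := congrArg (toChart (coord_mem k j)) hF
      simp only [map_sum, map_mul, map_zero] at this
      rw [← this]
      exact Finset.sum_congr rfl fun n _ => mul_comm _ _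
    rw [kaehlerMap_resRight_chartForm i j hj, kaehlerMap_resLeft_chartForm]
    simp only [resRight_toChart i j (hFd _)]
    exact pow_succ_smul_sum _ _ _ _

lemma sectionOfForm_apply {d : ℕ} {F : Fin 3 → MvPolynomial (Fin 3) k}
    (hFd : ∀ n, F n ∈ grading k d) (hF : ∑ n, X n * F n = 0) (i : Fin 3) :
    (sectionOfForm hFd hF).1 i = chartForm i fun n => toChart (coord_mem k i) (F n) := rfl

lemma mem_grading_of_X_pow_mul {i : Fin 3} {d e : ℕ} {F : MvPolynomial (Fin 3) k}
    (h : X i ^ e * F ∈ grading k (e + d)) : F ∈ grading k d := by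
  have he : (X i ^ e : MvPolynomial (Fin 3) k) ∈ grading k e := by
    simpa using SetLike.pow_mem_graded e (coord_mem k i)
  have h1 := DirectSum.coe_decompose_mul_add_of_left_mem (grading k) (j := d) (b := F) he
  rw [DirectSum.decompose_of_mem_same _ h] at h1
  rw [mul_left_cancel₀ (pow_ne_zero e (X_ne_zero i)) h1]
  exact SetLike.coe_mem _

/-- The global sections of `𝒪(d)` are the homogeneous polynomials of degree `d`. -/
lemma exists_toChart_eq_of_compatible {d : ℕ} (a : ∀ i : Fin 3, Chart k (coord k i))
    (h : ∀ i j, coordRatio k i j ^ d * resLeft k i j (a i) = resRight k i j (a j)) :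
    ∃ F ∈ grading k d, ∀ i, toChart (coord_mem k i) F = a i := by
  choose n G hG hGa using fun i => exists_toChart_eq (coord_mem k i) (a i)
  -- Powers of Xᵢ give all numerators the common degree `e + d`, so that the local sections become
  -- `G i` over Xᵢ to the power `e + d`.
  obtain ⟨e, G, hG, hGa⟩ : ∃ (e : ℕ) (G : Fin 3 → MvPolynomial (Fin 3) k),
      (∀ i, G i ∈ grading k (e + d)) ∧ ∀ i, toChart (coord_mem k i) (G i) = a i := by
    refine ⟨∑ i, n i, fun i => X i ^ (∑ j, n j + d - n i) * G i, fun i => ?_, fun i => ?_⟩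
    · have hi : n i ≤ ∑ j, n j := Finset.single_le_sum (fun _ _ => Nat.zero_le _)
        (Finset.mem_univ i)
      have := SetLike.mul_mem_graded
        (SetLike.pow_mem_graded (∑ j, n j + d - n i) (coord_mem k i)) (hG i)
      rw [smul_eq_mul, mul_one, Nat.sub_add_cancel (by omega)] at this
      exact this
    · rw [← hGa i]
      exact toChart_pow_mul _ _ _
  have hrel : ∀ i j, X j ^ e * G i = X i ^ e * G j := by
    intro i j
    have he : (X i ^ e : MvPolynomial (Fin 3) k) ∈ grading k e := by
      simpa using SetLike.pow_mem_graded e (coord_mem k i)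
    have h1 : toChart (coord_mem k j) (G i) = toChart (coord_mem k j) (X i ^ e * G j) := by
      apply resRight_injective i j
      rw [resRight_toChart i j (hG i), hGa, pow_add, mul_assoc, h, ← hGa j, coordRatio_eq,
        map_mul, map_mul, map_pow, map_pow]
      rfl
    rw [toChart_eq_iff (coord_mem k j) (hG i) (SetLike.mul_mem_graded he (hG j))] at h1
    obtain ⟨m, h1⟩ := h1
    have h2 := mul_left_cancel₀ (pow_ne_zero m (X_ne_zero (R := k) j)) h1
    apply mul_left_cancel₀ (pow_ne_zero (e + d) (X_ne_zero (R := k) j))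
    linear_combination h2
  -- Xᵢ is prime to Xⱼ, so the relation makes its `e`-th power divide `G i`; the quotient turns out
  -- not to depend on `i`.
  have hdvd : ∀ i, ∃ F, G i = X i ^ e * F := by
    intro i
    obtain ⟨j, hj⟩ := exists_ne i
    have hX : IsRelPrime (X i : MvPolynomial (Fin 3) k) (X j) := by
      rw [(X_prime (i := i) (R := k)).irreducible.isRelPrime_iff_not_dvd, X_dvd_X]
      simpa using hj.symm
    exact (hX.pow (m := e) (n := e)).dvd_of_dvd_mul_left ⟨_, hrel i j⟩
  choose F hF using hdvd
  have hFF : ∀ i j, F i = F j := by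
    intro i j
    have := hrel i j
    rw [hF i, hF j] at this
    apply mul_left_cancel₀ (pow_ne_zero e (X_ne_zero (R := k) i))
    apply mul_left_cancel₀ (pow_ne_zero e (X_ne_zero (R := k) j))
    linear_combination this
  refine ⟨F 0, ?_, fun i => ?_⟩
  · have := hG 0
    rw [hF 0] at this
    exact mem_grading_of_X_pow_mul this
  · rw [hFF 0 i, ← hGa, hF]
    exact (toChart_pow_mul _ _ _).symm

/-- This is the Euler sequence on global sections: each normalized component is a compatible family
for 𝒪(d), hence a form of degree `d`. -/
lemma exists_eq_sectionOfForm {d : ℕ} (s : OmegaSections k (d + 1)) :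
    ∃ (F : Fin 3 → MvPolynomial (Fin 3) k) (hFd : ∀ n, F n ∈ grading k d)
      (hF : ∑ n, X n * F n = 0), s = sectionOfForm hFd hF := by
  choose a ha has using fun i => exists_chartForm_eq i (s.1 i)
  have hcomp : ∀ i j, (fun m => coordRatio k i j ^ d * resLeft k i j (a i m)
      - resRight k i j (a j m)) = 0 := by
    intro i j
    have h := s.2 i j
    rw [← has i, ← has j, kaehlerMap_resRight_chartForm i j (ha j),
      kaehlerMap_resLeft_chartForm] at h
    exact eq_zero_of_sum_smul_D_eq_zero i j
      (sum_sub_mul_eq_zero _ _ (sum_resLeft_mul (ha i)) (sum_resRight_mul (ha j)))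
      (sum_sub_smul_eq_zero (isUnit_coordRatio i j) d h)
  choose F hFd hFa using fun m => exists_toChart_eq_of_compatible (fun i => a i m)
    (fun i j => sub_eq_zero.mp (congrFun (hcomp i j) m))
  have hF : ∑ n, X n * F n = 0 := by
    refine toChart_coord_injective (d := 1 + d) 0
      (Submodule.sum_mem _ fun n _ => SetLike.mul_mem_graded (coord_mem k n) (hFd n)) ?_
    rw [map_sum, ← ha 0]
    refine Finset.sum_congr rfl fun n _ => ?_
    rw [map_mul, hFa n 0, mul_comm]
    rfl
  refine ⟨F, hFd, hF, Subtype.ext (funext fun i => ?_)⟩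
  rw [← has i]
  rw [sectionOfForm_apply]
  congr 1
  ext1 n
  exact (hFa n i).symm

lemma zeroIdeal_sectionOfForm {d : ℕ} {F : Fin 3 → MvPolynomial (Fin 3) k}
    (hFd : ∀ n, F n ∈ grading k d) (hF : ∑ n, X n * F n = 0) (i : Fin 3) :
    zeroIdeal ((sectionOfForm hFd hF).1 i) =
      (Ideal.span (Set.range F)).map (toChart (coord_mem k i)) := by
  have h : ∑ n, toChart (coord_mem k i) (F n) * affineCoord i n = 0 := by
    have := congrArg (toChart (coord_mem k i)) hF
    simp only [map_sum, map_mul, map_zero] at this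
    rw [← this]
    exact Finset.sum_congr rfl fun n _ => mul_comm _ _
  rw [sectionOfForm_apply, Ideal.map_span, ← Set.range_comp]
  exact zeroIdeal_chartForm i h

end

/-! ### Ideal sheaves on the complements of lines -/

section

variable {k : Type u} [Field k]

section ChartIdeal

variable {f : MvPolynomial (Fin 3) k} {m : ℕ} (hf : f ∈ grading k m) (hm : 0 < m)

/-- The open subset `D₊(f)` as an affine open. -/
def basicAffineOpen : (P2 k).affineOpens :=
  ⟨Proj.basicOpen (grading k) f, Proj.isAffineOpen_basicOpen (grading k) f hf hm⟩

/-- The functions on `D₊(f)`. -/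
def sectionEquiv : Chart k f ≃+* Γ(P2 k, (basicAffineOpen hf hm).1) :=
  (Proj.basicOpenIsoAway (grading k) f hf hm).commRingCatIsoToRingEquiv

/-- The ideal of a closed subscheme on `D₊(f)`. -/
def basicIdeal (Z : (P2 k).IdealSheafData) : Ideal (Chart k f) :=
  (Z.ideal (basicAffineOpen hf hm)).comap (sectionEquiv hf hm)

lemma chartIdeal_eq (Z : (P2 k).IdealSheafData) (i : Fin 3) :
    chartIdeal Z i = basicIdeal (coord_mem k i) one_pos Z := rfl

lemma map_basicIdeal (Z : (P2 k).IdealSheafData) :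
    (basicIdeal hf hm Z).map (sectionEquiv hf hm) = Z.ideal (basicAffineOpen hf hm) :=
  Ideal.map_comap_of_surjective _ (sectionEquiv hf hm).surjective _

lemma basicIdeal_eq_map (Z : (P2 k).IdealSheafData) :
    basicIdeal hf hm Z = (Z.ideal (basicAffineOpen hf hm)).map (sectionEquiv hf hm).symm :=
  (Ideal.map_symm _).symm

lemma basicIdeal_sup (Z W : (P2 k).IdealSheafData) :
    basicIdeal hf hm (Z ⊔ W) = basicIdeal hf hm Z ⊔ basicIdeal hf hm W := by
  simp only [basicIdeal_eq_map, Scheme.IdealSheafData.ideal_sup, Pi.sup_apply, Ideal.map_sup]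

lemma basicIdeal_inf (Z W : (P2 k).IdealSheafData) :
    basicIdeal hf hm (Z ⊓ W) = basicIdeal hf hm Z ⊓ basicIdeal hf hm W := by
  simp only [basicIdeal, Scheme.IdealSheafData.ideal_inf, Pi.inf_apply, Ideal.comap_inf]

lemma basicIdeal_top : basicIdeal hf hm (⊤ : (P2 k).IdealSheafData) = ⊤ := rfl

lemma basicIdeal_mono {Z W : (P2 k).IdealSheafData} (h : Z ≤ W) :
    basicIdeal hf hm Z ≤ basicIdeal hf hm W :=
  Ideal.comap_mono (h _)

end ChartIdeal

lemma chartIdeal_sup (Z W : (P2 k).IdealSheafData) (i : Fin 3) :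
    chartIdeal (Z ⊔ W) i = chartIdeal Z i ⊔ chartIdeal W i :=
  basicIdeal_sup (coord_mem k i) one_pos Z W

lemma chartIdeal_inf (Z W : (P2 k).IdealSheafData) (i : Fin 3) :
    chartIdeal (Z ⊓ W) i = chartIdeal Z i ⊓ chartIdeal W i :=
  basicIdeal_inf (coord_mem k i) one_pos Z W

lemma iSup_chartOpen : ⨆ i, (chartOpen k i).1 = ⊤ := by
  refine Proj.iSup_basicOpen_eq_top' (grading k) _ (fun i => ⟨1, coord_mem k i⟩) ?_
  rw [eq_top_iff]
  rintro p -
  induction p using MvPolynomial.induction_on with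
  | C a =>
    have : C a ∈ grading k 0 := isHomogeneous_C _ _
    exact Subalgebra.algebraMap_mem _ (⟨C a, this⟩ : grading k 0)
  | add p q hp hq => exact add_mem hp hq
  | mul_X p i hp => exact mul_mem hp (Algebra.subset_adjoin ⟨i, rfl⟩)

lemma le_of_chartIdeal_le {Z W : (P2 k).IdealSheafData}
    (h : ∀ i, chartIdeal Z i ≤ chartIdeal W i) : Z ≤ W := by
  refine Scheme.IdealSheafData.le_of_iSup_eq_top (chartOpen k) iSup_chartOpen fun i => ?_
  have := Ideal.map_mono (f := sectionEquiv (coord_mem k i) one_pos) (h i)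
  rwa [chartIdeal_eq, chartIdeal_eq, map_basicIdeal, map_basicIdeal] at this

lemma eq_of_chartIdeal_eq {Z W : (P2 k).IdealSheafData}
    (h : ∀ i, chartIdeal Z i = chartIdeal W i) : Z = W :=
  le_antisymm (le_of_chartIdeal_le fun i => (h i).le) (le_of_chartIdeal_le fun i => (h i).ge)

/-- The order on ideal sheaves reverses that on subschemes: `Z ⊔ W` is the intersection, which is
empty when its ideal is the unit ideal. -/
lemma disjoint_support_iff {Z W : (P2 k).IdealSheafData} :
    Disjoint Z.support W.support ↔ ∀ i, chartIdeal Z i ⊔ chartIdeal W i = ⊤ := by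
  rw [disjoint_iff, ← Scheme.IdealSheafData.support_sup, Scheme.IdealSheafData.support_eq_bot_iff]
  constructor
  · intro h i
    rw [← chartIdeal_sup, h, chartIdeal_eq, basicIdeal_top]
  · intro h
    refine eq_of_chartIdeal_eq fun i => ?_
    rw [chartIdeal_sup, h i]
    rfl

/-! ### Comparing ideals on the complements of different lines -/

section Transfer

lemma map_comap_of_square {A B A' B' : Type*} [CommRing A] [CommRing B] [CommRing A']
    [CommRing B'] (e : A ≃+* A') (e' : B ≃+* B') {f : A →+* B} {f' : A' →+* B'}
    (h : ∀ a, f' (e a) = e' (f a)) {I : Ideal A'} {J : Ideal B'} (hIJ : I.map f' = J) :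
    (I.comap e).map f = J.comap e' := by
  subst hIJ
  apply le_antisymm
  · rw [Ideal.map_le_iff_le_comap]
    intro a ha
    rw [Ideal.mem_comap, Ideal.mem_comap, ← h]
    exact Ideal.mem_map_of_mem _ ha
  · rw [← Ideal.map_symm, Ideal.map_le_iff_le_comap, Ideal.map_le_iff_le_comap]
    intro x hx
    rw [Ideal.mem_comap, Ideal.mem_comap]
    have : e'.symm (f' x) = f (e.symm x) := by
      rw [RingEquiv.symm_apply_eq, ← h, RingEquiv.apply_symm_apply]
    rw [this]
    refine Ideal.mem_map_of_mem _ ?_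
    rwa [Ideal.mem_comap, RingEquiv.apply_symm_apply]

variable {f g : MvPolynomial (Fin 3) k} (hf : f ∈ grading k 1) (hg : g ∈ grading k 1)

/-- Restriction of functions from `D₊(f)` to `D₊(fg)`. -/
def restrictLeft : Chart k f →+* Chart k (f * g) := awayMap (grading k) hg rfl

/-- Restriction of functions from `D₊(g)` to `D₊(fg)`. -/
def restrictRight : Chart k g →+* Chart k (f * g) := awayMap (grading k) hf (mul_comm _ _)

lemma map_restrict_aux {x h : MvPolynomial (Fin 3) k} (hx : x ∈ grading k 2)
    (hh : h ∈ grading k 1) (e : x = f * h) (Z : (P2 k).IdealSheafData) :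
    (basicIdeal hf one_pos Z).map (awayMap (grading k) hh e) = basicIdeal hx two_pos Z := by
  have hle : basicAffineOpen hx two_pos ≤ basicAffineOpen hf one_pos :=
    Proj.basicOpen_mono (grading k) f x ⟨h, e⟩
  refine map_comap_of_square (sectionEquiv hf one_pos) (sectionEquiv hx two_pos)
    (f' := ((P2 k).presheaf.map (homOfLE hle).op).hom) (fun a => ?_) (Z.map_ideal hle)
  have := Proj.awayMap_awayToSection (grading k) (f := f) hh e
  exact (congrArg (fun φ => φ.hom a) this).symm

lemma map_restrictLeft (Z : (P2 k).IdealSheafData) :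
    (basicIdeal hf one_pos Z).map (restrictLeft hg) =
      basicIdeal (m := 2) (SetLike.mul_mem_graded hf hg) two_pos Z :=
  map_restrict_aux hf _ hg rfl Z

lemma map_restrictRight (Z : (P2 k).IdealSheafData) :
    (basicIdeal hg one_pos Z).map (restrictRight hf) =
      basicIdeal (m := 2) (SetLike.mul_mem_graded hf hg) two_pos Z :=
  map_restrict_aux hg _ hf (mul_comm _ _) Z

lemma restrictRight_toChart {F : MvPolynomial (Fin 3) k} {d : ℕ} (hF : F ∈ grading k d) :
    restrictRight hf (toChart hg F) =
      restrictRight hf (toChart hg f) ^ d * restrictLeft hg (toChart hf F) := by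
  rw [toChart_of_mem _ hF, toChart_of_mem _ hF, toChart_of_mem _ hf, restrictLeft, restrictRight,
    awayMap_mk, awayMap_mk, awayMap_mk]
  apply HomogeneousLocalization.val_injective
  rw [HomogeneousLocalization.val_mul, HomogeneousLocalization.val_pow, Away.val_mk,
    Away.val_mk, Away.val_mk, Localization.mk_pow, Localization.mk_mul, Localization.mk_eq_mk_iff,
    Localization.r_iff_exists]
  refine ⟨1, ?_⟩
  simp only [OneMemClass.coe_one, SubmonoidClass.coe_pow, Submonoid.coe_mul]
  ring

/-- The functions on D₊(fg) are those on D₊(g) with the image of `f` inverted, so membership there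
descends to D₊(g) after clearing powers of `f`. -/
lemma exists_pow_mul_mem_basicIdeal {Z : (P2 k).IdealSheafData} {F : MvPolynomial (Fin 3) k}
    {d : ℕ} (hF : F ∈ grading k d) (h : toChart hf F ∈ basicIdeal hf one_pos Z) :
    ∃ n, toChart hg (f ^ n * F) ∈ basicIdeal hg one_pos Z := by
  have h1 : restrictRight hf (toChart hg F) ∈ (basicIdeal hg one_pos Z).map (restrictRight hf) := by
    rw [map_restrictRight, ← map_restrictLeft hf hg, restrictRight_toChart hf hg hF]
    exact Ideal.mul_mem_left _ _ (Ideal.mem_map_of_mem _ h)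
  let : Algebra (Chart k g) (Chart k (f * g)) := (restrictRight hf).toAlgebra
  have : IsLocalization.Away (Away.isLocalizationElem hg hf) (Chart k (f * g)) :=
    Away.isLocalization_mul hg hf (mul_comm _ _) one_ne_zero
  have helem : Away.isLocalizationElem hg hf = toChart hg f := by
    rw [toChart_of_mem hg hf]
    simp only [Away.isLocalizationElem, pow_one]
  rw [helem] at this
  have h2 := (IsLocalization.mem_map_algebraMap_iff (Submonoid.powers (toChart hg f))
    (Chart k (f * g))).mp h1
  obtain ⟨⟨⟨a, ha⟩, ⟨_, n, rfl⟩⟩, h2⟩ := h2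
  change algebraMap _ _ (toChart hg F) * _ = _ at h2
  rw [← map_mul] at h2
  obtain ⟨⟨_, l, rfl⟩, h3⟩ := (IsLocalization.eq_iff_exists (Submonoid.powers (toChart hg f))
    (Chart k (f * g))).mp h2
  refine ⟨l + n, ?_⟩
  have : toChart hg (f ^ (l + n) * F) = toChart hg f ^ l * (toChart hg F * toChart hg f ^ n) := by
    simp only [map_mul, map_pow, pow_add]
    ring
  rw [this]
  simp only at h3
  rw [h3]
  exact Ideal.mul_mem_left _ _ ha

lemma mem_basicIdeal_of_forall {Z : (P2 k).IdealSheafData} {F : MvPolynomial (Fin 3) k}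
    {d : ℕ} (hF : F ∈ grading k d)
    (h : ∀ i, ∃ n, toChart (coord_mem k i) (f ^ n * F) ∈ chartIdeal Z i) :
    toChart hf F ∈ basicIdeal hf one_pos Z := by
  -- The polynomials multiplying `F` into the ideal contain powers of all coordinates, hence a power
  -- of `f`, whose image on D₊(f) is 1.
  let J : Ideal (MvPolynomial (Fin 3) k) :=
    { carrier := {r | toChart hf r * toChart hf F ∈ basicIdeal hf one_pos Z}
      add_mem' := fun {a b} ha hb => by
        simp only [Set.mem_ofPred_eq, map_add, add_mul] at ha hb ⊢
        exact add_mem ha hb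
      zero_mem' := by simp
      smul_mem' := fun c x hx => by
        simp only [Set.mem_ofPred_eq, smul_eq_mul, map_mul, mul_assoc] at hx ⊢
        exact Ideal.mul_mem_left _ _ hx }
  have hJ : ∀ i, ∃ n, coord k i ^ n ∈ J := by
    intro i
    obtain ⟨n, hn⟩ := h i
    obtain ⟨m, hm⟩ := exists_pow_mul_mem_basicIdeal (coord_mem k i) hf
      (SetLike.mul_mem_graded (SetLike.pow_mem_graded n hf) hF) hn
    refine ⟨m, ?_⟩
    change toChart hf (coord k i ^ m) * toChart hf F ∈ basicIdeal hf one_pos Z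
    rwa [map_mul, toChart_pow_mul] at hm
  obtain ⟨a, rfl⟩ := exists_eq_linForm hf
  obtain ⟨n, hn⟩ := linForm_pow_mem hJ a
  change toChart hf (linForm a ^ n) * toChart hf F ∈ basicIdeal hf one_pos Z at hn
  rwa [map_pow, toChart_self, one_pow, one_mul] at hn

/-- If a closed subscheme is given by a homogeneous ideal on the standard charts, then it is given
by this ideal on the complement of every line. -/
lemma basicIdeal_eq_map_toChart {Z : (P2 k).IdealSheafData} {J : Ideal (MvPolynomial (Fin 3) k)}
    (hJ : J.IsHomogeneous (grading k))
    (h : ∀ i, chartIdeal Z i = J.map (toChart (coord_mem k i))) :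
    basicIdeal hf one_pos Z = J.map (toChart hf) := by
  apply le_antisymm
  · intro a ha
    obtain ⟨d, F, hF, rfl⟩ := exists_toChart_eq hf a
    rw [toChart_mem_map_iff hf hJ hF]
    have h1 : ∀ i, ∃ n m, coord k i ^ m * (f ^ n * F) ∈ J := fun i => by
      obtain ⟨n, hn⟩ := exists_pow_mul_mem_basicIdeal hf (coord_mem k i) hF ha
      rw [← chartIdeal_eq, h, toChart_mem_map_iff _ hJ
        (SetLike.mul_mem_graded (SetLike.pow_mem_graded n hf) hF)] at hn
      exact ⟨n, hn⟩
    choose n m hnm using h1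
    -- The exponent of `f` depends on the chart; the sum of the three serves for all.
    have h2 : ∀ i, ∃ m, coord k i ^ m * (f ^ (∑ i, n i) * F) ∈ J := fun i => by
      refine ⟨m i, ?_⟩
      obtain ⟨e, he⟩ := Nat.exists_eq_add_of_le
        (Finset.single_le_sum (f := n) (fun _ _ => Nat.zero_le _) (Finset.mem_univ i))
      rw [he]
      convert! J.mul_mem_left (f ^ e) (hnm i) using 1
      ring
    obtain ⟨a, rfl⟩ := exists_eq_linForm hf
    obtain ⟨l, hl⟩ := linForm_pow_mul_mem h2 a
    exact ⟨l + ∑ i, n i, by rwa [pow_add, mul_assoc]⟩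
  · intro a ha
    obtain ⟨d, F, hF, hFJ, rfl⟩ := exists_of_mem_map_toChart hf hJ ha
    refine mem_basicIdeal_of_forall hf hF fun i => ⟨0, ?_⟩
    rw [pow_zero, one_mul, h]
    exact Ideal.mem_map_of_mem _ hFJ

end Transfer

end

/-! ### Subschemes of affine open subschemes -/

section

/-! ### Closed subschemes lying over an affine open, and closures -/

section SchemeLemmas

variable {X : Scheme.{u}}

lemma SpecMap_fromSpec_appLE {U : X.Opens} (hU : IsAffineOpen U) {B : CommRingCat.{u}}
    (φ : Γ(X, U) ⟶ B) (e : ⊤ ≤ (Spec.map φ ≫ hU.fromSpec) ⁻¹ᵁ U) :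
    (Spec.map φ ≫ hU.fromSpec).appLE U ⊤ e = φ ≫ (Scheme.ΓSpecIso _).inv := by
  have e' : ⊤ ≤ Spec.map φ ⁻¹ᵁ hU.fromSpec ⁻¹ᵁ U := e
  rw [Scheme.ΓSpecIso_inv_naturality, Scheme.Hom.comp_appLE, IsAffineOpen.fromSpec_app_self,
    Category.assoc]
  exact congrArg (_ ≫ ·) ((Scheme.Hom.map_appLE (Spec.map φ) e' _).trans
    (Scheme.Hom.appLE_eq_app _))

/-- The immersion of the closed subscheme of an affine open subscheme given by an ideal. -/
def quotientι {U : X.Opens} (hU : IsAffineOpen U) (I : Ideal Γ(X, U)) :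
    Spec (CommRingCat.of (Γ(X, U) ⧸ I)) ⟶ X :=
  Spec.map (CommRingCat.ofHom (Ideal.Quotient.mk I)) ≫ hU.fromSpec

lemma le_preimage_quotientι {U : X.Opens} (hU : IsAffineOpen U) (I : Ideal Γ(X, U)) :
    ⊤ ≤ quotientι hU I ⁻¹ᵁ U := by
  rw [quotientι, Scheme.Hom.comp_preimage, IsAffineOpen.fromSpec_preimage_self]
  exact le_rfl

lemma appLE_quotientι {U : X.Opens} (hU : IsAffineOpen U) (I : Ideal Γ(X, U))  :
    (quotientι hU I).appLE U ⊤ (le_preimage_quotientι hU I) =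
      CommRingCat.ofHom (Ideal.Quotient.mk I) ≫ (Scheme.ΓSpecIso _).inv := by
  exact SpecMap_fromSpec_appLE hU _ _

lemma mem_ker_appLE_quotientι {U : X.Opens} (hU : IsAffineOpen U) (I : Ideal Γ(X, U)) (s : Γ(X, U)) :
    (quotientι hU I).appLE U ⊤ (le_preimage_quotientι hU I) s = 0 ↔ s ∈ I := by
  rw [appLE_quotientι, ← Ideal.Quotient.eq_zero_iff_mem]
  exact map_eq_zero_iff _
    (Scheme.ΓSpecIso (CommRingCat.of (Γ(X, U) ⧸ I))).symm.commRingCatIsoToRingEquiv.injective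

variable (Z : X.IdealSheafData) (U : X.affineOpens)

/-- The open subscheme of a closed subscheme over an affine open. -/
def subschemePiece : Spec (CommRingCat.of (Γ(X, U.1) ⧸ Z.ideal U)) ⟶ Z.subscheme :=
  Z.subschemeCover.f U

lemma subschemePiece_subschemeι :
    subschemePiece Z U ≫ Z.subschemeι =
      Spec.map (CommRingCat.ofHom (Ideal.Quotient.mk (Z.ideal U))) ≫ IsAffineOpen.fromSpec U.2 := by
  exact (Z.subschemeCover_map_subschemeι U).trans (Z.glueDataObjι_ι U)


lemma isIso_subschemePiece (h : Z.subschemeι ⁻¹ᵁ U.1 = ⊤) : IsIso (subschemePiece Z U) := by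
  rw [isIso_iff_isOpenImmersion_and_epi_base]
  refine ⟨Z.subschemeCover.map_prop U, ?_⟩
  rw [TopCat.epi_iff_surjective, ← Set.range_eq_univ]
  have := Z.opensRange_subschemeCover_map U
  rw [h] at this
  exact congrArg (fun V : Z.subscheme.Opens => (V : Set Z.subscheme)) this

lemma topologicalKrullDim_quotient_le :
    ringKrullDim (Γ(X, U.1) ⧸ Z.ideal U) ≤ topologicalKrullDim Z.subscheme := by
  rw [← PrimeSpectrum.topologicalKrullDim_eq_ringKrullDim]
  have : IsOpenImmersion (subschemePiece Z U) := Z.subschemeCover.map_prop U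
  exact (Scheme.Hom.isOpenEmbedding (subschemePiece Z U)).isInducing.topologicalKrullDim_le

lemma finrank_top_eq {k : Type u} [Field k] {Y : Scheme.{u}} (σ : Y ⟶ Spec (CommRingCat.of k)) {B : CommRingCat.{u}}
    (j : Spec B ⟶ Y) [IsIso j] (ψ : CommRingCat.of k ⟶ B) (h : j ≫ σ = Spec.map ψ)
    {B' : Type u} [CommRing B'] [Algebra k B'] (e : B ≃+* B') (he : ∀ c, e (ψ c) = algebraMap k B' c) :
    @Module.finrank k Γ(Y, ⊤) _ _
      (((Scheme.ΓSpecIso (CommRingCat.of k)).inv ≫ σ.appTop).hom.toAlgebra).toModule =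
    Module.finrank k B' := by
  let : Algebra k Γ(Y, ⊤) := ((Scheme.ΓSpecIso (CommRingCat.of k)).inv ≫ σ.appTop).hom.toAlgebra
  let φ : Γ(Y, ⊤) ≅ B := asIso (j.app ⊤) ≪≫ Scheme.ΓSpecIso B
  have hφ : ((Scheme.ΓSpecIso (CommRingCat.of k)).inv ≫ σ.appTop) ≫ φ.hom = ψ := by
    change ((Scheme.ΓSpecIso (CommRingCat.of k)).inv ≫ σ.appTop) ≫ j.appTop ≫ (Scheme.ΓSpecIso B).hom = ψ
    rw [Category.assoc, ← Category.assoc σ.appTop, ← Scheme.Hom.comp_appTop, h, ← Category.assoc,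
      ← Scheme.ΓSpecIso_inv_naturality, Category.assoc, Iso.inv_hom_id, Category.comp_id]
  refine LinearEquiv.finrank_eq (AlgEquiv.ofRingEquiv (f := φ.commRingCatIsoToRingEquiv.trans e) fun c => ?_).toLinearEquiv
  rw [← he, ← hφ]
  rfl

lemma finrank_subscheme_eq {k : Type u} [Field k] (σ : X ⟶ Spec (CommRingCat.of k))
    (h : Z.subschemeι ⁻¹ᵁ U.1 = ⊤) (ψ : CommRingCat.of k ⟶ Γ(X, U.1))
    (hψ : IsAffineOpen.fromSpec U.2 ≫ σ = Spec.map ψ) {B' : Type u} [CommRing B'] [Algebra k B']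
    (e : Γ(X, U.1) ⧸ Z.ideal U ≃+* B')
    (he : ∀ c, e (Ideal.Quotient.mk _ (ψ c)) = algebraMap k B' c) :
    @Module.finrank k Γ(Z.subscheme, ⊤) _ _ (((Scheme.ΓSpecIso (CommRingCat.of k)).inv ≫
      (Z.subschemeι ≫ σ).appTop).hom.toAlgebra).toModule = Module.finrank k B' := by
  have := isIso_subschemePiece Z U h
  refine finrank_top_eq (Z.subschemeι ≫ σ) (subschemePiece Z U)
    (ψ ≫ CommRingCat.ofHom (Ideal.Quotient.mk (Z.ideal U))) ?_ e he
  rw [← Category.assoc, subschemePiece_subschemeι, Category.assoc, hψ, Spec.map_comp]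

variable [QuasiSeparatedSpace X]

/-- The ideal sheaf of the scheme-theoretic closure of the closed subscheme of an affine open
subscheme given by an ideal. -/
def closureIdeal {U : X.Opens} (hU : IsAffineOpen U) (I : Ideal Γ(X, U)) : X.IdealSheafData :=
  (quotientι hU I).ker

lemma closureIdeal_ideal_self {U : X.Opens} (hU : IsAffineOpen U) (I : Ideal Γ(X, U)) :
    (closureIdeal hU I).ideal ⟨U, hU⟩ = I := by
  ext s
  rw [closureIdeal, Scheme.Hom.ker_apply, RingHom.mem_ker, ← mem_ker_appLE_quotientι hU I s]
  have e : quotientι hU I ⁻¹ᵁ U = ⊤ := top_le_iff.mp (le_preimage_quotientι hU I)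
  have : (quotientι hU I).appLE U ⊤ (le_preimage_quotientι hU I) = (quotientι hU I).app U ≫
    (Spec (CommRingCat.of (Γ(X, U) ⧸ I))).presheaf.map (eqToHom e.symm).op := rfl
  rw [this, CommRingCat.comp_apply]
  exact (map_eq_zero_iff _ ((ConcreteCategory.bijective_of_isIso
    ((Spec (CommRingCat.of (Γ(X, U) ⧸ I))).presheaf.map (eqToHom e.symm).op)).injective)).symm

/-- A function on `V` vanishes on the closure as soon as its restriction to U ∩ V is a multiple of
an element of `I`, because the preimage of `V` maps into U ∩ V. -/
lemma mem_closureIdeal_ideal {U : X.Opens} (hU : IsAffineOpen U) (V : X.affineOpens) (I : Ideal Γ(X, U)) {s : Γ(X, V.1)}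
    {t : Γ(X, U)} (ht : t ∈ I) {W : X.Opens} (hWU : W ≤ U) (hWV : W ≤ V.1) (hW : U ⊓ V.1 ≤ W)
    {r : Γ(X, W)} (h : X.presheaf.map (homOfLE hWV).op s =
      r * X.presheaf.map (homOfLE hWU).op t) :
    s ∈ (closureIdeal hU I).ideal V := by
  rw [closureIdeal, Scheme.Hom.ker_apply, RingHom.mem_ker]
  have hU' := le_preimage_quotientι hU I
  have hUV : quotientι hU I ⁻¹ᵁ V.1 ≤ quotientι hU I ⁻¹ᵁ W := by
    refine le_trans ?_ (Scheme.Hom.preimage_mono _ hW)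
    rw [Scheme.Hom.preimage_inf]
    exact le_inf (le_top.trans hU') le_rfl
  have h1 := congrArg ((quotientι hU I).appLE W (quotientι hU I ⁻¹ᵁ V.1) hUV) h
  rw [map_mul, ← CommRingCat.comp_apply, ← CommRingCat.comp_apply, Scheme.Hom.map_appLE,
    Scheme.Hom.map_appLE] at h1
  rw [Scheme.Hom.app_eq_appLE]
  change ((quotientι hU I).appLE V.1 (quotientι hU I ⁻¹ᵁ V.1) le_rfl) s = 0
  rw [h1]
  have h2 := (mem_ker_appLE_quotientι hU I t).mpr ht
  have h3 := congrArg ((Spec (CommRingCat.of (Γ(X, U) ⧸ I))).presheaf.map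
    (homOfLE (le_top : quotientι hU I ⁻¹ᵁ V.1 ≤ ⊤)).op) h2
  rw [← CommRingCat.comp_apply, Scheme.Hom.appLE_map, map_zero] at h3
  rw [h3, mul_zero]

end SchemeLemmas

variable {k : Type u} [Field k]

lemma SpecMap_awayToSection_awayι {f : MvPolynomial (Fin 3) k} {m : ℕ} (hf : f ∈ grading k m)
    (hm : 0 < m) :
    Spec.map (Proj.awayToSection (grading k) f) ≫ Proj.awayι (grading k) f hf hm =
      (Proj.isAffineOpen_basicOpen (grading k) f hf hm).fromSpec := by
  have hU := Proj.isAffineOpen_basicOpen (grading k) f hf hm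
  rw [← cancel_epi hU.isoSpec.hom, IsAffineOpen.isoSpec_hom_fromSpec, IsAffineOpen.isoSpec_hom,
    ← Category.assoc]
  change Proj.basicOpenToSpec (grading k) f ≫ _ = _
  rw [← Proj.basicOpenIsoSpec_hom _ _ hf hm, Proj.awayι, Iso.hom_inv_id_assoc]

section

variable {f : MvPolynomial (Fin 3) k} (hf : f ∈ grading k 1)

/-- The functions on the part of a closed subscheme in `D₊(f)`. -/
def quotientSectionEquiv (Z : (P2 k).IdealSheafData) :
    Γ(P2 k, (basicAffineOpen hf one_pos).1) ⧸ Z.ideal (basicAffineOpen hf one_pos) ≃+*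
      Chart k f ⧸ basicIdeal hf one_pos Z :=
  Ideal.quotientEquiv _ _ (sectionEquiv hf one_pos).symm (basicIdeal_eq_map hf one_pos Z)

lemma length_eq_finrank {Z : (P2 k).IdealSheafData}
    (h : Z.subschemeι ⁻¹ᵁ Proj.basicOpen (grading k) f = ⊤) :
    length Z = Module.finrank k (Chart k f ⧸ basicIdeal hf one_pos Z) := by
  let α : CommRingCat.of (Chart k f) ⟶ Γ(P2 k, (basicAffineOpen hf one_pos).1) :=
    Proj.awayToSection (grading k) f
  refine finrank_subscheme_eq Z (basicAffineOpen hf one_pos) _ h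
    (CommRingCat.ofHom (algebraMap k (grading k 0)) ≫
      CommRingCat.ofHom (fromZeroRingHom (grading k) _) ≫ α) ?_ (quotientSectionEquiv hf Z) ?_
  · have h1 : Spec.map α ≫ Proj.awayι (grading k) f hf one_pos =
      IsAffineOpen.fromSpec (basicAffineOpen hf one_pos).2 := SpecMap_awayToSection_awayι hf one_pos
    rw [← h1]
    simp only [Category.assoc, Spec.map_comp, Proj.awayι_toSpecZero_assoc]
  · intro c
    exact congrArg (Ideal.Quotient.mk _)
      ((sectionEquiv hf one_pos).symm_apply_apply (algebraMap k (Chart k f) c))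

lemma isMaximal_of_basicIdeal_le {Z : (P2 k).IdealSheafData} (hZ : IsZeroDimensional Z)
    {P : Ideal (Chart k f)} [P.IsPrime] (hP : basicIdeal hf one_pos Z ≤ P) : P.IsMaximal := by
  have h1 := topologicalKrullDim_quotient_le Z (basicAffineOpen hf one_pos)
  rw [hZ, ringKrullDim_eq_of_ringEquiv (quotientSectionEquiv hf Z)] at h1
  have : Ring.KrullDimLE 0 (Chart k f ⧸ basicIdeal hf one_pos Z) := by
    rw [Ring.KrullDimLE, Order.krullDimLE_iff]
    exact h1
  have h2 : (P.map (Ideal.Quotient.mk (basicIdeal hf one_pos Z))).IsPrime :=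
    Ideal.map_isPrime_of_surjective Ideal.Quotient.mk_surjective (by rwa [Ideal.mk_ker])
  have h3 := Ideal.isMaximal_iff_isPrime.mpr h2
  have h4 := Ideal.comap_isMaximal_of_surjective (Ideal.Quotient.mk (basicIdeal hf one_pos Z))
    Ideal.Quotient.mk_surjective (K := P.map (Ideal.Quotient.mk (basicIdeal hf one_pos Z)))
  rwa [Ideal.comap_map_of_surjective' _ Ideal.Quotient.mk_surjective, Ideal.mk_ker,
    sup_eq_left.mpr hP] at h4

lemma isZeroDimensional_of_finrank_pos {Z : (P2 k).IdealSheafData}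
    (h : Z.subschemeι ⁻¹ᵁ Proj.basicOpen (grading k) f = ⊤)
    (hpos : 0 < Module.finrank k (Chart k f ⧸ basicIdeal hf one_pos Z)) : IsZeroDimensional Z := by
  have := isIso_subschemePiece Z (basicAffineOpen hf one_pos) h
  have hh := (Scheme.Hom.homeomorph (subschemePiece Z (basicAffineOpen hf one_pos))).isHomeomorph
  rw [IsZeroDimensional, ← hh.topologicalKrullDim_eq]
  refine PrimeSpectrum.topologicalKrullDim_eq_ringKrullDim _ |>.trans ?_
  refine (ringKrullDim_eq_of_ringEquiv (quotientSectionEquiv hf Z)).trans ?_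
  -- An infinite-dimensional space has `finrank` 0, so positivity gives both finiteness and
  -- nontriviality, and the ring is Artinian.
  have := Module.finite_of_finrank_pos hpos
  have := Module.nontrivial_of_finrank_pos hpos
  have : IsArtinianRing (Chart k f ⧸ basicIdeal hf one_pos Z) := IsArtinianRing.of_finite k _
  rw [← ringKrullDimZero_iff_ringKrullDim_eq_zero]
  infer_instance

end

lemma basicOpen_toChart_le {f : MvPolynomial (Fin 3) k} (hf : f ∈ grading k 1) (i : Fin 3) :
    (P2 k).basicOpen (sectionEquiv (coord_mem k i) one_pos (toChart (coord_mem k i) f)) ≤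
      Proj.basicOpen (grading k) f := by
  have hU := Proj.isAffineOpen_basicOpen (grading k) (coord k i) (coord_mem k i) one_pos
  let α : CommRingCat.of (Chart k (coord k i)) ⟶ Γ(P2 k, Proj.basicOpen (grading k) (coord k i)) :=
    Proj.awayToSection (grading k) (coord k i)
  have h1 : hU.fromSpec ⁻¹ᵁ (P2 k).basicOpen (α (toChart (coord_mem k i) f)) =
      hU.fromSpec ⁻¹ᵁ Proj.basicOpen (grading k) f := by
    rw [hU.fromSpec_preimage_basicOpen, ← SpecMap_awayToSection_awayι (coord_mem k i) one_pos,
      Scheme.Hom.comp_preimage,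
      Proj.awayι_preimage_basicOpen (grading k) (coord_mem k i) one_pos hf one_pos]
    have : Away.isLocalizationElem (coord_mem k i) hf = toChart (coord_mem k i) f := by
      rw [toChart_of_mem _ hf]
      simp only [Away.isLocalizationElem, pow_one]
    rw [this]
    rfl
  intro x hx
  obtain ⟨y, rfl⟩ : x ∈ Set.range hU.fromSpec := by
    rw [hU.range_fromSpec]
    exact (P2 k).basicOpen_le _ hx
  exact (congrArg (y ∈ ·) h1).mp hx

/-- At a point of `Z` the first summand in an expression of 1 vanishes, so the multiple of `f` is
invertible there: a subscheme missing the line lies in its complement. -/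
lemma preimage_basicOpen_eq_top {f : MvPolynomial (Fin 3) k} (hf : f ∈ grading k 1)
    {Z : (P2 k).IdealSheafData}
    (h : ∀ i, chartIdeal Z i ⊔ Ideal.span {toChart (coord_mem k i) f} = ⊤) :
    Z.subschemeι ⁻¹ᵁ Proj.basicOpen (grading k) f = ⊤ := by
  rw [eq_top_iff]
  rintro z -
  set x := Z.subschemeι z with hx
  have hxZ : x ∈ Z.support := by
    have : x ∈ Set.range Z.subschemeι := ⟨z, rfl⟩
    rwa [Scheme.IdealSheafData.range_subschemeι] at this
  change x ∈ Proj.basicOpen (grading k) f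
  obtain ⟨i, hi⟩ : ∃ i, x ∈ (chartOpen k i).1 := by
    have : x ∈ ⨆ i, (chartOpen k i).1 := by rw [iSup_chartOpen]; trivial
    exact TopologicalSpace.Opens.mem_iSup.mp this
  have h0 := (Scheme.mem_zeroLocus_iff _ _ _).mp
    ((Scheme.IdealSheafData.mem_support_iff_of_mem hi).mp hxZ)
  obtain ⟨s, hs, t, ht, hst⟩ := Submodule.mem_sup.mp ((Ideal.eq_top_iff_one _).mp (h i))
  obtain ⟨r, rfl⟩ := Ideal.mem_span_singleton'.mp ht
  let e := sectionEquiv (coord_mem k i) one_pos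
  have h1 : e s + e r * e (toChart (coord_mem k i) f) = 1 := by
    rw [← map_mul, ← map_add, hst, map_one]
  have h2 : x ∈ (P2 k).basicOpen (e s + e r * e (toChart (coord_mem k i) f)) := by
    rw [h1, Scheme.basicOpen_of_isUnit _ isUnit_one]
    exact hi
  have h3 := (P2 k).basicOpen_add_le _ _ h2
  rcases h3 with h3 | h3
  · exact absurd h3 (h0 _ hs)
  · rw [Scheme.basicOpen_mul] at h3
    exact basicOpen_toChart_le hf i h3.2

/-- Every homogeneous polynomial defines a curve. -/
lemma exists_chartIdeal_eq_span {F : MvPolynomial (Fin 3) k} {d : ℕ} (hF : F ∈ grading k d) :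
    ∃ C : (P2 k).IdealSheafData, ∀ i, chartIdeal C i = Ideal.span {toChart (coord_mem k i) F} := by
  let e : ∀ i, Chart k (coord k i) ≃+* Γ(P2 k, (chartOpen k i).1) := fun i =>
    sectionEquiv (coord_mem k i) one_pos
  let I : ∀ i, Ideal Γ(P2 k, (chartOpen k i).1) := fun i => Ideal.map (e i) (Ideal.span {toChart (coord_mem k i) F})
  -- The curve is the union of the closures of its affine pieces. On the `j`-th chart the `j`-th
  -- closure bounds the ideal from above; conversely the equation there is, on each overlap, a
  -- multiple of the `i`-th one and so lies in every closure ideal.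
  refine ⟨⨅ i, closureIdeal (chartOpen k i).2 (I i), fun j => ?_⟩
  apply le_antisymm
  · intro a ha
    have h1 : e j a ∈ (⨅ i, closureIdeal (chartOpen k i).2 (I i)).ideal (chartOpen k j) := ha
    rw [Scheme.IdealSheafData.ideal_iInf, iInf_apply] at h1
    have h2 := (Submodule.mem_iInf _).mp h1 j
    have h3 : e j a ∈ I j := (closureIdeal_ideal_self (chartOpen k j).2 (I j)).le h2
    rwa [← Ideal.mem_comap, Ideal.comap_map_of_bijective _ (e j).bijective] at h3
  · rw [Ideal.span_le, Set.singleton_subset_iff]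
    change e j (toChart (coord_mem k j) F) ∈
      (⨅ i, closureIdeal (chartOpen k i).2 (I i)).ideal (chartOpen k j)
    rw [Scheme.IdealSheafData.ideal_iInf, iInf_apply]
    refine (Submodule.mem_iInf _).mpr fun i => ?_
    have hx : coord k i * coord k j ∈ grading k 2 :=
      SetLike.mul_mem_graded (coord_mem k i) (coord_mem k j)
    have hi : Proj.basicOpen (grading k) (coord k i * coord k j) ≤ (chartOpen k i).1 :=
      Proj.basicOpen_mono _ _ _ ⟨_, rfl⟩
    have hj : Proj.basicOpen (grading k) (coord k i * coord k j) ≤ (chartOpen k j).1 :=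
      Proj.basicOpen_mono _ _ _ ⟨_, mul_comm _ _⟩
    refine mem_closureIdeal_ideal (chartOpen k i).2 (chartOpen k j) (I i)
      (Ideal.mem_map_of_mem _ (Ideal.mem_span_singleton_self _)) hi hj
      (Proj.basicOpen_mul _ _ _).ge (r := sectionEquiv hx two_pos
        (restrictRight (coord_mem k i) (toChart (coord_mem k j) (coord k i)) ^ d)) ?_
    have h1 := congrArg (fun φ => φ.hom (toChart (coord_mem k j) F))
      (Proj.awayMap_awayToSection (grading k) (coord_mem k i)
        (mul_comm (coord k i) (coord k j)))
    have h2 := congrArg (fun φ => φ.hom (toChart (coord_mem k i) F))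
      (Proj.awayMap_awayToSection (grading k) (f := coord k i) (coord_mem k j) rfl)
    have h3 := congrArg (sectionEquiv hx two_pos)
      (restrictRight_toChart (coord_mem k i) (coord_mem k j) hF)
    rw [map_mul] at h3
    exact h1.symm.trans (h3.trans (congrArg (_ * ·) h2))

end

/-! ### Subschemes of a line -/

section

variable {k : Type u} [Field k]

lemma map_toChart_eq_top {J : Ideal (MvPolynomial (Fin 3) k)} {i : Fin 3} {n : ℕ}
    (h : coord k i ^ n ∈ J) : J.map (toChart (coord_mem k i)) = ⊤ := by
  have := Ideal.mem_map_of_mem (toChart (coord_mem k i)) h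
  rwa [map_pow, toChart_self, one_pow, ← Ideal.eq_top_iff_one] at this

lemma isHomogeneous_span {s : Set (MvPolynomial (Fin 3) k)} (h : ∀ F ∈ s, ∃ d, F ∈ grading k d) :
    (Ideal.span s).IsHomogeneous (grading k) :=
  Ideal.homogeneous_span _ _ fun F hF => h F hF

namespace Frame

variable (E : Frame k)

lemma coord_pow_mem {J : Ideal (MvPolynomial (Fin 3) k)} (h : ∀ a, ∃ n, E.form a ^ n ∈ J)
    (i : Fin 3) : ∃ n, coord k i ^ n ∈ J := by
  have : coord k i ∈ J.radical := by
    rw [E.coord_eq]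
    exact Ideal.sum_mem _ fun a _ => Ideal.mul_mem_left _ _ (h a)
  exact this

/-- Every monomial of degree `d` other than the power of X₀ contains X₁. -/
lemma mem_span_X_one {p : MvPolynomial (Fin 2) k} {d : ℕ} (hp : p.IsHomogeneous d) :
    p - C (coeff (Finsupp.single 0 d) p) * X 0 ^ d ∈ Ideal.span {X 1} := by
  have h := (mem_ideal_span_X_image (s := {(1 : Fin 2)})
    (x := p - C (coeff (Finsupp.single 0 d) p) * X 0 ^ d)).mpr fun m hm => by
    refine ⟨1, rfl, fun h1 => ?_⟩
    rw [mem_support_iff, coeff_sub, coeff_C_mul, coeff_X_pow] at hm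
    by_cases h0 : m 0 = d
    · have : Finsupp.single 0 d = m := by
        ext j
        fin_cases j
        · simp [h0]
        · simp [h1]
      rw [if_pos this, this, mul_one, sub_self] at hm
      exact hm rfl
    · have h2 : Finsupp.single 0 d ≠ m := by
        rintro rfl
        simp at h0
      rw [if_neg h2, mul_zero, sub_zero] at hm
      have := hp hm
      rw [Finsupp.weight_apply, Finsupp.sum_fintype _ _ (by simp), Fin.sum_univ_two, h1] at this
      simp at this
      exact h0 this
  rwa [Set.image_singleton] at h

/-- If `F` does not vanish at the point of the line where the second coordinate is zero, then the
first coordinate is nilpotent modulo `F` and the two other coordinates. -/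
lemma form_zero_pow_mem {F : MvPolynomial (Fin 3) k} {d : ℕ} (hF : F ∈ grading k d)
    (hc : (E.restrictAffine F).coeff d ≠ 0) {J : Ideal (MvPolynomial (Fin 3) k)} (hFJ : F ∈ J)
    (h1 : E.form 1 ∈ J) (h2 : E.form 2 ∈ J) : E.form 0 ^ d ∈ J := by
  set p := E.restrict F with hp
  set c := coeff (Finsupp.single 0 d) p
  have h3 := mem_span_X_one (E.restrict_mem hF)
  obtain ⟨q, hq⟩ := Ideal.mem_span_singleton'.mp h3
  rw [E.coeff_restrictAffine hF] at hc
  have hc0 : c ≠ 0 := by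
    intro h0
    have h4 : p = q * X 1 := by
      rw [hq]
      change p = p - C c * X 0 ^ d
      rw [h0, C_0, zero_mul, sub_zero]
    rw [← hp, h4] at hc
    simp at hc
  obtain ⟨m, hm⟩ := E.X_dvd_lift F
  have h5 := congrArg E.lift hq
  rw [map_sub, map_mul, map_mul, map_pow, lift_X_one, lift_X_zero] at h5
  -- Modulo the last two coordinates `F` is a nonzero constant times the `d`-th power of the first.
  have h6 : E.lift (C c) * E.form 0 ^ d = F - E.form 2 * m - E.lift q * E.form 1 := by
    rw [h5, ← hp]
    rw [← hp] at hm
    nth_rw 1 [hm]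
    change _ = _ - (E.lift p - E.lift (C c) * _)
    ring
  have h7 : E.lift (C c) = C c := E.lift.commutes c
  have h8 : E.form 0 ^ d = C c⁻¹ * (F - E.form 2 * m - E.lift q * E.form 1) := by
    rw [← h6, h7, ← mul_assoc, ← C_mul, inv_mul_cancel₀ hc0, C_1, one_mul]
  rw [h8]
  exact J.mul_mem_left _ (J.sub_mem (J.sub_mem hFJ (J.mul_mem_right _ h2)) (J.mul_mem_left _ h1))

/-- The restriction of functions on `D₊(y₁)` to the line `y₂ = 0`, with the coordinate `y₀ / y₁`. -/
def evalLine : Chart k (E.form 1) →ₐ[k] Polynomial k :=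
  evalChart E.restrictAffine E.restrictAffine_form_one

@[simp] lemma evalLine_toChart (F : MvPolynomial (Fin 3) k) :
    E.evalLine (toChart (E.form_mem 1) F) = E.restrictAffine F :=
  evalChart_toChart _ _ _ _

lemma evalLine_surjective : Function.Surjective E.evalLine := by
  intro p
  refine ⟨Polynomial.aeval (toChart (E.form_mem 1) (E.form 0)) p, ?_⟩
  rw [← Polynomial.aeval_algHom_apply, evalLine_toChart, restrictAffine_form_zero,
    Polynomial.aeval_X_left_apply]

lemma ker_evalLine : RingHom.ker E.evalLine =
    Ideal.span {toChart (E.form_mem 1) (E.form 2)} := by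
  apply le_antisymm
  · intro a ha
    obtain ⟨d, F, hF, rfl⟩ := exists_toChart_eq (E.form_mem 1) a
    rw [RingHom.mem_ker, evalLine_toChart] at ha
    rw [Ideal.mem_span_singleton]
    exact map_dvd _ (E.dvd_of_restrictAffine_eq_zero hF ha)
  · rw [Ideal.span_le, Set.singleton_subset_iff]
    simp

lemma map_evalLine (J : Ideal (MvPolynomial (Fin 3) k)) :
    (J.map (toChart (E.form_mem 1))).map E.evalLine = J.map E.restrictAffine := by
  have : E.evalLine.comp (toChart (E.form_mem 1)) = E.restrictAffine :=
    AlgHom.ext E.evalLine_toChart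
  rw [← this, Ideal.map_mapₐ]

lemma finrank_quotient_eq {I : Ideal (Chart k (E.form 1))}
    (h : toChart (E.form_mem 1) (E.form 2) ∈ I) :
    Module.finrank k (Chart k (E.form 1) ⧸ I) =
      Module.finrank k (Polynomial k ⧸ I.map E.evalLine) := by
  let φ := (Ideal.Quotient.mkₐ k (I.map E.evalLine)).comp E.evalLine
  have hφ : Function.Surjective φ :=
    (Ideal.Quotient.mkₐ_surjective k _).comp E.evalLine_surjective
  have hker : RingHom.ker φ = I := by
    ext a
    rw [RingHom.mem_ker, AlgHom.comp_apply, Ideal.Quotient.mkₐ_eq_mk, Ideal.Quotient.eq_zero_iff_mem,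
      ← Ideal.mem_comap, Ideal.comap_map_of_surjective' _ E.evalLine_surjective, ker_evalLine,
      sup_eq_left.mpr]
    rwa [Ideal.span_le, Set.singleton_subset_iff]
  exact ((Ideal.quotientEquivAlgOfEq k hker).symm.trans
    (Ideal.quotientKerAlgEquivOfSurjective hφ)).toLinearEquiv.finrank_eq

variable {E} {J : Ideal (MvPolynomial (Fin 3) k)} {Γ : (P2 k).IdealSheafData}

/-- The length of a closed subscheme of a line. -/
theorem length_eq_natDegree (hJ : J.IsHomogeneous (grading k))
    (hΓ : ∀ i, chartIdeal Γ i = J.map (toChart (coord_mem k i)))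
    (h2 : E.form 2 ∈ J) {F : MvPolynomial (Fin 3) k} {d : ℕ}
    (hF : F ∈ grading k d) (hFJ : F ∈ J) (hc : (E.restrictAffine F).coeff d ≠ 0)
    {c : Polynomial k} (hmap : J.map E.restrictAffine = Ideal.span {c}) :
    length Γ = c.natDegree ∧ (0 < c.natDegree → IsZeroDimensional Γ) := by
  have h1 : basicIdeal (E.form_mem 1) one_pos Γ = J.map (toChart (E.form_mem 1)) :=
    basicIdeal_eq_map_toChart _ hJ hΓ
  have hfin : Module.finrank k (Chart k (E.form 1) ⧸ basicIdeal (E.form_mem 1) one_pos Γ) =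
      c.natDegree := by
    rw [h1, E.finrank_quotient_eq (Ideal.mem_map_of_mem _ h2), E.map_evalLine, hmap]
    exact finrank_quotient_span_eq_natDegree
  -- On the line only the point (1 : 0) lies outside D₊(y₁), and `F` does not vanish there, so Γ
  -- lies in this one chart and its length can be computed in k[t].
  have hsupp : Γ.subschemeι ⁻¹ᵁ Proj.basicOpen (grading k) (E.form 1) = ⊤ := by
    refine preimage_basicOpen_eq_top (E.form_mem 1) fun i => ?_
    have hle : J ≤ J ⊔ Ideal.span {E.form 1} := le_sup_left
    have h1' : E.form 1 ∈ J ⊔ Ideal.span {E.form 1} :=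
      Ideal.mem_sup_right (Ideal.mem_span_singleton_self _)
    obtain ⟨n, hn⟩ := E.coord_pow_mem (J := J ⊔ Ideal.span {E.form 1}) (fun a => by
      fin_cases a
      · exact ⟨d, E.form_zero_pow_mem hF hc (hle hFJ) h1' (hle h2)⟩
      · exact ⟨1, by simpa using h1'⟩
      · exact ⟨1, by simpa using hle h2⟩) i
    have := map_toChart_eq_top hn
    rwa [Ideal.map_sup, Ideal.map_span, Set.image_singleton, ← hΓ] at this
  refine ⟨(length_eq_finrank (E.form_mem 1) hsupp).trans hfin, fun hpos => ?_⟩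
  exact isZeroDimensional_of_finrank_pos (E.form_mem 1) hsupp (hfin ▸ hpos)

/-- A finite subscheme does not contain a line. -/
theorem exists_restrictAffine_ne_zero (E : Frame k) (hJ : J.IsHomogeneous (grading k))
    (hΓ : ∀ i, chartIdeal Γ i = J.map (toChart (coord_mem k i))) (hdim : IsZeroDimensional Γ) :
    ∃ F ∈ J, E.restrictAffine F ≠ 0 := by
  by_contra! h
  -- Otherwise the prime of the whole line would contain the ideal of Γ and be maximal, making `X`
  -- invertible in k[X].
  have h1 : basicIdeal (E.form_mem 1) one_pos Γ ≤ RingHom.ker E.evalLine := by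
    rw [basicIdeal_eq_map_toChart (E.form_mem 1) hJ hΓ, Ideal.map_le_iff_le_comap]
    intro F hF
    rw [Ideal.mem_comap, RingHom.mem_ker, evalLine_toChart]
    exact h F hF
  have h2 := RingHom.ker_isPrime E.evalLine
  have h3 := isMaximal_of_basicIdeal_le (E.form_mem 1) hdim h1
  have hX : toChart (E.form_mem 1) (E.form 0) ∉ RingHom.ker E.evalLine := by
    rw [RingHom.mem_ker, evalLine_toChart, restrictAffine_form_zero]
    exact Polynomial.X_ne_zero
  obtain ⟨y, r, hr, hy⟩ := h3.exists_inv hX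
  have h4 := congrArg E.evalLine hy
  rw [map_add, map_mul, evalLine_toChart, restrictAffine_form_zero, (RingHom.mem_ker).mp hr,
    add_zero, map_one] at h4
  exact Polynomial.not_isUnit_X (.of_mul_eq_one_right _ h4)

end Frame

end

/-! ### Lines disjoint from a finite subscheme -/

section

variable {k : Type u} [Field k]

lemma isNoetherianRing_chart {f : MvPolynomial (Fin 3) k} (hf : f ∈ grading k 1) :
    IsNoetherianRing (Chart k f) :=
  isNoetherianRing_of_surjective _ _ (toChart hf).toRingHom fun a => by
    obtain ⟨d, F, -, h⟩ := exists_toChart_eq hf a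
    exact ⟨F, h⟩

/-- The linear forms vanishing at a prime ideal of a standard chart. -/
def vanishingForms (i : Fin 3) (P : Ideal (Chart k (coord k i))) : Submodule k (Fin 3 → k) :=
  ((Ideal.Quotient.mkₐ k P).toLinearMap ∘ₗ
    Fintype.linearCombination k fun n => toChart (coord_mem k i) (X n)).ker

lemma mem_vanishingForms {i : Fin 3} {P : Ideal (Chart k (coord k i))} {a : Fin 3 → k} :
    a ∈ vanishingForms i P ↔ toChart (coord_mem k i) (linForm a) ∈ P := by
  have : toChart (coord_mem k i) (linForm a) =
      Fintype.linearCombination k (fun n => toChart (coord_mem k i) (X n)) a := by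
    rw [Fintype.linearCombination_apply, linForm, map_sum]
    refine Finset.sum_congr rfl fun n _ => ?_
    rw [← MvPolynomial.smul_eq_C_mul, map_smul]
  rw [this]
  exact Ideal.Quotient.eq_zero_iff_mem

lemma vanishingForms_ne_top {i : Fin 3} {P : Ideal (Chart k (coord k i))} (hP : P ≠ ⊤) :
    vanishingForms i P ≠ ⊤ := by
  intro h
  have h1 : Pi.single i 1 ∈ vanishingForms i P := h ▸ Submodule.mem_top
  have h2 : linForm (Pi.single i 1) = coord k i := by
    simp [linForm, Pi.single_apply]
  rw [mem_vanishingForms, h2, toChart_self, ← Ideal.eq_top_iff_one] at h1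
  exact hP h1

/-- A finite subscheme of the projective plane over an infinite field is disjoint from some line. -/
lemma exists_line_disjoint [Infinite k] {Z : (P2 k).IdealSheafData} (hZ : IsZeroDimensional Z) :
    ∃ a : Fin 3 → k, a ≠ 0 ∧
      ∀ i, chartIdeal Z i ⊔ Ideal.span {toChart (coord_mem k i) (linForm a)} = ⊤ := by
  -- One proper subspace of linear forms per minimal prime of `Z` on each chart, together with 0 so
  -- that the chosen form is nonzero; finitely many proper subspaces do not cover the space over an
  -- infinite field.
  let S : Set (Submodule k (Fin 3 → k)) :=
    insert ⊥ (⋃ i, vanishingForms i '' (chartIdeal Z i).minimalPrimes)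
  have hS : S.Finite := by
    refine (Set.finite_iUnion fun i => ?_).insert _
    have := isNoetherianRing_chart (coord_mem k i)
    exact (Ideal.finite_minimalPrimes_of_isNoetherianRing _ _).image _
  have htop : ⊤ ∉ S := by
    rintro (h | h)
    · exact bot_ne_top h.symm
    · obtain ⟨i, P, hP, h⟩ := Set.mem_iUnion.mp h
      exact vanishingForms_ne_top hP.1.1.ne_top h
  have hne := Subspace.biUnion_ne_univ_of_top_notMem (s := hS.toFinset) (by rwa [hS.mem_toFinset])
  obtain ⟨a, ha⟩ := (Set.ne_univ_iff_exists_notMem _).mp hne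
  have ha' : ∀ V ∈ S, a ∉ V := fun V hV h =>
    ha (Set.mem_iUnion₂.mpr ⟨V, hS.mem_toFinset.mpr hV, h⟩)
  refine ⟨a, fun h => ha' ⊥ (Set.mem_insert _ _) (by simpa using h), fun i => ?_⟩
  by_contra h
  obtain ⟨m, hm, hle⟩ := Ideal.exists_le_maximal _ h
  obtain ⟨P, hP, hPm⟩ := Ideal.exists_minimalPrimes_le (le_sup_left.trans hle)
  have := hP.1.1
  -- In dimension 0 minimal primes are maximal, so a common point of `Z` and the line is one of the
  -- finitely many avoided.
  have hPmax : P.IsMaximal := isMaximal_of_basicIdeal_le (coord_mem k i) hZ hP.1.2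
  refine ha' (vanishingForms i P)
    (Set.mem_insert_of_mem _ (Set.mem_iUnion.mpr ⟨i, P, hP, rfl⟩)) ?_
  rw [mem_vanishingForms, hPmax.eq_of_le hm.ne_top hPm]
  exact hle (Ideal.mem_sup_right (Ideal.mem_span_singleton_self _))

end

/-! ### From sections to linked subschemes -/

section

variable {k : Type u} [Field k]

lemma isCurve_iff {C : (P2 k).IdealSheafData} {d : ℕ} : IsCurve C d ↔
    ∃ F ∈ grading k d, F ≠ 0 ∧ ∀ i, chartIdeal C i = Ideal.span {toChart (coord_mem k i) F} := by
  constructor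
  · rintro ⟨F, h0, h⟩
    refine ⟨F, F.2, fun h' => h0 (Subtype.ext h'), fun i => ?_⟩
    rw [h, toChart_of_mem _ F.2]
    rfl
  · rintro ⟨F, hF, h0, h⟩
    refine ⟨⟨F, hF⟩, fun h' => h0 (congrArg Subtype.val h'), fun i => ?_⟩
    rw [h, toChart_of_mem _ hF]
    rfl

lemma isHomogeneous_span_insert {f : MvPolynomial (Fin 3) k} (hf : f ∈ grading k 1)
    {F : Fin 3 → MvPolynomial (Fin 3) k} {d : ℕ} (hF : ∀ n, F n ∈ grading k d) :
    (Ideal.span (insert f (Set.range F))).IsHomogeneous (grading k) := by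
  refine isHomogeneous_span ?_
  rintro _ (rfl | ⟨n, rfl⟩)
  · exact ⟨1, hf⟩
  · exact ⟨d, hF n⟩

lemma sup_span_eq_top_iff {f : MvPolynomial (Fin 3) k} (hf : f ∈ grading k 1)
    {F : Fin 3 → MvPolynomial (Fin 3) k} {d : ℕ} (hF : ∀ n, F n ∈ grading k d) (i : Fin 3) :
    (Ideal.span (Set.range F)).map (toChart (coord_mem k i)) ⊔
      Ideal.span {toChart (coord_mem k i) f} = ⊤ ↔
    ∃ n, coord k i ^ n ∈ Ideal.span (insert f (Set.range F)) := by
  rw [← map_toChart_eq_top_iff (coord_mem k i) (isHomogeneous_span_insert hf hF),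
    Ideal.span_insert, sup_comm, Ideal.map_sup, Ideal.map_span _ {f}, Set.image_singleton]

lemma span_range_fin_three {A : Type*} [CommRing A] (v : Fin 3 → A) : Ideal.span (Set.range v) =
    Ideal.span {v 0} ⊔ Ideal.span {v 1} ⊔ Ideal.span {v 2} := by
  apply le_antisymm
  · rw [Ideal.span_le]
    rintro _ ⟨n, rfl⟩
    fin_cases n
    · exact Ideal.mem_sup_left (Ideal.mem_sup_left (Ideal.mem_span_singleton_self _))
    · exact Ideal.mem_sup_left (Ideal.mem_sup_right (Ideal.mem_span_singleton_self _))
    · exact Ideal.mem_sup_right (Ideal.mem_span_singleton_self _)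
  · refine sup_le (sup_le ?_ ?_) ?_ <;> exact Ideal.span_mono (by simp)

/-- For comaximal ideals the intersection is the product, and every product of generators lies in
`K`. -/
lemma inf_eq_of_comaximal {A : Type*} [CommRing A] {K : Ideal A} {x y : A} (hxy : x * y ∈ K)
    (h : K ⊔ Ideal.span {x} ⊔ Ideal.span {y} = ⊤) :
    (K ⊔ Ideal.span {x}) ⊓ (K ⊔ Ideal.span {y}) = K := by
  apply le_antisymm
  · have h' : (K ⊔ Ideal.span {x}) ⊔ (K ⊔ Ideal.span {y}) = ⊤ := by
      rw [eq_top_iff, ← h]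
      exact sup_le le_sup_left (le_sup_right.trans le_sup_right)
    rw [← Ideal.mul_eq_inf_of_isCoprime (Ideal.isCoprime_iff_sup_eq.mpr h'), Ideal.sup_mul,
      Ideal.mul_sup, Ideal.mul_sup, Ideal.span_singleton_mul_span_singleton]
    refine sup_le (sup_le Ideal.mul_le_left Ideal.mul_le_left) (sup_le Ideal.mul_le_right ?_)
    rwa [Ideal.span_le, Set.singleton_subset_iff]
  · exact le_inf le_sup_left le_sup_left

namespace Frame

variable (E : Frame k) {F : Fin 3 → MvPolynomial (Fin 3) k} {d : ℕ}

/-- A point `p` of the line with g(p) ≠ 0 is moved to (1 : 0). The value of the new second component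
there is (r p₁ - s p₀) g(p) = g(p). -/
lemma exists_frame_of_relation [Infinite k] (hFd : ∀ n, F n ∈ grading k d)
    (hF : ∑ n, X n * F n = 0)
    (hdisj : ∀ i, ∃ n, coord k i ^ n ∈ Ideal.span (insert (E.form 2) (Set.range F))) :
    ∃ E' : Frame k, E'.M 2 = E.M 2 ∧ (E'.restrictAffine (E'.comp F 1)).coeff d ≠ 0 := by
  obtain ⟨g, m₀, m₁, hg, -, h₀, h₁, -⟩ := E.exists_comp_eq hF hdisj
  have h₀' : E.restrict (E.comp F 0) = X 1 * g := by
    rw [h₀, map_add, map_mul, map_mul, restrict_form_one, restrict_form_two, restrict_lift]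
    ring
  have h₁' : E.restrict (E.comp F 1) = -X 0 * g := by
    rw [h₁, map_add, map_mul, map_mul, map_neg, restrict_form_zero, restrict_form_two,
      restrict_lift]
    ring
  have hhom := E.restrict_mem (E.comp_mem hFd 0)
  -- A point where X₁g is nonzero serves twice: `g` is nonzero there, and `p` is not the origin.
  obtain ⟨p, hp⟩ : ∃ p, MvPolynomial.eval p (E.restrict (E.comp F 0)) ≠ 0 := by
    by_contra! hp
    have := hhom.eq_zero_of_forall_eval_eq_zero hp
    rw [h₀'] at this
    exact mul_ne_zero (X_ne_zero 1) hg this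
  have hgp : MvPolynomial.eval p g ≠ 0 := by
    intro h
    rw [h₀', map_mul, h, mul_zero] at hp
    exact hp rfl
  have hp0 : p ≠ 0 := by
    rintro rfl
    rw [h₀', map_mul, eval_X] at hp
    simp at hp
  obtain ⟨E', r, s, hM, hrs, hN0, hN1⟩ := E.exists_change hp0
  refine ⟨E', hM, ?_⟩
  have h1 : E'.comp F 1 = C r * E.comp F 0 + C s * E.comp F 1 := by
    simp only [comp, Finset.mul_sum, ← Finset.sum_add_distrib]
    refine Finset.sum_congr rfl fun n _ => ?_
    rw [hN1, C_add, C_mul, C_mul]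
    ring
  have h2 : (fun n => (![1, 0] : Fin 2 → k) 0 * E'.N n 0 + (![1, 0] : Fin 2 → k) 1 * E'.N n 1) =
      fun n => p 0 * E.N n 0 + p 1 * E.N n 1 := by
    ext n
    simp [hN0]
  have h3 := E.eval_restrict (E.comp F 0) p
  have h4 := E.eval_restrict (E.comp F 1) p
  rw [E'.coeff_restrictAffine (E'.comp_mem hFd 1), eval_restrict, h2, h1, map_add, map_mul, map_mul,
    ← h3, ← h4, h₀', h₁', eval_C, eval_C]
  simp only [map_mul, map_neg, eval_X]
  convert! hgp using 1
  linear_combination hrs * MvPolynomial.eval p g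

end Frame

/-- The zero scheme of a section of `Ω(d + 1)` is linked to a subscheme of a line by two
curves of degree `d`. -/
theorem exists_linked [Infinite k] {Z : (P2 k).IdealSheafData} (hdim : IsZeroDimensional Z) {d : ℕ}
    (hd : 2 ≤ d) {F : Fin 3 → MvPolynomial (Fin 3) k} (hFd : ∀ n, F n ∈ grading k d)
    (hF : ∑ n, X n * F n = 0)
    (hZ : ∀ i, chartIdeal Z i = (Ideal.span (Set.range F)).map (toChart (coord_mem k i))) :
    ∃ C₀ ∈ linearSystem Z d, ∃ C₁ ∈ linearSystem Z d, ∃ Γ L : (P2 k).IdealSheafData,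
      C₀ ⊔ C₁ = Z ⊓ Γ ∧ IsZeroDimensional Γ ∧ length Γ = d - 1 ∧ IsCurve L 1 ∧ L ≤ Γ ∧
        Disjoint L.support Z.support := by
  obtain ⟨a, ha0, ha⟩ := exists_line_disjoint hdim
  obtain ⟨E₀, hE₀⟩ := Frame.exists_row_eq ha0
  have hdisj₀ : ∀ i, ∃ n, coord k i ^ n ∈ Ideal.span (insert (linForm a) (Set.range F)) := fun i =>
    (sup_span_eq_top_iff (linForm_mem a) hFd i).mp (hZ i ▸ ha i)
  obtain ⟨E, hE, hcoeff⟩ := E₀.exists_frame_of_relation hFd hF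
    (by rwa [Frame.form, hE₀])
  have hE2 : E.form 2 = linForm a := by rw [Frame.form, hE, hE₀]
  rw [← hE2] at hdisj₀ ha
  obtain ⟨g, m₀, m₁, -, -, h₀, h₁, -⟩ := E.exists_comp_eq hF hdisj₀
  set γ := E.restrictAffine (E.lift g) with hγ
  have hρ₀ : E.restrictAffine (E.comp F 0) = γ := by
    rw [h₀]
    simp [hγ]
  have hρ₁ : E.restrictAffine (E.comp F 1) = -(Polynomial.X * γ) := by
    rw [h₁]
    simp [hγ]
  obtain ⟨e, rfl⟩ : ∃ e, d = e + 1 := ⟨d - 1, by omega⟩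
  -- The second component restricts to -Xγ, so its coefficient in degree `e + 1` is, up to sign,
  -- that of γ in degree `e`; with the degree bound below, γ has degree exactly `e`.
  have hγc : γ.coeff e ≠ 0 := by
    rw [hρ₁, Polynomial.coeff_neg, Polynomial.coeff_X_mul] at hcoeff
    exact neg_ne_zero.mp hcoeff
  have hγ0 : γ ≠ 0 := by
    intro h
    rw [h] at hγc
    exact hγc rfl
  have hγd : γ.natDegree = e := by
    apply le_antisymm _ (Polynomial.le_natDegree_of_ne_zero hγc)
    have := E.natDegree_restrictAffine_le (E.comp_mem hFd 1)
    rw [hρ₁, Polynomial.natDegree_neg, Polynomial.natDegree_X_mul hγ0] at this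
    omega
  have hF₀ : E.comp F 0 ≠ 0 := fun h => hγ0 (by rw [← hρ₀, h, map_zero])
  have hF₁ : E.comp F 1 ≠ 0 := fun h => by
    rw [h, map_zero] at hcoeff
    exact hcoeff rfl
  obtain ⟨C₀, hC₀⟩ := exists_chartIdeal_eq_span (E.comp_mem hFd 0)
  obtain ⟨C₁, hC₁⟩ := exists_chartIdeal_eq_span (E.comp_mem hFd 1)
  obtain ⟨L, hL⟩ := exists_chartIdeal_eq_span (E.form_mem 2)
  have hZle : ∀ a {C : (P2 k).IdealSheafData}, (∀ i, chartIdeal C i =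
      Ideal.span {toChart (coord_mem k i) (E.comp F a)}) → C ≤ Z := fun a C hC => by
    refine le_of_chartIdeal_le fun i => ?_
    rw [hC, hZ, ← E.span_range_comp, Ideal.span_le, Set.singleton_subset_iff]
    exact Ideal.mem_map_of_mem _ (Ideal.subset_span ⟨a, rfl⟩)
  -- Γ is the intersection of both curves with the line; it is cut out there by γ, which divides the
  -- restriction of the second component.
  set J : Ideal (MvPolynomial (Fin 3) k) :=
    Ideal.span {E.comp F 0} ⊔ Ideal.span {E.comp F 1} ⊔ Ideal.span {E.form 2} with hJdef
  have hΓ : ∀ i, chartIdeal (C₀ ⊔ C₁ ⊔ L) i = J.map (toChart (coord_mem k i)) := fun i => by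
    rw [chartIdeal_sup, chartIdeal_sup, hC₀, hC₁, hL, hJdef]
    simp only [Ideal.map_sup, Ideal.map_span, Set.image_singleton]
  have hJ : J.IsHomogeneous (grading k) := by
    rw [hJdef, ← Ideal.span_union, ← Ideal.span_union]
    refine isHomogeneous_span ?_
    rintro _ ((rfl | rfl) | rfl)
    · exact ⟨_, E.comp_mem hFd 0⟩
    · exact ⟨_, E.comp_mem hFd 1⟩
    · exact ⟨_, E.form_mem 2⟩
  have hmap : J.map E.restrictAffine = Ideal.span {γ} := by
    simp only [hJdef, Ideal.map_sup, Ideal.map_span, Set.image_singleton, hρ₀, hρ₁,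
      Frame.restrictAffine_form_two]
    apply le_antisymm
    · refine sup_le (sup_le le_rfl ?_) ?_
      · rw [Ideal.span_singleton_le_span_singleton]
        exact ⟨-Polynomial.X, by ring⟩
      · simp
    · exact le_sup_left.trans le_sup_left
  obtain ⟨hlen, hΓdim⟩ := Frame.length_eq_natDegree hJ hΓ
    (Ideal.mem_sup_right (Ideal.mem_span_singleton_self _)) (E.comp_mem hFd 1)
    (Ideal.mem_sup_left (Ideal.mem_sup_right (Ideal.mem_span_singleton_self _))) hcoeff hmap
  rw [hγd] at hlen hΓdim
  refine ⟨C₀, ⟨isCurve_iff.mpr ⟨_, E.comp_mem hFd 0, hF₀, hC₀⟩, hZle 0 hC₀⟩,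
    C₁, ⟨isCurve_iff.mpr ⟨_, E.comp_mem hFd 1, hF₁, hC₁⟩, hZle 1 hC₁⟩,
    C₀ ⊔ C₁ ⊔ L, L, ?_, hΓdim (by omega), hlen,
    isCurve_iff.mpr ⟨_, E.form_mem 2, E.form_two_ne_zero, hL⟩, le_sup_right, ?_⟩
  · refine eq_of_chartIdeal_eq fun i => ?_
    have hZi : chartIdeal Z i = (Ideal.span {toChart (coord_mem k i) (E.comp F 0)} ⊔
        Ideal.span {toChart (coord_mem k i) (E.comp F 1)}) ⊔
        Ideal.span {toChart (coord_mem k i) (E.comp F 2)} := by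
      rw [hZ, ← E.span_range_comp, span_range_fin_three]
      simp only [Ideal.map_sup, Ideal.map_span, Set.image_singleton]
    rw [chartIdeal_inf, chartIdeal_sup, chartIdeal_sup, chartIdeal_sup, hC₀, hC₁, hL, hZi, inf_eq_of_comaximal]
    · have h := congrArg (toChart (coord_mem k i)) ((E.sum_form_mul_comp F).trans hF)
      rw [Fin.sum_univ_three, map_zero] at h
      simp only [map_add, map_mul] at h
      have h' : toChart (coord_mem k i) (E.comp F 2) * toChart (coord_mem k i) (E.form 2) =
          -toChart (coord_mem k i) (E.form 0) * toChart (coord_mem k i) (E.comp F 0) +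
          -toChart (coord_mem k i) (E.form 1) * toChart (coord_mem k i) (E.comp F 1) := by
        linear_combination h
      rw [h']
      exact add_mem
        (Ideal.mul_mem_left _ _ (Ideal.mem_sup_left (Ideal.mem_span_singleton_self _)))
        (Ideal.mul_mem_left _ _ (Ideal.mem_sup_right (Ideal.mem_span_singleton_self _)))
    · rw [← hZi]
      exact ha i
  · rw [disjoint_support_iff]
    intro i
    rw [hL, sup_comm]
    exact ha i

end

/-! ### Uniqueness of sections -/

section

variable {k : Type u} [Field k]

lemma sum_algebraMap_mul_smul {A M : Type*} [CommRing A] [Algebra k A] [AddCommGroup M] [Module A M]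
    [Module k M] [IsScalarTower k A M] (c : k) (a : Fin 3 → A) (x : Fin 3 → M) :
    ∑ n, (algebraMap k A c * a n) • x n = c • ∑ n, a n • x n := by
  simp only [mul_smul, algebraMap_smul, Finset.smul_sum]

lemma chartForm_smul (i : Fin 3) (c : k) (a : Fin 3 → Chart k (coord k i)) :
    chartForm i (fun n => algebraMap k (Chart k (coord k i)) c * a n) = c • chartForm i a :=
  sum_algebraMap_mul_smul c a fun n => KaehlerDifferential.D k (Chart k (coord k i)) (affineCoord i n)

lemma sectionOfForm_eq_smul {d : ℕ} {F F' : Fin 3 → MvPolynomial (Fin 3) k}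
    (hFd : ∀ n, F n ∈ grading k d) (hF : ∑ n, X n * F n = 0)
    (hFd' : ∀ n, F' n ∈ grading k d) (hF' : ∑ n, X n * F' n = 0) {c : k} (h : F' = c • F) :
    sectionOfForm hFd' hF' = c • sectionOfForm hFd hF := by
  apply Subtype.ext
  funext i
  change chartForm i (fun n => toChart (coord_mem k i) (F' n)) =
    c • chartForm i (fun n => toChart (coord_mem k i) (F n))
  rw [← chartForm_smul]
  congr 1
  funext n
  rw [h, Pi.smul_apply, MvPolynomial.smul_eq_C_mul, map_mul]
  congr 1
  exact (toChart (coord_mem k i)).commutes c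

/-- A section of `Ω(d + 1)` with a finite zero scheme is determined by it up to a scalar. -/
theorem exists_section_eq_smul [Infinite k] {Z : (P2 k).IdealSheafData}
    (hdim : IsZeroDimensional Z) {d : ℕ} (hd : 3 ≤ d) (s s' : OmegaSections k (d + 1))
    (hs : IsZeroScheme s Z) (hs' : IsZeroScheme s' Z) : ∃ c : k, c ≠ 0 ∧ s' = c • s := by
  obtain ⟨F, hFd, hF, rfl⟩ := exists_eq_sectionOfForm s
  obtain ⟨F', hFd', hF', rfl⟩ := exists_eq_sectionOfForm s'
  have hZ : ∀ i, chartIdeal Z i = (Ideal.span (Set.range F)).map (toChart (coord_mem k i)) :=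
    fun i => (hs i).trans (zeroIdeal_sectionOfForm hFd hF i)
  have hZ' : ∀ i, chartIdeal Z i = (Ideal.span (Set.range F')).map (toChart (coord_mem k i)) :=
    fun i => (hs' i).trans (zeroIdeal_sectionOfForm hFd' hF' i)
  have hJ : ∀ {G : Fin 3 → MvPolynomial (Fin 3) k}, (∀ n, G n ∈ grading k d) →
      (Ideal.span (Set.range G)).IsHomogeneous (grading k) := fun hG =>
    isHomogeneous_span (by rintro _ ⟨n, rfl⟩; exact ⟨d, hG n⟩)
  obtain ⟨a, ha0, ha⟩ := exists_line_disjoint hdim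
  obtain ⟨E, rfl⟩ := Frame.exists_row_eq ha0
  obtain ⟨c, hc⟩ := E.exists_eq_smul hd hFd hF hFd' hF'
    (fun i => (sup_span_eq_top_iff (E.form_mem 2) hFd i).mp (hZ i ▸ ha i)) fun n i => by
      rw [← toChart_mem_map_iff (coord_mem k i) (hJ hFd) (hFd' n), ← hZ, hZ']
      exact Ideal.mem_map_of_mem _ (Ideal.subset_span ⟨n, rfl⟩)
  refine ⟨c, ?_, sectionOfForm_eq_smul hFd hF hFd' hF' hc⟩
  -- For `c = 0` the form `F'` would be 0 and `Z` would contain a line.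
  rintro rfl
  obtain ⟨G, hG, hG0⟩ := Frame.exists_restrictAffine_ne_zero E (hJ hFd') hZ' hdim
  rw [hc, zero_smul] at hG
  have h0 : Set.range (0 : Fin 3 → MvPolynomial (Fin 3) k) = {0} := Set.range_const
  rw [h0, Ideal.mem_span_singleton, zero_dvd_iff] at hG
  exact hG0 (by rw [hG, map_zero])

end

/-! ### Pencils and linkage -/

section

variable {k : Type u} [Field k]

instance isDomain_chart (i : Fin 3) : IsDomain (Chart k (coord k i)) := by
  have h : Function.LeftInverse (polyToChart i) (chartToPoly (k := k) i) := fun a => by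
    obtain ⟨p, rfl⟩ := polyToChart_surjective i a
    rw [chartToPoly_polyToChart]
  exact h.injective.isDomain (chartToPoly (k := k) i).toRingHom

/-! ### Pencils of polynomials on the line -/

section Pencils

/-- Two polynomials whose greatest common divisor has degree one less than the bound on their
degrees span the same pencil as this divisor and its product with `-X`. -/
lemma exists_pencil {e : ℕ} {p q c : Polynomial k} (hp : p.natDegree ≤ e + 1)
    (hq : q.natDegree ≤ e + 1) (hpq : p.coeff (e + 1) ≠ 0 ∨ q.coeff (e + 1) ≠ 0)
    (hspan : Ideal.span {p} ⊔ Ideal.span {q} = Ideal.span {c}) (hc : c.natDegree = e) :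
    ∃ r s r' s' : k, r * s' - s * r' ≠ 0 ∧
      Polynomial.C r * p + Polynomial.C s * q = c ∧
      Polynomial.C r' * p + Polynomial.C s' * q = -(Polynomial.X * c) := by
  obtain ⟨p', rfl⟩ : c ∣ p := by
    rw [← Ideal.mem_span_singleton, ← hspan]
    exact Ideal.mem_sup_left (Ideal.mem_span_singleton_self _)
  obtain ⟨q', rfl⟩ : c ∣ q := by
    rw [← Ideal.mem_span_singleton, ← hspan]
    exact Ideal.mem_sup_right (Ideal.mem_span_singleton_self _)
  have hc0 : c ≠ 0 := by
    rintro rfl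
    simp at hpq
  have hdeg : ∀ {r : Polynomial k}, (c * r).natDegree ≤ e + 1 → r.natDegree ≤ 1 := fun {r} h => by
    by_cases hr : r = 0
    · simp [hr]
    · rw [Polynomial.natDegree_mul hc0 hr] at h
      omega
  obtain ⟨a₀, b₀, rfl⟩ := Polynomial.exists_eq_X_add_C_of_natDegree_le_one (hdeg hp)
  obtain ⟨a₁, b₁, rfl⟩ := Polynomial.exists_eq_X_add_C_of_natDegree_le_one (hdeg hq)
  obtain ⟨x, hx, y, hy, hxy⟩ := Submodule.mem_sup.mp
    (hspan.ge (Ideal.mem_span_singleton_self c))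
  obtain ⟨u, rfl⟩ := Ideal.mem_span_singleton'.mp hx
  obtain ⟨v, rfl⟩ := Ideal.mem_span_singleton'.mp hy
  have huv : u * (Polynomial.C a₀ * Polynomial.X + Polynomial.C b₀) +
      v * (Polynomial.C a₁ * Polynomial.X + Polynomial.C b₁) = 1 := by
    apply mul_left_cancel₀ hc0
    linear_combination hxy
  have hcoeff : ∀ a b : k, (c * (Polynomial.C a * Polynomial.X + Polynomial.C b)).coeff (e + 1) =
      c.coeff e * a := fun a b => by
    rw [mul_add, Polynomial.coeff_add, Polynomial.coeff_mul_C, ← mul_assoc, Polynomial.coeff_mul_X,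
      Polynomial.coeff_mul_C, Polynomial.coeff_eq_zero_of_natDegree_lt (n := e + 1) (by omega),
      zero_mul, add_zero]
  rw [hcoeff, hcoeff] at hpq
  -- One of the linear cofactors has a nonzero leading coefficient, hence a root. A zero determinant
  -- would make it a root of both, against the Bézout identity `huv`.
  have hdet : a₀ * b₁ - a₁ * b₀ ≠ 0 := by
    intro hdet
    have key : ∀ t : k, a₀ * t + b₀ = 0 → a₁ * t + b₁ = 0 → False := fun t h₀ h₁ => by
      have := congrArg (Polynomial.eval t) huv
      simp [h₀, h₁] at this
    rcases hpq with h | h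
    · have h0 := right_ne_zero_of_mul h
      refine key (-b₀ / a₀) (by field_simp; ring) ?_
      field_simp
      linear_combination hdet
    · have h0 := right_ne_zero_of_mul h
      refine key (-b₁ / a₁) ?_ (by field_simp; ring)
      field_simp
      linear_combination -hdet
  set D := a₀ * b₁ - a₁ * b₀ with hD
  have hDC : Polynomial.C D⁻¹ * (Polynomial.C a₀ * Polynomial.C b₁ -
      Polynomial.C a₁ * Polynomial.C b₀) = 1 := by
    rw [← Polynomial.C_mul, ← Polynomial.C_mul, ← Polynomial.C_sub, ← Polynomial.C_mul, ← hD,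
      inv_mul_cancel₀ hdet, Polynomial.C_1]
  -- By Cramer's rule these combinations of the cofactors are 1 and -X.
  refine ⟨-(D⁻¹ * a₁), D⁻¹ * a₀, -(D⁻¹ * b₁), D⁻¹ * b₀, ?_, ?_, ?_⟩
  · have : -(D⁻¹ * a₁) * (D⁻¹ * b₀) - D⁻¹ * a₀ * -(D⁻¹ * b₁) = D⁻¹ * (D⁻¹ * D) := by
      rw [hD]
      ring
    rw [this, inv_mul_cancel₀ hdet, mul_one]
    exact inv_ne_zero hdet
  · simp only [Polynomial.C_neg, Polynomial.C_mul]
    linear_combination c * hDC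
  · simp only [Polynomial.C_neg, Polynomial.C_mul]
    linear_combination -c * Polynomial.X * hDC

lemma span_pencil_eq {A : Type*} [CommRing A] [Algebra k A] {r s r' s' : k}
    (h : r * s' - s * r' ≠ 0) (x y : A) :
    Ideal.span {r • x + s • y} ⊔ Ideal.span {r' • x + s' • y} =
      Ideal.span {x} ⊔ Ideal.span {y} := by
  have hx : x = (r * s' - s * r')⁻¹ • (s' • (r • x + s • y) - s • (r' • x + s' • y)) := by
    rw [eq_inv_smul_iff₀ h]
    module
  have hy : y = (r * s' - s * r')⁻¹ • (r • (r' • x + s' • y) - r' • (r • x + s • y)) := by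
    rw [eq_inv_smul_iff₀ h]
    module
  have hmem : ∀ (I : Ideal A) (c : k) {z : A}, z ∈ I → c • z ∈ I := fun I c z hz => by
    rw [Algebra.smul_def]
    exact I.mul_mem_left _ hz
  have hL : ∀ {x y : A}, x ∈ Ideal.span {x} ⊔ Ideal.span {y} :=
    Ideal.mem_sup_left (Ideal.mem_span_singleton_self _)
  have hR : ∀ {x y : A}, y ∈ Ideal.span {x} ⊔ Ideal.span {y} :=
    Ideal.mem_sup_right (Ideal.mem_span_singleton_self _)
  apply le_antisymm
  · simp only [sup_le_iff, Ideal.span_le, Set.singleton_subset_iff, SetLike.mem_coe]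
    exact ⟨add_mem (hmem _ _ hL) (hmem _ _ hR), add_mem (hmem _ _ hL) (hmem _ _ hR)⟩
  · simp only [sup_le_iff, Ideal.span_le, Set.singleton_subset_iff, SetLike.mem_coe]
    constructor
    · nth_rw 3 [hx]
      exact hmem _ _ (sub_mem (hmem _ _ hL) (hmem _ _ hR))
    · nth_rw 3 [hy]
      exact hmem _ _ (sub_mem (hmem _ _ hR) (hmem _ _ hL))

end Pencils

/-! ### Linkage in a commutative ring -/

section Linkage

variable {A : Type*} [CommRing A]

lemma le_sup_of_comaximal {Z G K L : Ideal A} (hK : Z ⊓ G ≤ K) (hZL : Z ⊔ L = ⊤) :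
    G ≤ K ⊔ L := by
  calc G = (Z ⊔ L) * G := by rw [hZL, Ideal.top_mul]
    _ = Z * G ⊔ L * G := Ideal.sup_mul _ _ _
    _ ≤ K ⊔ L := sup_le_sup (Ideal.mul_le_inf.trans hK) Ideal.mul_le_left

/-- An ideal comaximal with `l` contains `y` whenever it contains `l * y`. Both sides are comaximal
with `l`, and multiplication by `l` carries each into the other. -/
lemma eq_sup_span_of_linked {Z G K : Ideal A} {l x : A} (hK : K = Z ⊓ G) (hl : l ∈ G)
    (hZ : Z ⊔ Ideal.span {l} = ⊤) (hx : l * x ∈ K) (h : K ⊔ Ideal.span {x} ⊔ Ideal.span {l} = ⊤) :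
    Z = K ⊔ Ideal.span {x} := by
  have key : ∀ {I : Ideal A} {y : A}, I ⊔ Ideal.span {l} = ⊤ → l * y ∈ I → y ∈ I := by
    intro I y hI hy
    obtain ⟨w, hw, v, hv, h1⟩ := Submodule.mem_sup.mp ((Ideal.eq_top_iff_one _).mp hI)
    obtain ⟨r, rfl⟩ := Ideal.mem_span_singleton'.mp hv
    have : y = y * w + r * (l * y) := by linear_combination -y * h1
    rw [this]
    exact add_mem (I.mul_mem_left _ hw) (I.mul_mem_left _ hy)
  apply le_antisymm
  · intro z hz
    refine key h (Ideal.mem_sup_left ?_)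
    rw [hK]
    exact ⟨Z.mul_mem_left _ hz, G.mul_mem_right _ hl⟩
  · refine sup_le (hK.le.trans inf_le_left) ?_
    rw [Ideal.span_le, Set.singleton_subset_iff]
    exact key hZ ((hK.le.trans inf_le_left) hx)

/-- Eliminating `x₁` between the relation and the expression of `l * z` leaves a multiple of `x₀`,
from which `l` can be cancelled as `l`, `x₀` behave like a regular sequence. The result puts `y₁ *
z` in `P`. -/
lemma mem_of_linked [IsDomain A] {P : Ideal A} [P.IsPrime] {l x₀ x₁ x₂ y₀ y₁ z a b : A}
    (hrel : y₀ * x₀ + y₁ * x₁ + l * x₂ = 0) (hz : l * z = a * x₀ + b * x₁) (hzP : z ∉ P)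
    (hx₀ : x₀ ∈ P) (hx₂ : x₂ ∈ P) (hl : l ≠ 0) (hdvd : ∀ c, l ∣ c * x₀ → l ∣ c) : y₁ ∈ P := by
  by_contra hy
  have h1 : l * (y₁ * z + b * x₂) = (y₁ * a - b * y₀) * x₀ := by
    linear_combination y₁ * hz + b * hrel
  obtain ⟨c, hc⟩ := hdvd _ ⟨_, h1.symm⟩
  rw [hc, mul_assoc] at h1
  have h2 : y₁ * z = c * x₀ - b * x₂ := by
    linear_combination mul_left_cancel₀ hl h1
  have h3 : y₁ * z ∈ P := by
    rw [h2]
    exact sub_mem (P.mul_mem_left _ hx₀) (P.mul_mem_left _ hx₂)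
  rcases Ideal.IsPrime.mem_or_mem ‹_› h3 with h | h
  · exact hy h
  · exact hzP h

end Linkage

namespace Frame

variable (E : Frame k)

lemma form_two_prime : Prime (E.form 2) := by
  refine ⟨E.form_two_ne_zero, fun h => ?_, fun a b h => ?_⟩
  · have h1 := (E.restrict_eq_zero_iff (F := 1)).mpr h.dvd
    rw [map_one] at h1
    exact one_ne_zero h1
  · rw [← restrict_eq_zero_iff, map_mul, mul_eq_zero] at h
    exact h.imp E.restrict_eq_zero_iff.mp E.restrict_eq_zero_iff.mp

lemma exists_eq_form_two_mul {G : MvPolynomial (Fin 3) k} {d : ℕ} (hG : G ∈ grading k (d + 1))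
    (h : E.form 2 ∣ G) : ∃ H ∈ grading k d, G = E.form 2 * H := by
  obtain ⟨m, rfl⟩ := h
  have h1 := DirectSum.coe_decompose_mul_add_of_left_mem (grading k) (j := d) (b := m)
    (E.form_mem 2)
  rw [add_comm 1 d, DirectSum.decompose_of_mem_same _ hG] at h1
  exact ⟨_, SetLike.coe_mem _, h1⟩

/-- The linear form is prime and does not divide `F`. The condition `hunit` rules out that it
divides a power of the coordinate inverted on the chart. -/
lemma dvd_of_dvd_mul_toChart {i : Fin 3} (hunit : ¬ IsUnit (toChart (coord_mem k i) (E.form 2)))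
    {F : MvPolynomial (Fin 3) k} {d : ℕ} (hF : F ∈ grading k d) (h : ¬ E.form 2 ∣ F)
    (c : Chart k (coord k i))
    (hc : toChart (coord_mem k i) (E.form 2) ∣ c * toChart (coord_mem k i) F) :
    toChart (coord_mem k i) (E.form 2) ∣ c := by
  obtain ⟨m, G, hG, rfl⟩ := exists_toChart_eq (coord_mem k i) c
  have hJ : (Ideal.span {E.form 2}).IsHomogeneous (grading k) :=
    isHomogeneous_span (by rintro _ rfl; exact ⟨1, E.form_mem 2⟩)
  rw [← map_mul, ← Ideal.mem_span_singleton, ← Set.image_singleton, ← Ideal.map_span,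
    toChart_mem_map_iff (coord_mem k i) hJ (SetLike.mul_mem_graded hG hF)] at hc
  obtain ⟨n, hn⟩ := hc
  rw [Ideal.mem_span_singleton] at hn
  rcases E.form_two_prime.dvd_or_dvd hn with h1 | h1
  · refine absurd (isUnit_of_dvd_one ?_) hunit
    rw [← toChart_self (coord_mem k i)]
    exact map_dvd _ (E.form_two_prime.dvd_of_dvd_pow h1)
  · rcases E.form_two_prime.dvd_or_dvd h1 with h2 | h2
    · exact map_dvd _ h2
    · exact absurd h2 h

end Frame

end

/-! ### From linked subschemes to sections -/

section

variable {k : Type u} [Field k]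

/-- If the components of a form in a frame cut out, together with the last coordinate `l`, a
subscheme linked to `Z` by the first two components, then `Z` is the zero scheme of the form. -/
lemma map_span_eq_of_linked {i : Fin 3} (E : Frame k) {G : Fin 3 → MvPolynomial (Fin 3) k} {d : ℕ}
    (hG : ∀ a, G a ∈ grading k d) (hrel : ∑ a, E.form a * G a = 0)
    (h₀ : ¬ E.form 2 ∣ G 0) (h₁ : ¬ E.form 2 ∣ G 1) {I I' : Ideal (Chart k (coord k i))}
    (hI : (Ideal.span {G 0} ⊔ Ideal.span {G 1}).map (toChart (coord_mem k i)) = I ⊓ I')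
    (hl : toChart (coord_mem k i) (E.form 2) ∈ I')
    (hIl : I ⊔ Ideal.span {toChart (coord_mem k i) (E.form 2)} = ⊤) :
    I = (Ideal.span (Set.range G)).map (toChart (coord_mem k i)) := by
  set τ := toChart (coord_mem k i) with hτ
  have hrel' := congrArg τ hrel
  rw [Fin.sum_univ_three, map_zero] at hrel'
  simp only [map_add, map_mul] at hrel'
  rw [span_range_fin_three, Ideal.map_sup, Ideal.map_span _ {G 2}, Set.image_singleton]
  refine eq_sup_span_of_linked hI hl hIl ?_ ?_
  · have : τ (E.form 2) * τ (G 2) =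
        -τ (E.form 0) * τ (G 0) + -τ (E.form 1) * τ (G 1) := by
      linear_combination hrel'
    rw [this]
    exact add_mem
      (Ideal.mul_mem_left _ _ (Ideal.mem_map_of_mem _
        (Ideal.mem_sup_left (Ideal.mem_span_singleton_self _))))
      (Ideal.mul_mem_left _ _ (Ideal.mem_map_of_mem _
        (Ideal.mem_sup_right (Ideal.mem_span_singleton_self _))))
  -- At a point `P` of the line where all components vanish, some `z` in `I` is nonzero because `Z`
  -- misses the line, so `z` times the line form is a combination of the first two components. This
  -- forces all frame coordinates into `P`, while they generate the unit Xᵢ/Xᵢ.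
  · by_contra htop
    obtain ⟨P, hP, hle⟩ := Ideal.exists_le_maximal _ htop
    have hG₀ : τ (G 0) ∈ P := hle (Ideal.mem_sup_left (Ideal.mem_sup_left
      (Ideal.mem_map_of_mem _ (Ideal.mem_sup_left (Ideal.mem_span_singleton_self _)))))
    have hG₁ : τ (G 1) ∈ P := hle (Ideal.mem_sup_left (Ideal.mem_sup_left
      (Ideal.mem_map_of_mem _ (Ideal.mem_sup_right (Ideal.mem_span_singleton_self _)))))
    have hG₂ : τ (G 2) ∈ P := hle (Ideal.mem_sup_left (Ideal.mem_sup_right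
      (Ideal.mem_span_singleton_self _)))
    have hlP : τ (E.form 2) ∈ P := hle (Ideal.mem_sup_right (Ideal.mem_span_singleton_self _))
    have hunit : ¬ IsUnit (τ (E.form 2)) := fun h => hP.ne_top (P.eq_top_of_isUnit_mem hlP h)
    have hl0 : τ (E.form 2) ≠ 0 := fun h =>
      E.form_two_ne_zero (toChart_coord_injective i (E.form_mem 2) h)
    obtain ⟨z, hz, hzP⟩ : ∃ z ∈ I, z ∉ P := by
      by_contra! h
      apply hP.ne_top
      rw [eq_top_iff, ← hIl, sup_le_iff, Ideal.span_le, Set.singleton_subset_iff]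
      exact ⟨h, hlP⟩
    have hzmem : τ (E.form 2) * z ∈ I ⊓ I' := ⟨I.mul_mem_left _ hz, I'.mul_mem_right _ hl⟩
    rw [← hI, Ideal.map_sup, Ideal.map_span, Ideal.map_span, Set.image_singleton,
      Set.image_singleton] at hzmem
    obtain ⟨x, hx, y, hy, hxy⟩ := Submodule.mem_sup.mp hzmem
    obtain ⟨a, rfl⟩ := Ideal.mem_span_singleton'.mp hx
    obtain ⟨b, rfl⟩ := Ideal.mem_span_singleton'.mp hy
    have hy₁ : τ (E.form 1) ∈ P := mem_of_linked hrel' hxy.symm hzP hG₀ hG₂ hl0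
      (E.dvd_of_dvd_mul_toChart hunit (hG 0) h₀)
    have hy₀ : τ (E.form 0) ∈ P := mem_of_linked (y₀ := τ (E.form 1)) (x₀ := τ (G 1))
      (x₁ := τ (G 0)) (a := b) (b := a) (by linear_combination hrel') (by linear_combination -hxy) hzP hG₁ hG₂ hl0
      (E.dvd_of_dvd_mul_toChart hunit (hG 1) h₁)
    apply hP.ne_top
    have h1 := congrArg τ (E.coord_eq i)
    rw [hτ, toChart_self, ← hτ, map_sum] at h1
    rw [Ideal.eq_top_iff_one, h1]
    refine Ideal.sum_mem _ fun n _ => ?_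
    rw [map_mul]
    refine P.mul_mem_left _ ?_
    fin_cases n
    exacts [hy₀, hy₁, hlP]

/-- If two curves of degree `d` link `Z` to a subscheme of degree `d - 1` of a line disjoint
from `Z`, then `Z` is the zero scheme of a section of `Ω(d + 1)`. -/
theorem exists_section_of_linked [Infinite k] {Z : (P2 k).IdealSheafData} {d : ℕ} (hd : 2 ≤ d)
    {C₀ C₁ Γ L : (P2 k).IdealSheafData} (hC₀ : IsCurve C₀ d) (hC₁ : IsCurve C₁ d)
    (hC : C₀ ⊔ C₁ = Z ⊓ Γ) (hΓ : IsZeroDimensional Γ) (hlen : length Γ = d - 1)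
    (hL : IsCurve L 1) (hLΓ : L ≤ Γ) (hdisj : Disjoint L.support Z.support) :
    ∃ s : OmegaSections k (d + 1), IsZeroScheme s Z := by
  obtain ⟨f₀, hf₀, -, hC₀⟩ := isCurve_iff.mp hC₀
  obtain ⟨f₁, hf₁, -, hC₁⟩ := isCurve_iff.mp hC₁
  obtain ⟨l, hl, hl0, hL⟩ := isCurve_iff.mp hL
  obtain ⟨a, rfl⟩ := exists_eq_linForm hl
  obtain ⟨E₀, rfl⟩ := Frame.exists_row_eq (a := a) (by
    rintro rfl
    exact hl0 (by simp [linForm]))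
  have hdisj' : ∀ i, chartIdeal Z i ⊔ Ideal.span {toChart (coord_mem k i) (E₀.form 2)} = ⊤ :=
    fun i => by
      have := disjoint_support_iff.mp hdisj i
      rwa [hL, sup_comm] at this
  have hK : ∀ i, (Ideal.span {f₀} ⊔ Ideal.span {f₁}).map (toChart (coord_mem k i)) =
      chartIdeal Z i ⊓ chartIdeal Γ i := fun i => by
    rw [← chartIdeal_inf, ← hC, chartIdeal_sup, hC₀, hC₁, Ideal.map_sup, Ideal.map_span,
      Ideal.map_span, Set.image_singleton, Set.image_singleton]
  have hlΓ : ∀ i, toChart (coord_mem k i) (E₀.form 2) ∈ chartIdeal Γ i := fun i =>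
    basicIdeal_mono (coord_mem k i) one_pos hLΓ
      ((hL i).ge (Ideal.mem_span_singleton_self _))
  set J : Ideal (MvPolynomial (Fin 3) k) :=
    Ideal.span {f₀} ⊔ Ideal.span {f₁} ⊔ Ideal.span {E₀.form 2} with hJdef
  -- Since `Z` misses the line, cutting the union of `Z` and Γ with the line leaves exactly Γ.
  have hΓJ : ∀ i, chartIdeal Γ i = J.map (toChart (coord_mem k i)) := fun i => by
    rw [hJdef, Ideal.map_sup, hK, Ideal.map_span, Set.image_singleton]
    apply le_antisymm
    · exact le_sup_of_comaximal le_rfl (hdisj' i)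
    · refine sup_le inf_le_right ?_
      rw [Ideal.span_le, Set.singleton_subset_iff]
      exact hlΓ i
  have hJ : J.IsHomogeneous (grading k) := by
    rw [hJdef, ← Ideal.span_union, ← Ideal.span_union]
    refine isHomogeneous_span ?_
    rintro _ ((rfl | rfl) | rfl)
    exacts [⟨_, hf₀⟩, ⟨_, hf₁⟩, ⟨_, E₀.form_mem 2⟩]
  have hf₀J : f₀ ∈ J := Ideal.mem_sup_left (Ideal.mem_sup_left (Ideal.mem_span_singleton_self _))
  have hf₁J : f₁ ∈ J := Ideal.mem_sup_left (Ideal.mem_sup_right (Ideal.mem_span_singleton_self _))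
  have hlJ : E₀.form 2 ∈ J := Ideal.mem_sup_right (Ideal.mem_span_singleton_self _)
  -- If the line were a component of both curves, Γ would be the whole line.
  have hndvd : ∃ F ∈ ({f₀, f₁} : Set (MvPolynomial (Fin 3) k)), ¬ E₀.form 2 ∣ F := by
    by_contra! h
    obtain ⟨G, hG, hG0⟩ := Frame.exists_restrictAffine_ne_zero E₀ hJ hΓJ hΓ
    have hle : J ≤ Ideal.span {E₀.form 2} := by
      simp only [hJdef, sup_le_iff, Ideal.span_singleton_le_span_singleton]
      exact ⟨⟨h _ (by simp), h _ (by simp)⟩, dvd_rfl⟩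
    obtain ⟨m, rfl⟩ := Ideal.mem_span_singleton.mp (hle hG)
    exact hG0 (by simp)
  obtain ⟨F, hFmem, hFdvd⟩ := hndvd
  have hFd : F ∈ grading k d := by
    rcases hFmem with rfl | rfl
    exacts [hf₀, hf₁]
  obtain ⟨E, hE, hcoeff⟩ := E₀.exists_coeff_ne_zero (by omega) hFd hFdvd
  have hE2 : E.form 2 = E₀.form 2 := by rw [Frame.form, Frame.form, hE]
  rw [← hE2] at hJdef hlJ
  simp only [← hE2] at hdisj' hlΓ
  obtain ⟨c, hc⟩ : ∃ c, Ideal.span {E.restrictAffine f₀} ⊔ Ideal.span {E.restrictAffine f₁} =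
      Ideal.span {c} := by
    obtain ⟨c, hc⟩ := (IsPrincipalIdealRing.principal
      (Ideal.span {E.restrictAffine f₀} ⊔ Ideal.span {E.restrictAffine f₁})).principal
    exact ⟨c, hc⟩
  have hmap : J.map E.restrictAffine = Ideal.span {c} := by
    rw [← hc]
    simp [hJdef, Ideal.map_sup, Ideal.map_span]
  obtain ⟨e, rfl⟩ : ∃ e, d = e + 1 := ⟨d - 1, by omega⟩
  have hce : c.natDegree = e := by
    have hFJ : F ∈ J := by
      rcases hFmem with rfl | rfl
      exacts [hf₀J, hf₁J]
    have := (Frame.length_eq_natDegree hJ hΓJ hlJ hFd hFJ hcoeff hmap).1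
    omega
  -- `natDegree` is 0 on the zero polynomial, while `e` is at least 1.
  have hc0 : c ≠ 0 := by
    rintro rfl
    rw [Polynomial.natDegree_zero] at hce
    omega
  -- The new basis of the pencil has the restrictions that the first two components of a section
  -- must have.
  obtain ⟨r, s, r', s', hdet, h₀, h₁⟩ := exists_pencil (E.natDegree_restrictAffine_le hf₀)
    (E.natDegree_restrictAffine_le hf₁)
    (by rcases hFmem with rfl | rfl
        exacts [Or.inl hcoeff, Or.inr hcoeff]) hc hce
  set g₀ := r • f₀ + s • f₁ with hg₀
  set g₁ := r' • f₀ + s' • f₁ with hg₁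
  have hg₀d : g₀ ∈ grading k (e + 1) :=
    add_mem (Submodule.smul_mem _ _ hf₀) (Submodule.smul_mem _ _ hf₁)
  have hg₁d : g₁ ∈ grading k (e + 1) :=
    add_mem (Submodule.smul_mem _ _ hf₀) (Submodule.smul_mem _ _ hf₁)
  have hρ₀ : E.restrictAffine g₀ = c := by
    rw [hg₀, map_add, map_smul, map_smul, Polynomial.smul_eq_C_mul, Polynomial.smul_eq_C_mul, h₀]
  have hρ₁ : E.restrictAffine g₁ = -(Polynomial.X * c) := by
    rw [hg₁, map_add, map_smul, map_smul, Polynomial.smul_eq_C_mul, Polynomial.smul_eq_C_mul, h₁]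
  have hndvd : ∀ {g}, E.restrictAffine g ≠ 0 → ¬ E.form 2 ∣ g := by
    rintro _ h ⟨m, rfl⟩
    exact h (by simp)
  obtain ⟨H, hH, hHeq⟩ := E.exists_eq_form_two_mul (G := E.form 0 * g₀ + E.form 1 * g₁)
    (d := e + 1) (by
      rw [add_comm (e + 1) 1]
      exact add_mem (SetLike.mul_mem_graded (E.form_mem 0) hg₀d)
        (SetLike.mul_mem_graded (E.form_mem 1) hg₁d))
    (by
      refine E.dvd_of_restrictAffine_eq_zero (d := 1 + (e + 1))
        (add_mem (SetLike.mul_mem_graded (E.form_mem 0) hg₀d)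
        (SetLike.mul_mem_graded (E.form_mem 1) hg₁d)) ?_
      rw [map_add, map_mul, map_mul, hρ₀, hρ₁, Frame.restrictAffine_form_zero,
        Frame.restrictAffine_form_one]
      ring)
  -- The sign of `H` turns the divisibility of y₀g₀ + y₁g₁ by the line into the Euler relation.
  let G : Fin 3 → MvPolynomial (Fin 3) k := ![g₀, g₁, -H]
  have hG : ∀ n, G n ∈ grading k (e + 1) := fun n => by
    fin_cases n
    exacts [hg₀d, hg₁d, neg_mem hH]
  have hrel : ∑ n, E.form n * G n = 0 := by
    rw [Fin.sum_univ_three]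
    change E.form 0 * g₀ + E.form 1 * g₁ + E.form 2 * -H = 0
    rw [hHeq]
    ring
  refine ⟨sectionOfForm (E.ofComp_mem hG) ((E.sum_X_mul_ofComp G).trans hrel), fun i => ?_⟩
  rw [zeroIdeal_sectionOfForm, ← E.span_range_comp, E.comp_ofComp]
  refine map_span_eq_of_linked E hG hrel (hndvd (by rwa [← hρ₀] at hc0)) (hndvd ?_)
    (I' := chartIdeal Γ i) ?_ (hlΓ i) (hdisj' i)
  · change E.restrictAffine g₁ ≠ 0
    rw [hρ₁]
    exact neg_ne_zero.mpr (mul_ne_zero Polynomial.X_ne_zero hc0)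
  · change (Ideal.span {g₀} ⊔ Ideal.span {g₁}).map _ = _
    rw [span_pencil_eq hdet, hK]

end

end

end PlaneForms

theorem theorem2p1 {k : Type*} [Field k] [IsAlgClosed k] (b : ℕ) (hb : 4 ≤ b)
    (Z : (PlaneForms.P2 k).IdealSheafData)
    (hdim : PlaneForms.IsZeroDimensional Z)
    (hred : AlgebraicGeometry.IsReduced Z.subscheme)
    (hlen : (PlaneForms.length Z : ℤ) = (b : ℤ) ^ 2 - 3 * b + 3) :
    ((∃ s : PlaneForms.OmegaSections k b, PlaneForms.IsZeroScheme s Z) ↔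
      ∃ C₀ ∈ PlaneForms.linearSystem Z (b - 1), ∃ C₁ ∈ PlaneForms.linearSystem Z (b - 1),
        ∃ Γ L : (PlaneForms.P2 k).IdealSheafData,
          -- the scheme-theoretic intersection of the curves is the union of `Z` and `Γ`
          C₀ ⊔ C₁ = Z ⊓ Γ ∧
          PlaneForms.IsZeroDimensional Γ ∧ PlaneForms.length Γ = b - 2 ∧
          -- `Γ` is contained in the line `L`, which is disjoint from `Z`
          PlaneForms.IsCurve L 1 ∧ L ≤ Γ ∧ Disjoint L.support Z.support) ∧
    (∀ s s' : PlaneForms.OmegaSections k b,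
      PlaneForms.IsZeroScheme s Z → PlaneForms.IsZeroScheme s' Z →
        ∃ c : k, c ≠ 0 ∧ s' = c • s) := by
  -- Writing `b = d + 1` turns both truncated subtractions into `d` and `d - 1`; the bound on `b`
  -- gives the `3 ≤ d` needed for uniqueness.
  obtain ⟨d, rfl⟩ : ∃ d, b = d + 1 := ⟨b - 1, by omega⟩
  have : Infinite k := IsAlgClosed.instInfinite
  refine ⟨⟨?_, ?_⟩, PlaneForms.exists_section_eq_smul hdim (by omega)⟩
  · rintro ⟨s, hs⟩
    obtain ⟨F, hFd, hF, rfl⟩ := PlaneForms.exists_eq_sectionOfForm s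
    exact PlaneForms.exists_linked hdim (by omega) hFd hF fun i =>
      (hs i).trans (PlaneForms.zeroIdeal_sectionOfForm hFd hF i)
  · rintro ⟨C₀, hC₀, C₁, hC₁, Γ, L, hC, hΓ, hlen, hL, hLΓ, hdisj⟩
    exact PlaneForms.exists_section_of_linked (by omega) hC₀.1 hC₁.1 hC hΓ hlen hL hLΓ hdisj
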